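/- **Problem.** Let $G=(V,E)$ be a finite simple directed graph (no loops, no parallel arcs; oppositely directed arcs $ij,ji$ are allowed) with sink $t\in V$, $n=|V|$, $m=|E|$, $n\le m$, gain factors $\gamma_{ij}>0$ and demands $b_i\in\mathbb R$. For $f:E\to\mathbb R_{\ge0}$ put $e_i(f)=\sum_{ji\in E}\gamma_{ji}f_{ji}-\sum_{ij\in E}f_{ij}-b_i$; $f$ is a generalized flow if $e_i(f)\ge 0$ for all $i\ne t$. Assume that $it\in E$ for all $i\neq t$, that a generalized flow exists, and that $\sum_{jt\in E}\gamma_{jt}f_{jt}-\sum_{tj\in E}f_{tj}$ is bounded from above over all generalized flows. **Notation.** For labels $\mu:V\to\mathbb R_{>0}$ let $\gamma^\mu_{ij}=\gamma_{ij}\mu_i/\mu_j$, $f^\mu_{ij}=f_{ij}/\mu_i$, $b^\mu_i=b_i/\mu_i$, $e^\mu_i=e_i/\mu_i$; an arc is tight if $\gamma^\mu_{ij}=1$, and $F^\mu=\{ij\in E:\gamma^\mu_{ij}<1\}$. Reverse arcs have gain $\gamma_{ji}=1/\gamma_{ij}$. The residual graph is $E_f=E\cup\{ij: ji\in E, f_{ji}>0\}$,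 the $\Delta$-fat graph is $E^\mu_f(\Delta)=E\cup\{ij:ji\in E,f^\mu_{ji}>\Delta\}$. $d_i$ is the number of arcs incident to $i$ in the current graph. $V,E,\gamma,b$ below are those of the current (contracted) graph; $n,m$ always belong to the original one. For node sets $X,Y$, $E[X,Y]$ is the set of arcs from $X$ to $Y$, $E[X]=E[X,X]$, and $F^\mu[X]=F^\mu\cap E[X]$. **Tight-Flow$(X,\mu)$**, $t\in X\subseteq V$: add a source $s$ with arcs $si$, $i\in X\setminus\{t\}$, of upper capacity $-b_i^\mu$ and lower capacity $-\infty$, to the uncapacitated tight arcs spanned by $X$; take a maximum $s$–$t$ flow $x\ge0$ on the tight arcs; return $f'_{ij}=x_{ij}\mu_i$ on tight arcs spanned by $X$ and $f'_{ij}=0$ elsewhere. **Enhanced Continuous Scaling.** *Initialize:* take a generalized flow $g$ such that no cycle in $E_g$ has gain product greater than $1$ (the output of cycle-canceling); set $\mu_t=1$ and $1/\mu_i=\max\{\gamma(P):P\text{ an }i\text{–}t\text{ walk in }E_g\}$; let $f$ be the output of Tight-Flow$(V,\mu)$, $\Delta=\max_{i\ne t}e_i^\mu$, $T_0=T=\emptyset$,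 $k=0$. While $|V|>1$, perform an *iteration*: let $N=\{t\}\cup\{i\ne t:e_i^\mu<(d_i+1)\Delta\}$. 1. If $N\cap T\ne\emptyset$: pick $p\in T_0$, $q\in N\cap T$ and a tight $p$–$q$ path in $E_f^\mu(\Delta)$; send $\Delta$ units of relabeled flow along it; if now $e_p^\mu<(d_p+2)\Delta$, remove $p$ from $T_0$; set $T=T_0$. 2. Otherwise, if some tight arc $ij$ of $E^\mu_f(\Delta)$ has $i\in T$, $j\in V\setminus T$: add one such $j$ to $T$. 3. Otherwise: (a) if $|b_i^\mu|<\Delta/(16^kn)$ for all $i\in (V\setminus T)\setminus\{t\}$, perform *Filtration*: replace $f$ on $E[V\setminus T]$ by the output of Tight-Flow$(V\setminus T,\mu)$ and set $f=0$ on $E[V\setminus T,T]$. (b) Then, if $e_i^\mu\ge(d_i+2)\Delta$ on $T_0$ and $e_i^\mu\ge (d_i+1)\Delta$ on $T$, perform *Elementary Step*; else, if some $i\in T_0$ has $e^\mu_i<(d_i+2)\Delta$, remove all such $i$ from $T_0$ and set $T=T_0$. 4. Finally, as long as there is an abundant arc $pq$, i.e. $f^\mu_{pq}\ge17m\Delta$: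 set $f=0$ on $F^\mu$, contract $pq$, replace $\Delta$ by $16\Delta$ and $k$ by $k+1$, and set $T_0=T=\emptyset$. *Elementary Step:* Let $A=F^\mu[V\setminus T]\cup E[V\setminus T,T]$. For $i\in(V\setminus T)\setminus\{t\}$ let $r_1(i)$ and $r_2(i)$ be the sums of $\gamma_{ji}f_{ji}$ over the arcs entering $i$ that are, respectively are not, in $F^\mu[V\setminus T]$, let $r_3(i)$ and $r_4(i)$ be the sums of $f_{ij}$ over the arcs leaving $i$ that are, respectively are not, in $A$, and let $\delta_i=\frac{4(d_i+2)\Delta\mu_i+r_3(i)-r_1(i)}{r_2(i)-r_4(i)-b_i}$ ($\infty$ if the denominator is $0$). Let $\alpha$ be the minimum of all these $\delta_i$ and of all $1/\gamma_{ij}^\mu$, $ij\in E[T,V\setminus T]$. If $\alpha=\infty$, set $f=0$ on the arcs of $F^\mu$ leaving $t$, and the whole algorithm returns. Otherwise divide $\Delta$ by $\alpha$, multiply $\mu_i$ by $\alpha$ for $i\in T$, divide $f$ by $\alpha$ on $A$; add every $i\in (V\setminus T)\setminus\{t\}$ with $e_i^\mu=4(d_i+2)\Delta$ to $T_0$ and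 $T$; if then some $i\in T_0$ has $e_i^\mu<(d_i+2)\Delta$, remove all such $i$ from $T_0$ and set $T=T_0$. *Contraction of $pq$:* if $p\ne t$, merge $p$ into $q$ with $c=\gamma_{pq}$; if $p=t$, merge $q$ into $p$ with $c=1/\gamma_{pq}$. Merging $r$ into $s$ with factor $c$: delete $r$; arcs $ir$, $ri$ become $is$, $si$ with gains $\gamma_{ir}c$, $\gamma_{ri}/c$ and flows $f_{ir}$, $c f_{ri}$; $b_s$ becomes $b_s+c\,b_r$; loops are removed; of two parallel arcs the larger gain is kept and the flows are added. An iteration is *shrinking* if some node belongs to $T$ at its beginning but not at the beginning of the next iteration. **Theorem.** In every execution (whatever choices are made), the total number of iterations of Enhanced Continuous Scaling is at most $390n^3m$, and at most $195n^2m$ of them are shrinking. -/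

import Mathlib

open scoped Classical

noncomputable section

namespace GenFlow

/-- A network: finitely many nodes, arcs (ordered pairs, hence no parallel arcs), gain factors and
node demands. Only the values on `arcs` and `nodes` matter. -/
structure Network (V : Type*) where
  nodes : Finset V
  arcs : Finset (V × V)
  gain : V × V → ℝ
  demand : V → ℝ

namespace Network

variable {V : Type*} (G : Network V) (t : V)

/-- The sink is a node, arcs join distinct nodes, and gain factors are positive. -/
structure WellFormed : Prop where
  sink_mem : t ∈ G.nodes
  arc_mem : ∀ a ∈ G.arcs, a.1 ∈ G.nodes ∧ a.2 ∈ G.nodes ∧ a.1 ≠ a.2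
  gain_pos : ∀ a ∈ G.arcs, 0 < G.gain a

/-- The number of arcs entering or leaving `i`. -/
def degree (i : V) : ℕ := (G.arcs.filter fun a => a.1 = i ∨ a.2 = i).card

/-- Flow arriving at `i` minus flow leaving `i`. -/
def netInflow (f : V × V → ℝ) (i : V) : ℝ :=
  (∑ a ∈ G.arcs with a.2 = i, G.gain a * f a) - ∑ a ∈ G.arcs with a.1 = i, f a

/-- The excess `e_i(f)`. -/
def excess (f : V × V → ℝ) (i : V) : ℝ := G.netInflow f i - G.demand i

/-- Generalized flows: the feasible solutions of the uncapacitated problem. -/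
def Feasible (f : V × V → ℝ) : Prop :=
  (∀ a ∈ G.arcs, 0 ≤ f a) ∧ ∀ i ∈ G.nodes.erase t, 0 ≤ G.excess f i

/-- The relabeled gain factor of an arc. -/
def relGain (μ : V → ℝ) (a : V × V) : ℝ := G.gain a * μ a.1 / μ a.2

/-- The relabeled excess. -/
def relExcess (f : V × V → ℝ) (μ : V → ℝ) (i : V) : ℝ := G.excess f i / μ i

/-- The relabeled demand. -/
def relDemand (μ : V → ℝ) (i : V) : ℝ := G.demand i / μ i

/-- The non-tight arcs `F^μ`. -/
def nonTight (μ : V → ℝ) : Finset (V × V) := G.arcs.filter fun a => G.relGain μ a < 1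

/-! Residual network -/

/-- `ResArc f i j c`: the residual network of `f` has an arc from `i` to `j` with gain `c`, either
an arc of the network, or the reverse of an arc that carries positive flow. -/
def ResArc (f : V × V → ℝ) (i j : V) (c : ℝ) : Prop :=
  ((i, j) ∈ G.arcs ∧ c = G.gain (i, j)) ∨
    ((j, i) ∈ G.arcs ∧ 0 < f (j, i) ∧ c = 1 / G.gain (j, i))

/-- `ResWalk f i k L c`: there is a walk from `i` to `k` in the residual network of `f`, with the
product of the gains equal to `c`; `L` lists the nodes of the walk except for the last one. -/
inductive ResWalk (f : V × V → ℝ) : V → V → List V → ℝ → Prop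
  | nil (i : V) : ResWalk f i i [] 1
  | cons {i j k : V} {L : List V} {c c' : ℝ} :
      G.ResArc f i j c → ResWalk f j k L c' → ResWalk f i k (i :: L) (c * c')

/-- The residual network has a cycle whose gains have a product greater than 1. -/
def HasFlowGeneratingCycle (f : V × V → ℝ) : Prop :=
  ∃ i L c, G.ResWalk f i i L c ∧ L ≠ [] ∧ L.Nodup ∧ 1 < c

/-! The subroutine Tight-Flow -/

/-- The tight arcs spanned by `S`. -/
def tightArcs (μ : V → ℝ) (S : Finset V) : Finset (V × V) :=
  G.arcs.filter fun a => a.1 ∈ S ∧ a.2 ∈ S ∧ G.relGain μ a = 1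

/-- Feasible flows of the auxiliary network on `S` and a new source: `x` is the flow on the tight
arcs spanned by `S`, which are uncapacitated, and `y i` is the flow on the arc from the source to
`i`, which has lower capacity `-∞` and upper capacity `-b_i^μ`. -/
def IsAuxFlow (μ : V → ℝ) (S : Finset V) (x : V × V → ℝ) (y : V → ℝ) : Prop :=
  (∀ a ∈ G.tightArcs μ S, 0 ≤ x a) ∧
  ∀ i ∈ S.erase t, y i ≤ - G.relDemand μ i ∧
    y i + (∑ a ∈ G.tightArcs μ S with a.2 = i, x a) = ∑ a ∈ G.tightArcs μ S with a.1 = i, x a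

/-- `f'` is a possible output of Tight-Flow on `S` with the labels `μ`: it comes from a flow of the
auxiliary network that has maximum value. -/
def IsTightFlow (μ : V → ℝ) (S : Finset V) (f' : V × V → ℝ) : Prop :=
  ∃ x y, G.IsAuxFlow t μ S x y ∧
    (∀ x' y', G.IsAuxFlow t μ S x' y' → ∑ i ∈ S.erase t, y' i ≤ ∑ i ∈ S.erase t, y i) ∧
    f' = fun a => if a ∈ G.tightArcs μ S then x a * μ a.1 else 0

/-! Tight paths in the fat graph -/

/-- A tight arc `ij` of the network. -/
def FwdArc (μ : V → ℝ) (i j : V) : Prop := (i, j) ∈ G.arcs ∧ G.relGain μ (i, j) = 1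

/-- `ij` is the reverse of the arc `ji` of the network, which carries more than `Δ` units of
relabeled flow, and the relabeled gain of `ij` is 1. -/
def BwdArc (f : V × V → ℝ) (μ : V → ℝ) (Δ : ℝ) (i j : V) : Prop :=
  (j, i) ∈ G.arcs ∧ Δ < f (j, i) / μ j ∧ 1 / G.gain (j, i) * μ i / μ j = 1

/-- `FatWalk f μ Δ p q L φ`: there is a tight walk from `p` to `q` in the `Δ`-fat graph, `L` lists
its nodes except for the last one, and `φ` is the change of the flow when `Δ` units of relabeled
flow are sent along it. -/
inductive FatWalk (f : V × V → ℝ) (μ : V → ℝ) (Δ : ℝ) :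
    V → V → List V → (V × V → ℝ) → Prop
  | nil (i : V) : FatWalk f μ Δ i i [] 0
  | fwd {i j k : V} {L : List V} {φ : V × V → ℝ} :
      G.FwdArc μ i j → FatWalk f μ Δ j k L φ →
      FatWalk f μ Δ i k (i :: L) (φ + Pi.single (i, j) (Δ * μ i))
  | bwd {i j k : V} {L : List V} {φ : V × V → ℝ} :
      G.BwdArc f μ Δ i j → FatWalk f μ Δ j k L φ →
      FatWalk f μ Δ i k (i :: L) (φ - Pi.single (j, i) (Δ * μ j))

/-! Contraction -/

/-- Image of an arc when the node `r` is merged into the node `s`. -/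
def merge (r s : V) (a : V × V) : V × V :=
  (if a.1 = r then s else a.1, if a.2 = r then s else a.2)

/-- Merge the node `r` into the node `s`, where one unit at `r` is worth `c` units at `s`. Loops are
removed, and the larger gain factor is kept when two arcs become parallel. -/
def absorb (r s : V) (c : ℝ) : Network V where
  nodes := G.nodes.erase r
  arcs := (G.arcs.image (merge r s)).filter fun a => a.1 ≠ a.2
  gain := fun e => (((G.arcs.filter fun a => merge r s a = e).image fun a =>
    G.gain a * (if a.2 = r then c else 1) / (if a.1 = r then c else 1)).max).unbotD 0
  demand := fun i => if i = s then G.demand s + c * G.demand r else G.demand i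

/-- The image of a flow under the same operation; parallel arcs add up. -/
def absorbFlow (r s : V) (c : ℝ) (f : V × V → ℝ) : V × V → ℝ := fun e =>
  if e ∈ (G.absorb r s c).arcs then
    ∑ a ∈ G.arcs with merge r s a = e, f a * (if a.1 = r then c else 1)
  else 0

/-- Contraction of the arc `pq`: `p` is merged into `q` if `p` is not the sink, and `q` is merged
into `p` otherwise. -/
def contract (p q : V) : Network V :=
  if p ≠ t then G.absorb p q (G.gain (p, q)) else G.absorb q p (1 / G.gain (p, q))

/-- The image of a flow under the contraction of `pq`. -/
def contractFlow (p q : V) (f : V × V → ℝ) : V × V → ℝ :=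
  if p ≠ t then G.absorbFlow p q (G.gain (p, q)) f else G.absorbFlow q p (1 / G.gain (p, q)) f

end Network

/-- The state of the algorithm at the beginning of an iteration: the current (contracted) network,
the flow `f`, the labels `μ`, the scaling factor `Δ`, the sets `T₀` and `T`, and the number `k` of
arcs contracted so far. `halted` is set when the algorithm returns from inside Elementary Step. -/
structure State (V : Type*) where
  net : Network V
  f : V × V → ℝ
  μ : V → ℝ
  Δ : ℝ
  T₀ : Finset V
  T : Finset V
  k : ℕ
  halted : Bool

namespace State

variable {V : Type*} (t : V)

/-- Relabeled excess in the current state. -/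
def e (S : State V) (i : V) : ℝ := S.net.relExcess S.f S.μ i

/-- Degree in the current network, as a real number. -/
def d (S : State V) (i : V) : ℝ := (S.net.degree i : ℝ)

/-- The possible results of Initialize on the network `G`. Here `g` stands for the result of the
cycle-canceling procedure; nothing is used of it but that it is a generalized flow without
flow-generating cycles in its residual network. -/
def Initial (G : Network V) (S : State V) : Prop :=
  (∃ g, G.Feasible t g ∧ ¬ G.HasFlowGeneratingCycle g ∧ S.μ t = 1 ∧
    ∀ i ∈ G.nodes.erase t, IsGreatest {c : ℝ | ∃ L, G.ResWalk g i t L c} (1 / S.μ i)) ∧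
  G.IsTightFlow t S.μ G.nodes S.f ∧
  IsGreatest {x : ℝ | ∃ i ∈ G.nodes.erase t, x = G.relExcess S.f S.μ i} S.Δ ∧
  S.net = G ∧ S.T₀ = ∅ ∧ S.T = ∅ ∧ S.k = 0 ∧ S.halted = false

/-- The set `N`. -/
def low (S : State V) : Finset V :=
  insert t ((S.net.nodes.erase t).filter fun i => S.e i < (S.d i + 1) * S.Δ)

/-- Path augmentation. -/
def Augment (S S' : State V) : Prop :=
  ∃ p ∈ S.T₀, ∃ q ∈ low t S ∩ S.T, ∃ L φ,
    S.net.FatWalk S.f S.μ S.Δ p q L φ ∧ (L ++ [q]).Nodup ∧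
    let S₁ : State V := { S with f := S.f + φ }
    let U : Finset V := if S₁.e p < (S₁.d p + 2) * S₁.Δ then S.T₀.erase p else S.T₀
    S' = { S₁ with T₀ := U, T := U }

/-- `ij` is a tight arc of the fat graph that leaves `T`. -/
def Leaving (S : State V) (i j : V) : Prop :=
  i ∈ S.T ∧ j ∈ S.net.nodes \ S.T ∧ (S.net.FwdArc S.μ i j ∨ S.net.BwdArc S.f S.μ S.Δ i j)

/-- The condition for calling Filtration; `n` is the number of nodes of the original network. -/
def FiltrationCond (n : ℕ) (S : State V) : Prop :=
  ∀ i ∈ (S.net.nodes \ S.T).erase t, |S.net.relDemand S.μ i| < S.Δ / (16 ^ S.k * n)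

/-- The subroutine Filtration. -/
def Filtration (S S' : State V) : Prop :=
  ∃ f', S.net.IsTightFlow t S.μ (S.net.nodes \ S.T) f' ∧
    S' = { S with f := fun a =>
      if a ∈ S.net.arcs ∧ a.1 ∉ S.T then (if a.2 ∈ S.T then 0 else f' a) else S.f a }

/-! The subroutine Elementary Step -/

/-- The arcs on which Elementary Step decreases the flow: the non-tight arcs spanned by the
complement of `T`, and the arcs entering `T`. -/
def decreasing (S : State V) : Finset (V × V) :=
  S.net.arcs.filter fun a => a.1 ∉ S.T ∧ (a.2 ∈ S.T ∨ a ∈ S.net.nonTight S.μ)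

def r₁ (S : State V) (i : V) : ℝ :=
  ∑ a ∈ S.net.arcs with a.2 = i ∧ (a ∈ S.net.nonTight S.μ ∧ a.1 ∉ S.T ∧ a.2 ∉ S.T),
    S.net.gain a * S.f a

def r₂ (S : State V) (i : V) : ℝ :=
  ∑ a ∈ S.net.arcs with a.2 = i ∧ ¬ (a ∈ S.net.nonTight S.μ ∧ a.1 ∉ S.T ∧ a.2 ∉ S.T),
    S.net.gain a * S.f a

def r₃ (S : State V) (i : V) : ℝ :=
  ∑ a ∈ S.net.arcs with a.1 = i ∧ a ∈ S.decreasing, S.f a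

def r₄ (S : State V) (i : V) : ℝ :=
  ∑ a ∈ S.net.arcs with a.1 = i ∧ a ∉ S.decreasing, S.f a

/-- The bound `δ_i`, which is infinite if the denominator vanishes. -/
def δ (S : State V) (i : V) : WithTop ℝ :=
  if S.r₂ i - S.r₄ i - S.net.demand i = 0 then ⊤
  else (((4 * (S.d i + 2) * S.Δ * S.μ i + S.r₃ i - S.r₁ i) /
    (S.r₂ i - S.r₄ i - S.net.demand i) : ℝ) : WithTop ℝ)

/-- The value `α` of Elementary Step. -/
def α (S : State V) : WithTop ℝ :=
  min (((S.net.nodes \ S.T).erase t).inf S.δ)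
    ((S.net.arcs.filter fun a => a.1 ∈ S.T ∧ a.2 ∉ S.T).inf
      fun a => ((1 / S.net.relGain S.μ a : ℝ) : WithTop ℝ))

/-- If the excess of some node of `T₀` is too small, remove all such nodes and reset `T`. -/
def dropLow (S : State V) : State V :=
  if ∃ i ∈ S.T₀, S.e i < (S.d i + 2) * S.Δ then
    { S with
      T₀ := S.T₀.filter fun i => ¬ S.e i < (S.d i + 2) * S.Δ
      T := S.T₀.filter fun i => ¬ S.e i < (S.d i + 2) * S.Δ }
  else S

/-- Elementary Step with a finite `α`. -/
def scaleBy (a : ℝ) (S : State V) : State V :=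
  let S₁ : State V := { S with
    Δ := S.Δ / a
    μ := fun i => if i ∈ S.T then a * S.μ i else S.μ i
    f := fun c => if c ∈ S.decreasing then S.f c / a else S.f c }
  let A : Finset V :=
    ((S.net.nodes \ S.T).erase t).filter fun i => S₁.e i = 4 * (S₁.d i + 2) * S₁.Δ
  dropLow { S₁ with T₀ := S.T₀ ∪ A, T := S.T ∪ (S.T₀ ∪ A) }

/-- Elementary Step. If `α` is infinite, the flow on the non-tight arcs leaving the sink is set to
zero, and the algorithm returns. -/
def elementaryStep (S : State V) : State V :=
  match α t S with
  | ⊤ => { S with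
      f := fun c => if c.1 = t ∧ c ∈ S.net.nonTight S.μ then 0 else S.f c
      halted := true }
  | (a : ℝ) => scaleBy t a S

/-- The part of an iteration that precedes the contractions. -/
def Body (n : ℕ) (S S' : State V) : Prop :=
  if (low t S ∩ S.T).Nonempty then Augment t S S'
  else if ∃ i j, S.Leaving i j then
    ∃ i j, S.Leaving i j ∧ S' = { S with T := insert j S.T }
  else ∃ S₁, (if FiltrationCond t n S then Filtration t S S₁ else S₁ = S) ∧
    S' = if (∀ i ∈ S₁.T₀, (S₁.d i + 2) * S₁.Δ ≤ S₁.e i) ∧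
            (∀ i ∈ S₁.T, (S₁.d i + 1) * S₁.Δ ≤ S₁.e i)
      then elementaryStep t S₁ else dropLow S₁

/-- The arc `a` is abundant; `m` is the number of arcs of the original network. -/
def Abundant (m : ℕ) (S : State V) (a : V × V) : Prop :=
  a ∈ S.net.arcs ∧ 17 * m * S.Δ ≤ S.f a / S.μ a.1

/-- Contraction of one abundant arc. -/
def ContractOne (m : ℕ) (S S' : State V) : Prop :=
  ∃ p q, S.Abundant m (p, q) ∧
    S' = { S with
      net := S.net.contract t p q
      f := S.net.contractFlow t p q fun a => if a ∈ S.net.nonTight S.μ then 0 else S.f a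
      Δ := 16 * S.Δ
      T₀ := ∅
      T := ∅
      k := S.k + 1 }

/-- One iteration of the while loop of Enhanced Continuous Scaling: it starts only if more than one
node is left and the algorithm has not returned; its last part contracts abundant arcs until there
are none, unless the algorithm returns before. -/
def Iteration (n m : ℕ) (S S' : State V) : Prop :=
  S.halted = false ∧ 1 < S.net.nodes.card ∧
  ∃ S₁, Body t n S S₁ ∧
    if S₁.halted then S' = S₁
    else Relation.ReflTransGen (ContractOne t m) S₁ S' ∧ ∀ a, ¬ S'.Abundant m a

end State

/-- The iteration that leads from the state `S` to the state `S'` is shrinking. -/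
def Shrinking {V : Type*} (S S' : State V) : Prop := (S.T \ S'.T).Nonempty

end GenFlow

end

/-! The proof is an amortization against the potential `cost` + 13m · `deficit`.

Write x = e/Δ for the relative excess of a node of degree d. Every node except the sink contributes
between 0 and 3d+7 to `cost`, so `cost` never exceeds 13m. A node of T₀ is charged x − d − 1, hence
a path augmentation starting there lowers `cost` by one. A node outside T₀ is charged a capped
logarithm of x + d, which vanishes for x ≤ d+2 and has reached its cap 3d+7 at x = 4(d+2), where a
node enters T₀ and its active charge is 3d+7 too. Entering T₀ is therefore free, and leaving it
releases at least one unit.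

Elementary Step with factor a multiplies x + d outside T by at most a
(`StepLength.scaled_e_le_of_notMem`), so `cost` grows by at most 13m log₂ a. The growth is paid by
`deficit`, the total distance of the logarithms of the demand ratios |b^μ| 16^k n/Δ from a cap that
is valid while no arc is abundant (`Valid.demandRatio_le`). If Filtration is not performed, some
demand ratio outside T is at least 1, and it grows by the factor a, so `deficit` falls by log₂ a. If
Filtration is performed, the excesses outside T are small afterwards and no flow there is rescaled.
Then either all demand ratios outside T stay below 1, the excesses stay small and cost nothing, or
some ratio passes 1 and the jump of its level by one pays for any value of `cost`
(`Prepared.scaleBy`). A contraction raises the caps and may spoil the merged demand, but the summand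
6n per node in `deficit` covers this with 2 to spare (`absorb_valid`), which again pays for any new
value of `cost`.

An iteration that does not lower the potential by 1 does not raise it, keeps T growing and increases
`rank`, which is at most 2n+1 (`Iteration.progress`). Hence there are at most 2n+2 iterations per
unit of potential, and every shrinking iteration uses up a unit (`iterations_le`). Initially the
potential is below 104 n²m. All estimates rest on the invariant `ScaledFeasible`: arcs that are not
tight carry at most Δ, and the excesses can do without the flow arriving on them. -/

namespace GenFlow

/-! ### Relabeled networks and the feasibility invariant -/

namespace Network

variable {V : Type*}

/-- The number of arcs entering `i`. -/
noncomputable def inDegree (G : Network V) (i : V) : ℕ := (G.arcs.filter fun a => a.2 = i).card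

/-- The number of arcs leaving `i`. -/
noncomputable def outDegree (G : Network V) (i : V) : ℕ := (G.arcs.filter fun a => a.1 = i).card

/-- The relabeled flow that arrives at `i` on arcs that are not tight. -/
noncomputable def nonTightInflow (G : Network V) (f : V × V → ℝ) (μ : V → ℝ) (i : V) : ℝ :=
  ∑ a ∈ G.arcs with a.2 = i ∧ G.relGain μ a < 1, G.relGain μ a * (f a / μ a.1)

/-- The labels are positive and the relabeled gains of all arcs are at most 1. -/
structure Labeling (G : Network V) (t : V) (μ : V → ℝ) : Prop where
  wf : G.WellFormed t
  label_pos : ∀ i ∈ G.nodes, 0 < μ i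
  relGain_le : ∀ a ∈ G.arcs, G.relGain μ a ≤ 1

/-- The flow is nonnegative, it is at most `Δ` (after relabeling) on arcs that are not tight, and the
excesses stay nonnegative, but not too large, when the flow on these arcs is deleted. -/
structure ScaledFeasible (G : Network V) (t : V) (f : V × V → ℝ) (μ : V → ℝ) (Δ : ℝ) : Prop
    extends G.Labeling t μ where
  flow_nonneg : ∀ a ∈ G.arcs, 0 ≤ f a
  slack : ∀ a ∈ G.arcs, G.relGain μ a < 1 → f a / μ a.1 ≤ Δ
  nonTightInflow_le : ∀ i ∈ G.nodes.erase t, G.nonTightInflow f μ i ≤ G.relExcess f μ i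
  relExcess_le : ∀ i ∈ G.nodes.erase t, G.relExcess f μ i ≤ 4 * (G.degree i + 2) * Δ

variable {G : Network V} {t : V} {f : V × V → ℝ} {μ : V → ℝ} {Δ : ℝ}

theorem WellFormed.inDegree_add_outDegree (h : G.WellFormed t) (i : V) :
    G.inDegree i + G.outDegree i = G.degree i := by
  rw [inDegree, outDegree, degree, ← Finset.card_union_of_disjoint, ← Finset.filter_or]
  · congr 1; ext a; simp [or_comm]
  · rw [Finset.disjoint_filter]
    rintro a ha h2 h1
    exact (h.arc_mem a ha).2.2 (h1.trans h2.symm)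

theorem WellFormed.inDegree_add_outDegree_cast (h : G.WellFormed t) (i : V) :
    (G.inDegree i : ℝ) + G.outDegree i = G.degree i := by
  exact_mod_cast h.inDegree_add_outDegree i

theorem WellFormed.sum_degree_le (h : G.WellFormed t) (s : Finset V) :
    ∑ i ∈ s, (G.degree i : ℝ) ≤ 2 * G.arcs.card := by
  have h1 : ∑ i ∈ s, G.inDegree i ≤ G.arcs.card := by
    refine le_trans (le_of_eq ?_) (Finset.card_filter_le G.arcs fun a => Prod.snd a ∈ s)
    unfold inDegree
    convert Finset.sum_card_fiberwise_eq_card_filter G.arcs s Prod.snd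
  have h2 : ∑ i ∈ s, G.outDegree i ≤ G.arcs.card := by
    refine le_trans (le_of_eq ?_) (Finset.card_filter_le G.arcs fun a => Prod.fst a ∈ s)
    unfold outDegree
    convert Finset.sum_card_fiberwise_eq_card_filter G.arcs s Prod.fst
  have h3 : ∑ i ∈ s, G.degree i ≤ 2 * G.arcs.card := by
    simp_rw [← h.inDegree_add_outDegree, Finset.sum_add_distrib]
    omega
  exact_mod_cast h3

theorem WellFormed.inDegree_le (h : G.WellFormed t) (i : V) : G.inDegree i ≤ G.nodes.card := by
  refine Finset.card_le_card_of_injOn Prod.fst ?_ ?_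
  · intro a ha
    simp only [Finset.coe_filter, Set.mem_ofPred_eq] at ha
    exact (h.arc_mem a ha.1).1
  · rintro ⟨a1, a2⟩ ha ⟨b1, b2⟩ hb hab
    simp only [Finset.coe_filter, Set.mem_ofPred_eq] at ha hb hab
    rw [hab, ha.2, hb.2]

theorem WellFormed.outDegree_le (h : G.WellFormed t) (i : V) : G.outDegree i ≤ G.nodes.card := by
  refine Finset.card_le_card_of_injOn Prod.snd ?_ ?_
  · intro a ha
    simp only [Finset.coe_filter, Set.mem_ofPred_eq] at ha
    exact (h.arc_mem a ha.1).2.1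
  · rintro ⟨a1, a2⟩ ha ⟨b1, b2⟩ hb hab
    simp only [Finset.coe_filter, Set.mem_ofPred_eq] at ha hb hab
    rw [hab, ha.2, hb.2]

theorem WellFormed.card_arcs_le (h : G.WellFormed t) : G.arcs.card ≤ G.nodes.card ^ 2 := by
  rw [sq, ← Finset.card_product]
  refine Finset.card_le_card fun a ha => ?_
  exact Finset.mem_product.2 ⟨(h.arc_mem a ha).1, (h.arc_mem a ha).2.1⟩

theorem Labeling.fst_pos (h : G.Labeling t μ) {a : V × V} (ha : a ∈ G.arcs) : 0 < μ a.1 :=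
  h.label_pos _ (h.wf.arc_mem a ha).1

theorem Labeling.snd_pos (h : G.Labeling t μ) {a : V × V} (ha : a ∈ G.arcs) : 0 < μ a.2 :=
  h.label_pos _ (h.wf.arc_mem a ha).2.1

theorem Labeling.relGain_pos (h : G.Labeling t μ) {a : V × V} (ha : a ∈ G.arcs) :
    0 < G.relGain μ a :=
  div_pos (mul_pos (h.wf.gain_pos a ha) (h.fst_pos ha)) (h.snd_pos ha)

theorem Labeling.gain_mul_div (h : G.Labeling t μ) {a : V × V} (ha : a ∈ G.arcs) :
    G.gain a * f a / μ a.2 = G.relGain μ a * (f a / μ a.1) := by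
  have := h.fst_pos ha
  have := h.snd_pos ha
  unfold relGain
  field_simp

/-- A sum of flows that arrive at `i` in relabeled form. -/
theorem Labeling.sum_gain_div (h : G.Labeling t μ) (i : V) (p : V × V → Prop)
    [DecidablePred fun a : V × V => a.2 = i ∧ p a] :
    (∑ a ∈ G.arcs with a.2 = i ∧ p a, G.gain a * f a) / μ i =
      ∑ a ∈ G.arcs with a.2 = i ∧ p a, G.relGain μ a * (f a / μ a.1) := by
  rw [Finset.sum_div]
  refine Finset.sum_congr rfl fun a ha => ?_
  simp only [Finset.mem_filter] at ha
  rw [← h.gain_mul_div ha.1, ha.2.1]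

theorem sum_div_label (i : V) (p : V × V → Prop) [DecidablePred fun a : V × V => a.1 = i ∧ p a] :
    (∑ a ∈ G.arcs with a.1 = i ∧ p a, f a) / μ i =
      ∑ a ∈ G.arcs with a.1 = i ∧ p a, f a / μ a.1 := by
  rw [Finset.sum_div]
  refine Finset.sum_congr rfl fun a ha => ?_
  simp only [Finset.mem_filter] at ha
  rw [ha.2.1]

theorem Labeling.relExcess_eq (h : G.Labeling t μ) (f : V × V → ℝ) (i : V) :
    G.relExcess f μ i = (∑ a ∈ G.arcs with a.2 = i, G.relGain μ a * (f a / μ a.1)) -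
      (∑ a ∈ G.arcs with a.1 = i, f a / μ a.1) - G.relDemand μ i := by
  have h1 := h.sum_gain_div (f := f) i (fun _ => True)
  have h2 := sum_div_label (G := G) (f := f) (μ := μ) i (fun _ => True)
  simp only [and_true] at h1 h2
  rw [relExcess, excess, netInflow, relDemand, sub_div, sub_div, h1, h2]

theorem Labeling.relGain_mul_le (h : G.Labeling t μ) {a : V × V} (ha : a ∈ G.arcs) {c : ℝ}
    (hx : 0 ≤ f a) (hc : f a / μ a.1 ≤ c) : G.relGain μ a * (f a / μ a.1) ≤ c := by
  have h1 := h.relGain_le a ha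
  have h2 : 0 ≤ f a / μ a.1 := div_nonneg hx (h.fst_pos ha).le
  nlinarith

theorem Labeling.relGain_mul_nonneg (h : G.Labeling t μ) {a : V × V} (ha : a ∈ G.arcs)
    (hx : 0 ≤ f a) : 0 ≤ G.relGain μ a * (f a / μ a.1) :=
  mul_nonneg (h.relGain_pos ha).le (div_nonneg hx (h.fst_pos ha).le)

/-- If the relabeled flow on some of the arcs that enter `i` is at most `c`, then at most `c` times
the in-degree arrives there. -/
theorem Labeling.sum_in_le (h : G.Labeling t μ) {c : ℝ} (hc : 0 ≤ c) (i : V) (p : V × V → Prop)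
    [DecidablePred fun a : V × V => a.2 = i ∧ p a]
    (hp : ∀ a ∈ G.arcs, a.2 = i → p a → 0 ≤ f a ∧ f a / μ a.1 ≤ c) :
    ∑ a ∈ G.arcs with a.2 = i ∧ p a, G.relGain μ a * (f a / μ a.1) ≤ G.inDegree i * c := by
  calc _ ≤ ∑ a ∈ G.arcs with a.2 = i ∧ p a, c := by
        refine Finset.sum_le_sum fun a ha => ?_
        simp only [Finset.mem_filter] at ha
        exact h.relGain_mul_le ha.1 (hp a ha.1 ha.2.1 ha.2.2).1 (hp a ha.1 ha.2.1 ha.2.2).2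
    _ ≤ ∑ a ∈ G.arcs with a.2 = i, c := by
        refine Finset.sum_le_sum_of_subset_of_nonneg ?_ fun _ _ _ => hc
        intro a ha
        simp only [Finset.mem_filter] at ha ⊢
        exact ⟨ha.1, ha.2.1⟩
    _ = _ := by simp [inDegree]

theorem sum_out_le {c : ℝ} (hc : 0 ≤ c) (i : V) (p : V × V → Prop)
    [DecidablePred fun a : V × V => a.1 = i ∧ p a]
    (hp : ∀ a ∈ G.arcs, a.1 = i → p a → f a / μ a.1 ≤ c) :
    ∑ a ∈ G.arcs with a.1 = i ∧ p a, f a / μ a.1 ≤ G.outDegree i * c := by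
  calc _ ≤ ∑ a ∈ G.arcs with a.1 = i ∧ p a, c := by
        refine Finset.sum_le_sum fun a ha => ?_
        simp only [Finset.mem_filter] at ha
        exact hp a ha.1 ha.2.1 ha.2.2
    _ ≤ ∑ a ∈ G.arcs with a.1 = i, c := by
        refine Finset.sum_le_sum_of_subset_of_nonneg ?_ fun _ _ _ => hc
        intro a ha
        simp only [Finset.mem_filter] at ha ⊢
        exact ⟨ha.1, ha.2.1⟩
    _ = _ := by simp [outDegree]

theorem ScaledFeasible.nonTightInflow_nonneg (h : G.ScaledFeasible t f μ Δ) (i : V) :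
    0 ≤ G.nonTightInflow f μ i := by
  refine Finset.sum_nonneg fun a ha => ?_
  simp only [Finset.mem_filter] at ha
  exact h.relGain_mul_nonneg ha.1 (h.flow_nonneg a ha.1)

theorem ScaledFeasible.relExcess_nonneg (h : G.ScaledFeasible t f μ Δ) {i : V}
    (hi : i ∈ G.nodes.erase t) : 0 ≤ G.relExcess f μ i :=
  (h.nonTightInflow_nonneg i).trans (h.nonTightInflow_le i hi)

theorem ScaledFeasible.nonTightInflow_le_inDegree (h : G.ScaledFeasible t f μ Δ) (hΔ : 0 ≤ Δ)
    (i : V) : G.nonTightInflow f μ i ≤ G.inDegree i * Δ :=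
  h.sum_in_le hΔ i _ fun a ha _ hp => ⟨h.flow_nonneg a ha, h.slack a ha hp⟩

/-- Demands are bounded in terms of a bound on the flow. -/
theorem ScaledFeasible.abs_relDemand_le (h : G.ScaledFeasible t f μ Δ) {c : ℝ}
    (hc : 0 ≤ c) (hf : ∀ a ∈ G.arcs, f a / μ a.1 ≤ c) {i : V} (hi : i ∈ G.nodes.erase t) :
    |G.relDemand μ i| ≤ G.nodes.card * c + 4 * (G.degree i + 2) * Δ := by
  have h0 := h.relExcess_eq f i
  have h1 := h.sum_in_le hc (f := f) i (fun _ => True)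
    (fun a ha _ _ => ⟨h.flow_nonneg a ha, hf a ha⟩)
  have h2 := sum_out_le (G := G) (f := f) (μ := μ) hc i (fun _ => True) (fun a ha _ _ => hf a ha)
  have h3 : 0 ≤ ∑ a ∈ G.arcs with a.2 = i, G.relGain μ a * (f a / μ a.1) := by
    refine Finset.sum_nonneg fun a ha => ?_
    simp only [Finset.mem_filter] at ha
    exact h.relGain_mul_nonneg ha.1 (h.flow_nonneg a ha.1)
  have h4 : 0 ≤ ∑ a ∈ G.arcs with a.1 = i, f a / μ a.1 := by
    refine Finset.sum_nonneg fun a ha => ?_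
    simp only [Finset.mem_filter] at ha
    exact div_nonneg (h.flow_nonneg a ha.1) (h.fst_pos ha.1).le
  have h5 := h.relExcess_nonneg hi
  have h6 := h.relExcess_le i hi
  have h7 : (G.inDegree i : ℝ) ≤ G.nodes.card := by exact_mod_cast h.wf.inDegree_le i
  have h8 : (G.outDegree i : ℝ) ≤ G.nodes.card := by exact_mod_cast h.wf.outDegree_le i
  simp only [and_true] at h1 h2
  have h9 := mul_le_mul_of_nonneg_right h7 hc
  have h10 := mul_le_mul_of_nonneg_right h8 hc
  rw [abs_le]
  constructor <;> linarith

end Network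

/-! ### Labels from walks of maximum gain, and maximum flows on tight arcs -/

namespace Network

variable {V : Type*} {G : Network V} {t : V} {f : V × V → ℝ} {μ : V → ℝ} {Δ : ℝ}

theorem ResArc.pos (h : G.WellFormed t) {i j : V} {c : ℝ} (hc : G.ResArc f i j c) : 0 < c := by
  rcases hc with ⟨ha, rfl⟩ | ⟨ha, _, rfl⟩
  · exact h.gain_pos _ ha
  · exact one_div_pos.2 (h.gain_pos _ ha)

theorem ResWalk.pos (h : G.WellFormed t) {i k : V} {L : List V} {c : ℝ}
    (hw : G.ResWalk f i k L c) : 0 < c := by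
  induction hw with
  | nil => exact one_pos
  | cons ha _ ih => exact mul_pos (ha.pos h) ih

theorem ResWalk.append {i j k : V} {L L' : List V} {c c' : ℝ}
    (h : G.ResWalk f i j L c) (h' : G.ResWalk f j k L' c') :
    G.ResWalk f i k (L ++ L') (c * c') := by
  induction h with
  | nil => simpa using h'
  | cons ha _ ih => rw [mul_assoc]; exact .cons ha (ih h')

theorem ResWalk.split {k v : V} {L₂ : List V} (L₁ : List V) : ∀ {i : V} {c : ℝ},
    G.ResWalk f i k (L₁ ++ v :: L₂) c →
    ∃ c₁ c₂, G.ResWalk f i v L₁ c₁ ∧ G.ResWalk f v k (v :: L₂) c₂ ∧ c = c₁ * c₂ := by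
  induction L₁ with
  | nil =>
    intro i c h
    obtain ⟨ha, hw⟩ : i = v ∧ G.ResWalk f i k (v :: L₂) c := by
      cases h with
      | cons ha hw => exact ⟨rfl, .cons ha hw⟩
    subst ha
    exact ⟨1, c, .nil i, hw, (one_mul c).symm⟩
  | cons u L₁ ih =>
    intro i c h
    cases h with
    | cons ha hw =>
      obtain ⟨c₁, c₂, h₁, h₂, rfl⟩ := ih hw
      exact ⟨_, c₂, .cons ha h₁, h₂, (mul_assoc _ _ _).symm⟩

theorem exists_repetition {W : Type*} : ∀ {l : List W}, ¬ l.Nodup →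
    ∃ A v B C, l = A ++ v :: (B ++ v :: C)
  | [], h => absurd List.nodup_nil h
  | u :: l, h => by
    by_cases hu : u ∈ l
    · obtain ⟨B, C, rfl⟩ := List.append_of_mem hu
      exact ⟨[], u, B, C, rfl⟩
    · have : ¬ l.Nodup := fun hl => h (List.nodup_cons.2 ⟨hu, hl⟩)
      obtain ⟨A, v, B, C, rfl⟩ := exists_repetition this
      exact ⟨u :: A, v, B, C, rfl⟩

/-- Without flow-generating cycles, no closed walk has gain greater than 1. -/
theorem ResWalk.gain_le_one (h : G.WellFormed t) (hno : ¬ G.HasFlowGeneratingCycle f) :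
    ∀ (ℓ : ℕ) {L : List V} {i : V} {c : ℝ}, L.length ≤ ℓ → G.ResWalk f i i L c → c ≤ 1 := by
  intro ℓ
  induction ℓ with
  | zero =>
    intro L i c hL hw
    obtain rfl : L = [] := List.length_eq_zero_iff.1 (by omega)
    cases hw
    exact le_rfl
  | succ ℓ ih =>
    intro L i c hL hw
    by_cases hnd : L.Nodup
    · by_contra! hc
      refine hno ⟨i, L, c, hw, ?_, hnd, hc⟩
      rintro rfl
      cases hw
      exact lt_irrefl _ hc
    -- A repeated node v splits the closed walk into the closed walk along `v :: B` and the
    -- remaining closed walk; both are shorter, and their gains multiply to the total gain.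
    · obtain ⟨A, v, B, C, rfl⟩ := exists_repetition hnd
      obtain ⟨c₁, c₂, h₁, h₂, rfl⟩ := hw.split
      obtain ⟨c₃, c₄, h₃, h₄, rfl⟩ := ResWalk.split (v :: B) (by simpa using h₂)
      simp only [List.length_append, List.length_cons] at hL
      have h5 : c₃ ≤ 1 := ih (by simp only [List.length_cons]; omega) h₃
      have h6 : c₁ * c₄ ≤ 1 := ih (by simp only [List.length_append, List.length_cons]; omega)
        (h₁.append h₄)
      have h7 := h₃.pos h
      have h8 := h₁.pos h
      have h9 := h₄.pos h
      nlinarith [mul_pos h8 h9]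

/-- Labels defined by walks of maximum gain to the sink. -/
theorem WellFormed.labeling (h : G.WellFormed t) {g : V × V → ℝ}
    (hno : ¬ G.HasFlowGeneratingCycle g) (ht : μ t = 1)
    (hμ : ∀ i ∈ G.nodes.erase t,
      IsGreatest {c : ℝ | ∃ L, G.ResWalk g i t L c} (1 / μ i)) : G.Labeling t μ := by
  have hpos : ∀ i ∈ G.nodes, 0 < μ i := by
    intro i hi
    by_cases hit : i = t
    · rw [hit, ht]; exact one_pos
    · obtain ⟨L, hL⟩ := (hμ i (Finset.mem_erase.2 ⟨hit, hi⟩)).1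
      exact one_div_pos.1 (hL.pos h)
  refine ⟨h, hpos, ?_⟩
  rintro ⟨i, j⟩ ha
  obtain ⟨hi, hj, hij⟩ := h.arc_mem _ ha
  have hwj : ∃ L, G.ResWalk g j t L (1 / μ j) := by
    by_cases hjt : j = t
    · refine ⟨[], ?_⟩
      rw [hjt, ht, div_one]
      exact .nil t
    · exact (hμ j (Finset.mem_erase.2 ⟨hjt, hj⟩)).1
  obtain ⟨L, hL⟩ := hwj
  -- Prepending ij to an optimal walk from j gives a competitor at i. For i = t it is a closed walk,
  -- which the absence of flow-generating cycles controls.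
  have hw : G.ResWalk g i t (i :: L) (G.gain (i, j) * (1 / μ j)) := .cons (.inl ⟨ha, rfl⟩) hL
  have hle : G.gain (i, j) * (1 / μ j) ≤ 1 / μ i := by
    by_cases hit : i = t
    · subst hit
      rw [ht, div_one]
      exact ResWalk.gain_le_one h hno _ le_rfl hw
    · exact (hμ i (Finset.mem_erase.2 ⟨hit, hi⟩)).2 ⟨_, hw⟩
  have h1 := hpos i hi
  have h2 := hpos j hj
  simp only [relGain]
  rw [le_div_iff₀ h1] at hle
  calc G.gain (i, j) * μ i / μ j = G.gain (i, j) * (1 / μ j) * μ i := by ring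
    _ ≤ 1 := hle

theorem mem_tightArcs {S : Finset V} {a : V × V} :
    a ∈ G.tightArcs μ S ↔ a ∈ G.arcs ∧ a.1 ∈ S ∧ a.2 ∈ S ∧ G.relGain μ a = 1 := by
  simp [tightArcs]

theorem IsTightFlow.nonneg (h : G.Labeling t μ) {S : Finset V}
    (hf : G.IsTightFlow t μ S f) (a : V × V) : 0 ≤ f a := by
  obtain ⟨x, y, hxy, -, rfl⟩ := hf
  by_cases ha : a ∈ G.tightArcs μ S
  · simp only [ha, if_true]
    exact mul_nonneg (hxy.1 a ha) (h.fst_pos (mem_tightArcs.1 ha).1).le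
  · simp [ha]

theorem IsTightFlow.eq_zero {S : Finset V} (hf : G.IsTightFlow t μ S f) {a : V × V}
    (ha : a ∉ G.tightArcs μ S) : f a = 0 := by
  obtain ⟨x, y, -, -, rfl⟩ := hf
  simp [ha]

theorem IsTightFlow.eq_zero_of_lt {X : Finset V}
    (hf : G.IsTightFlow t μ X f) {a : V × V} (ha : G.relGain μ a < 1) : f a = 0 :=
  hf.eq_zero fun h => ha.ne (mem_tightArcs.1 h).2.2.2

/-- In a flow of the auxiliary network that has maximum value, an arc of the source that is far
from its capacity forces large demands. -/
theorem IsAuxFlow.gap_le {S : Finset V} {x : V × V → ℝ} {y : V → ℝ}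
    (hxy : G.IsAuxFlow t μ S x y)
    (hmax : ∀ x' y', G.IsAuxFlow t μ S x' y' → ∑ i ∈ S.erase t, y' i ≤ ∑ i ∈ S.erase t, y i)
    {i : V} (hi : i ∈ S.erase t) :
    - y i - G.relDemand μ i ≤ ∑ j ∈ S.erase t, |G.relDemand μ j| := by
  set A := G.tightArcs μ S with hA
  have hAS : ∀ a ∈ A, a.1 ∈ S ∧ a.2 ∈ S := fun a ha =>
    ⟨(mem_tightArcs.1 ha).2.1, (mem_tightArcs.1 ha).2.2.1⟩
  obtain hlt | hge := lt_or_ge (y i) (- G.relDemand μ i)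
  swap
  · exact le_trans (by linarith) (Finset.sum_nonneg fun j _ => abs_nonneg (G.relDemand μ j))
  -- A linear substitute for reachability in the residual graph: z moves one unit from i to k and is
  -- nonnegative where x has no room to decrease. Such z can be extended by one arc without any
  -- bookkeeping of paths.
  let P : V → Prop := fun k => ∃ z : V × V → ℝ, (∀ a ∈ A, x a = 0 → 0 ≤ z a) ∧
    ∀ j ∈ S.erase t, (∑ a ∈ A with a.1 = j, z a) - (∑ a ∈ A with a.2 = j, z a) =
      (if i = j then 1 else 0) - (if k = j then 1 else 0)
  -- Otherwise a small multiple of z could be added to x, and the source arc at i, which is below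
  -- its capacity, could carry more.
  have hPt : ¬ P t := by
    rintro ⟨z, hz, hdiv⟩
    have hev : ∀ᶠ ε : ℝ in nhdsWithin 0 (Set.Ioi 0),
        (∀ a ∈ A, 0 ≤ x a + ε * z a) ∧ ε < - G.relDemand μ i - y i ∧ 0 < ε := by
      refine Filter.Eventually.and ?_ (Filter.Eventually.and ?_ ?_)
      · refine (Finset.eventually_all A).2 fun a ha => ?_
        obtain h0 | h0 := (hxy.1 a ha).eq_or_lt
        · filter_upwards [self_mem_nhdsWithin] with ε hε
          have := mul_nonneg (le_of_lt (Set.mem_Ioi.1 hε)) (hz a ha h0.symm)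
          linarith
        · refine Filter.Eventually.filter_mono nhdsWithin_le_nhds ?_
          have hc : ContinuousAt (fun ε : ℝ => x a + ε * z a) 0 := by fun_prop
          have := hc.eventually (lt_mem_nhds (show 0 < x a + 0 * z a by simpa using h0))
          exact this.mono fun _ h => h.le
      · exact Filter.Eventually.filter_mono nhdsWithin_le_nhds
          (eventually_lt_nhds (by linarith))
      · exact self_mem_nhdsWithin
    obtain ⟨ε, h1, h2, h3⟩ := hev.exists
    have hflow : G.IsAuxFlow t μ S (fun a => x a + ε * z a)
        (fun j => y j + if i = j then ε else 0) := by
      refine ⟨h1, fun j hj => ⟨?_, ?_⟩⟩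
      · dsimp only
        split_ifs with hij
        · subst hij; linarith
        · have := (hxy.2 j hj).1; linarith
      · have h4 := (hxy.2 j hj).2
        have h5 := hdiv j hj
        have h6 : t ≠ j := (Finset.mem_erase.1 hj).1.symm
        simp only [Finset.sum_add_distrib, ← Finset.mul_sum]
        rw [if_neg h6, sub_zero] at h5
        have h7 : (if i = j then ε else 0) = ε * (if i = j then 1 else 0) := by split_ifs <;> simp
        rw [h7, ← h5]
        linarith
    have := hmax _ _ hflow
    rw [Finset.sum_add_distrib, Finset.sum_ite_eq, if_pos hi] at this
    linarith
  have hfwd : ∀ a ∈ A, P a.1 → P a.2 := by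
    rintro a ha ⟨z, hz, hdiv⟩
    refine ⟨z + Pi.single a 1, fun b hb hxb => ?_, fun j hj => ?_⟩
    · have h1 := hz b hb hxb
      have h2 : (0 : ℝ) ≤ (Pi.single a 1 : V × V → ℝ) b := by
        by_cases hab : b = a
        · subst hab; simp
        · simp [hab]
      exact add_nonneg h1 h2
    · have := hdiv j hj
      simp only [Pi.add_apply, Finset.sum_add_distrib, Finset.sum_pi_single', Finset.mem_filter,
        ha, true_and]
      linarith
  have hbwd : ∀ a ∈ A, 0 < x a → P a.2 → P a.1 := by
    rintro a ha hxa ⟨z, hz, hdiv⟩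
    refine ⟨z - Pi.single a 1, fun b hb hxb => ?_, fun j hj => ?_⟩
    · have hab : b ≠ a := by rintro rfl; exact hxa.ne' hxb
      simpa [hab] using hz b hb hxb
    · have := hdiv j hj
      simp only [Pi.sub_apply, Finset.sum_sub_distrib, Finset.sum_pi_single', Finset.mem_filter,
        ha, true_and]
      linarith
  have hPi : P i := ⟨0, fun _ _ _ => le_rfl, fun j _ => by simp⟩
  -- A minimum cut: no tight arc leaves R, and the arcs entering R carry no flow. Conservation on R
  -- makes the source flows into R add up to 0.
  set R := (S.erase t).filter P with hR
  have hRS : R ⊆ S.erase t := Finset.filter_subset _ _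
  have hout : ∀ a ∈ A, a.1 ∈ R → a.2 ∈ R := by
    intro a ha h1
    have h2 := hfwd a ha (Finset.mem_filter.1 h1).2
    refine Finset.mem_filter.2 ⟨Finset.mem_erase.2 ⟨?_, (hAS a ha).2⟩, h2⟩
    rintro h3
    exact hPt (h3 ▸ h2)
  have hin : ∀ a ∈ A, a.2 ∈ R → a.1 ∉ R → x a = 0 := by
    intro a ha h1 h3
    by_contra h0
    have h2 := hbwd a ha (lt_of_le_of_ne (hxy.1 a ha) (Ne.symm h0)) (Finset.mem_filter.1 h1).2
    refine h3 (Finset.mem_filter.2 ⟨Finset.mem_erase.2 ⟨?_, (hAS a ha).1⟩, h2⟩)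
    rintro h4
    exact hPt (h4 ▸ h2)
  have hs1 : ∑ j ∈ R, ∑ a ∈ A with a.1 = j, x a = ∑ a ∈ A with a.1 ∈ R, x a := by
    simp only [Finset.sum_filter]
    rw [Finset.sum_comm]
    simp
  have hs2 : ∑ j ∈ R, ∑ a ∈ A with a.2 = j, x a = ∑ a ∈ A with a.1 ∈ R, x a := by
    simp only [Finset.sum_filter]
    rw [Finset.sum_comm]
    refine Finset.sum_congr rfl fun a ha => ?_
    simp only [Finset.sum_ite_eq]
    by_cases h1 : a.1 ∈ R
    · simp [h1, hout a ha h1]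
    · by_cases h2 : a.2 ∈ R
      · simp [h1, h2, hin a ha h2 h1]
      · simp [h1, h2]
  have hs3 : ∑ j ∈ R, y j = 0 := by
    have : ∑ j ∈ R, (y j + ∑ a ∈ A with a.2 = j, x a) = ∑ j ∈ R, ∑ a ∈ A with a.1 = j, x a :=
      Finset.sum_congr rfl fun j hj => (hxy.2 j (hRS hj)).2
    rw [Finset.sum_add_distrib, hs1, hs2] at this
    linarith
  -- All gaps on R are nonnegative, so one of them is at most their sum, and in the sum the source
  -- flows cancel.
  calc - y i - G.relDemand μ i ≤ ∑ j ∈ R, (- y j - G.relDemand μ j) :=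
        Finset.single_le_sum (f := fun j => - y j - G.relDemand μ j)
          (fun j hj => by have := (hxy.2 j (hRS hj)).1; linarith) (Finset.mem_filter.2 ⟨hi, hPi⟩)
    _ = ∑ j ∈ R, - G.relDemand μ j := by
        simp only [sub_eq_add_neg, Finset.sum_add_distrib, Finset.sum_neg_distrib, hs3]
        simp
    _ ≤ ∑ j ∈ R, |G.relDemand μ j| := Finset.sum_le_sum fun j _ => neg_le_abs _
    _ ≤ _ := Finset.sum_le_sum_of_subset_of_nonneg hRS fun j _ _ => abs_nonneg _

/-- Excesses of an output of Tight-Flow. -/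
theorem IsTightFlow.relExcess_mem (h : G.Labeling t μ) {S : Finset V}
    (hf : G.IsTightFlow t μ S f) {i : V} (hi : i ∈ S.erase t) :
    0 ≤ G.relExcess f μ i ∧ G.relExcess f μ i ≤ ∑ j ∈ S.erase t, |G.relDemand μ j| := by
  have h0 : ∀ a ∉ G.tightArcs μ S, f a = 0 := fun a ha => hf.eq_zero ha
  obtain ⟨x, y, hxy, hmax, hfx⟩ := hf
  have h1 : ∀ a ∈ G.tightArcs μ S, f a / μ a.1 = x a := by
    intro a ha
    have := h.fst_pos (mem_tightArcs.1 ha).1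
    rw [hfx]
    simp only [ha, if_true]
    field_simp
  have hsub : G.tightArcs μ S ⊆ G.arcs := Finset.filter_subset _ _
  have h2 : ∑ a ∈ G.arcs with a.2 = i, G.relGain μ a * (f a / μ a.1) =
      ∑ a ∈ G.tightArcs μ S with a.2 = i, x a := by
    symm
    calc _ = ∑ a ∈ G.tightArcs μ S with a.2 = i, G.relGain μ a * (f a / μ a.1) := by
          refine Finset.sum_congr rfl fun a ha => ?_
          rw [Finset.mem_filter] at ha
          rw [h1 a ha.1, (mem_tightArcs.1 ha.1).2.2.2, one_mul]
      _ = _ := by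
          refine Finset.sum_subset (Finset.filter_subset_filter _ hsub) fun a ha hna => ?_
          rw [Finset.mem_filter] at ha hna
          rw [h0 a fun h => hna ⟨h, ha.2⟩]
          simp
  have h3 : ∑ a ∈ G.arcs with a.1 = i, f a / μ a.1 = ∑ a ∈ G.tightArcs μ S with a.1 = i, x a := by
    symm
    calc _ = ∑ a ∈ G.tightArcs μ S with a.1 = i, f a / μ a.1 := by
          refine Finset.sum_congr rfl fun a ha => ?_
          rw [Finset.mem_filter] at ha
          rw [h1 a ha.1]
      _ = _ := by
          refine Finset.sum_subset (Finset.filter_subset_filter _ hsub) fun a ha hna => ?_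
          rw [Finset.mem_filter] at ha hna
          rw [h0 a fun h => hna ⟨h, ha.2⟩]
          simp
  have h4 : G.relExcess f μ i = - y i - G.relDemand μ i := by
    rw [h.relExcess_eq, h2, h3, ← (hxy.2 i hi).2]
    ring
  rw [h4]
  exact ⟨by have := (hxy.2 i hi).1; linarith, hxy.gap_le hmax hi⟩

end Network

/-! ### Path augmentation -/

namespace Network

variable {V : Type*} {G : Network V} {t : V} {f : V × V → ℝ} {μ : V → ℝ} {Δ : ℝ}

theorem netInflow_add (f g : V × V → ℝ) (i : V) :
    G.netInflow (f + g) i = G.netInflow f i + G.netInflow g i := by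
  simp only [netInflow, Pi.add_apply, mul_add, Finset.sum_add_distrib]
  ring

theorem netInflow_single {a : V × V} (ha : a ∈ G.arcs) (v : ℝ) (i : V) :
    G.netInflow (Pi.single a v) i =
      (if a.2 = i then G.gain a * v else 0) - (if a.1 = i then v else 0) := by
  have h1 : ∀ b : V × V, G.gain b * (Pi.single a v : V × V → ℝ) b =
      (Pi.single a (G.gain a * v) : V × V → ℝ) b := by
    intro b
    by_cases hb : b = a
    · subst hb; simp
    · simp [hb]
  simp only [netInflow, h1, Finset.sum_pi_single', Finset.mem_filter, ha, true_and]

theorem BwdArc.relGain_eq (h : G.Labeling t μ) {i j : V} (hb : G.BwdArc f μ Δ i j) :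
    G.relGain μ (j, i) = 1 := by
  obtain ⟨h1, -, h3⟩ := hb
  have h4 : 0 < μ j := h.fst_pos h1
  have h5 : 0 < μ i := h.snd_pos h1
  have h6 := h.wf.gain_pos _ h1
  simp only [relGain]
  field_simp at h3 ⊢
  linarith

theorem FatWalk.of_ne_zero (h : G.Labeling t μ) {p q : V} {L : List V} {φ : V × V → ℝ}
    (hw : G.FatWalk f μ Δ p q L φ) {a : V × V} (ha : φ a ≠ 0) :
    (a ∈ G.arcs ∧ G.relGain μ a = 1) ∧ a.1 ∈ L ++ [q] ∧ a.2 ∈ L ++ [q] := by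
  have hstart : ∀ {j k : V} {L : List V} {φ : V × V → ℝ},
      G.FatWalk f μ Δ j k L φ → j ∈ L ++ [k] := by
    intro j k L φ hw
    cases hw <;> simp
  induction hw with
  | nil => exact absurd rfl ha
  | @fwd i j k L φ hb hw ih =>
    by_cases hab : a = (i, j)
    · subst hab
      have := hstart hw
      refine ⟨hb, by simp, ?_⟩
      simp only [List.cons_append, List.mem_cons]
      exact .inr this
    · have := ih (by simpa [hab] using ha)
      simp only [List.cons_append, List.mem_cons]
      exact ⟨this.1, .inr this.2.1, .inr this.2.2⟩
  | @bwd i j k L φ hb hw ih =>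
    by_cases hab : a = (j, i)
    · subst hab
      have := hstart hw
      refine ⟨⟨hb.1, hb.relGain_eq h⟩, ?_, by simp⟩
      simp only [List.cons_append, List.mem_cons]
      exact .inr this
    · have := ih (by simpa [hab] using ha)
      simp only [List.cons_append, List.mem_cons]
      exact ⟨this.1, .inr this.2.1, .inr this.2.2⟩

/-- No node is repeated, so each arc is used at most once: a backward step takes Δ units from an arc
that carries more than Δ, and nothing else is ever decreased. -/
theorem FatWalk.nonneg_or (h : G.Labeling t μ) (hΔ : 0 ≤ Δ) {p q : V} {L : List V}
    {φ : V × V → ℝ} (hw : G.FatWalk f μ Δ p q L φ) (hnd : (L ++ [q]).Nodup) (a : V × V) :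
    0 ≤ φ a ∨ (a ∈ G.arcs ∧ Δ < f a / μ a.1 ∧ - (Δ * μ a.1) ≤ φ a) := by
  induction hw with
  | nil => exact .inl le_rfl
  | @fwd i j k L φ hb hw ih =>
    simp only [List.cons_append, List.nodup_cons] at hnd
    by_cases hab : a = (i, j)
    · subst hab
      left
      have h0 : φ (i, j) = 0 := by
        by_contra h0
        exact hnd.1 (hw.of_ne_zero h h0).2.1
      have := h.fst_pos hb.1
      simp only [Pi.add_apply, h0, Pi.single_eq_same, zero_add]
      exact mul_nonneg hΔ this.le
    · simpa [hab] using ih hnd.2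
  | @bwd i j k L φ hb hw ih =>
    simp only [List.cons_append, List.nodup_cons] at hnd
    by_cases hab : a = (j, i)
    · subst hab
      right
      have h0 : φ (j, i) = 0 := by
        by_contra h0
        exact hnd.1 (hw.of_ne_zero h h0).2.2
      refine ⟨hb.1, hb.2.1, ?_⟩
      simp [h0]
    · simpa [hab] using ih hnd.2

/-- On a tight arc uj, Δμ_u units sent arrive as Δμ_j units, so the contributions cancel at the
inner nodes of the walk. -/
theorem FatWalk.netInflow_eq (h : G.Labeling t μ) {p q : V} {L : List V} {φ : V × V → ℝ}
    (hw : G.FatWalk f μ Δ p q L φ) (i : V) :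
    G.netInflow φ i = Δ * μ i * ((if i = q then 1 else 0) - (if i = p then 1 else 0)) := by
  induction hw with
  | nil => simp [netInflow]
  | @fwd u j k L φ hb hw ih =>
    have h1 := h.snd_pos hb.1
    have h2 : G.gain (u, j) * (Δ * μ u) = Δ * μ j := by
      have := hb.2
      simp only [relGain] at this
      rw [div_eq_one_iff_eq h1.ne'] at this
      calc _ = Δ * (G.gain (u, j) * μ u) := by ring
        _ = _ := by rw [this]
    rw [netInflow_add, ih, netInflow_single hb.1]
    simp only [h2, eq_comm (b := i)]
    split_ifs <;> subst_vars <;> ring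
  | @bwd u j k L φ hb hw ih =>
    have h1 := h.snd_pos hb.1
    have h2 : G.gain (j, u) * (Δ * μ j) = Δ * μ u := by
      have := hb.relGain_eq h
      simp only [relGain] at this
      rw [div_eq_one_iff_eq h1.ne'] at this
      calc _ = Δ * (G.gain (j, u) * μ j) := by ring
        _ = _ := by rw [this]
    have h3 : φ - Pi.single (j, u) (Δ * μ j) = φ + Pi.single (j, u) (-(Δ * μ j)) := by
      rw [sub_eq_add_neg, Pi.single_neg]
    rw [h3, netInflow_add, ih, netInflow_single hb.1]
    simp only [mul_neg, h2, eq_comm (b := i)]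
    split_ifs <;> subst_vars <;> ring

theorem FatWalk.relExcess_eq (h : G.Labeling t μ) {p q : V} {L : List V} {φ : V × V → ℝ}
    (hw : G.FatWalk f μ Δ p q L φ) {i : V} (hi : i ∈ G.nodes) :
    G.relExcess (f + φ) μ i =
      G.relExcess f μ i + Δ * ((if i = q then 1 else 0) - (if i = p then 1 else 0)) := by
  have := h.label_pos i hi
  rw [relExcess, excess, netInflow_add, hw.netInflow_eq h, relExcess, excess]
  field_simp
  ring

theorem nonTightInflow_congr {g : V × V → ℝ} {i : V}
    (hg : ∀ a ∈ G.arcs, a.2 = i → G.relGain μ a < 1 → g a = f a) :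
    G.nonTightInflow g μ i = G.nonTightInflow f μ i := by
  refine Finset.sum_congr rfl fun a ha => ?_
  simp only [Finset.mem_filter] at ha
  rw [hg a ha.1 ha.2.1 ha.2.2]

/-- Path augmentation keeps the flow feasible. -/
theorem ScaledFeasible.augment (h : G.ScaledFeasible t f μ Δ) (hΔ : 0 < Δ) {p q : V} {L : List V}
    {φ : V × V → ℝ} (hw : G.FatWalk f μ Δ p q L φ) (hnd : (L ++ [q]).Nodup)
    (hp : (G.degree p + 2) * Δ ≤ G.relExcess f μ p)
    (hq : q = t ∨ G.relExcess f μ q < (G.degree q + 1) * Δ) :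
    G.ScaledFeasible t (f + φ) μ Δ := by
  have hl := h.toLabeling
  have h0 : ∀ a, G.relGain μ a < 1 → φ a = 0 := by
    intro a ha
    by_contra hne
    exact ha.ne (hw.of_ne_zero hl hne).1.2
  refine ⟨hl, ?_, ?_, ?_, ?_⟩
  · intro a ha
    have h1 := h.flow_nonneg a ha
    have h2 := h.fst_pos ha
    rcases hw.nonneg_or hl hΔ.le hnd a with h3 | ⟨-, h4, h5⟩
    · exact add_nonneg h1 h3
    · rw [lt_div_iff₀ h2] at h4
      simp only [Pi.add_apply]
      linarith
  · intro a ha hlt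
    simpa [h0 a hlt] using h.slack a ha hlt
  · intro i hi
    rw [nonTightInflow_congr (f := f) fun a _ _ hlt => by simp [h0 a hlt],
      hw.relExcess_eq hl (Finset.mem_of_mem_erase hi)]
    have h1 := h.nonTightInflow_le i hi
    -- Only p loses excess. It keeps (d+1)Δ, which exceeds the at most Δ per entering arc that
    -- arrives on arcs that are not tight.
    by_cases hip : i = p
    · have h2 := h.nonTightInflow_le_inDegree hΔ.le i
      have h3 := h.wf.inDegree_add_outDegree_cast i
      have h4 : (0 : ℝ) ≤ G.outDegree i := Nat.cast_nonneg _
      subst hip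
      have h5 : (0 : ℝ) ≤ if i = q then 1 else 0 := by split_ifs <;> norm_num
      rw [if_pos rfl]
      nlinarith
    · rw [if_neg hip]
      split_ifs <;> linarith
  · intro i hi
    rw [hw.relExcess_eq hl (Finset.mem_of_mem_erase hi)]
    have h1 := h.relExcess_le i hi
    have h4 : (0 : ℝ) ≤ G.degree i := Nat.cast_nonneg _
    have h5 : (0 : ℝ) ≤ if i = p then 1 else 0 := by split_ifs <;> norm_num
    -- Only q gains excess, and it ends below (d+2)Δ unless it is the sink.
    by_cases hiq : i = q
    · subst hiq
      rcases hq with rfl | hq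
      · simp at hi
      · rw [if_pos rfl]
        nlinarith [mul_nonneg h4 hΔ.le, mul_nonneg h5 hΔ.le]
    · rw [if_neg hiq]
      nlinarith [mul_nonneg h5 hΔ.le]

end Network

theorem sum_filter_split {ι : Type*} (s : Finset ι) (p q : ι → Prop) [DecidablePred p]
    [DecidablePred fun a => p a ∧ q a] [DecidablePred fun a => p a ∧ ¬ q a] (g : ι → ℝ) :
    ∑ a ∈ s with p a, g a = (∑ a ∈ s with p a ∧ q a, g a) + ∑ a ∈ s with p a ∧ ¬ q a, g a := by
  rw [← Finset.sum_filter_add_sum_filter_not (s.filter p) q]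
  congr 1 <;> refine Finset.sum_congr ?_ fun _ _ => rfl <;> ext a <;>
    simp only [Finset.mem_filter, and_assoc]

/-! ### Elementary Step -/

namespace State

open Network

variable {V : Type*} {t : V} {S : State V}

/-- No tight arc of the fat graph leaves `T`, and the nodes of `T` are different from the sink and
have large excesses. -/
structure Blocked (t : V) (S : State V) : Prop where
  subset : S.T ⊆ S.net.nodes
  sink_notMem : t ∉ S.T
  not_leaving : ∀ i j, ¬ S.Leaving i j
  high : ∀ i ∈ S.T, (S.d i + 1) * S.Δ ≤ S.e i

theorem Blocked.relGain_lt (hB : Blocked t S) (h : S.net.ScaledFeasible t S.f S.μ S.Δ)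
    {a : V × V} (ha : a ∈ S.net.arcs) (h1 : a.1 ∈ S.T) (h2 : a.2 ∉ S.T) :
    S.net.relGain S.μ a < 1 := by
  refine lt_of_le_of_ne (h.relGain_le a ha) fun heq => hB.not_leaving a.1 a.2 ⟨h1, ?_, .inl ⟨ha, heq⟩⟩
  exact Finset.mem_sdiff.2 ⟨(h.wf.arc_mem a ha).2.1, h2⟩

/-- If a tight arc into T carried more than Δ, its reverse would be a tight arc of the fat graph
leaving T. -/
theorem Blocked.flow_le_of_entering (hB : Blocked t S) (h : S.net.ScaledFeasible t S.f S.μ S.Δ)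
    {a : V × V} (ha : a ∈ S.net.arcs) (h1 : a.1 ∉ S.T) (h2 : a.2 ∈ S.T) :
    S.f a / S.μ a.1 ≤ S.Δ := by
  obtain hlt | heq := (h.relGain_le a ha).lt_or_eq
  · exact h.slack a ha hlt
  · by_contra! hfat
    refine hB.not_leaving a.2 a.1
      ⟨h2, Finset.mem_sdiff.2 ⟨(h.wf.arc_mem a ha).1, h1⟩, .inr ⟨ha, hfat, ?_⟩⟩
    have h3 := h.fst_pos ha
    have h4 := h.snd_pos ha
    have h5 := h.wf.gain_pos a ha
    simp only [relGain] at heq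
    change 1 / S.net.gain a * S.μ a.2 / S.μ a.1 = 1
    field_simp at heq ⊢
    linarith

theorem Blocked.flow_le_of_leaving (hB : Blocked t S) (h : S.net.ScaledFeasible t S.f S.μ S.Δ)
    {a : V × V} (ha : a ∈ S.net.arcs) (h1 : a.1 ∈ S.T) (h2 : a.2 ∉ S.T) :
    S.f a / S.μ a.1 ≤ S.Δ :=
  h.slack a ha (hB.relGain_lt h ha h1 h2)

/-- Little flow arrives at a node from outside of `T` and on arcs that are not tight. -/
theorem Blocked.sum_in_le (hB : Blocked t S) (h : S.net.ScaledFeasible t S.f S.μ S.Δ)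
    (hΔ : 0 < S.Δ) {i : V} (hi : i ∈ S.T) :
    ∑ a ∈ S.net.arcs with a.2 = i ∧ (a.1 ∉ S.T ∨ S.net.relGain S.μ a < 1),
      S.net.gain a * S.f a ≤ S.net.inDegree i * S.Δ * S.μ i := by
  have hμ := h.label_pos i (hB.subset hi)
  rw [← div_le_iff₀ hμ, h.sum_gain_div]
  refine h.toLabeling.sum_in_le hΔ.le i _ fun a ha hai hp => ⟨h.flow_nonneg a ha, ?_⟩
  rcases hp with hp | hp
  · exact hB.flow_le_of_entering h ha hp (hai ▸ hi)
  · exact h.slack a ha hp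

theorem sum_in_nonneg (h : S.net.ScaledFeasible t S.f S.μ S.Δ) (p : V × V → Prop)
    [DecidablePred p] :
    0 ≤ ∑ a ∈ S.net.arcs with p a, S.net.gain a * S.f a := by
  refine Finset.sum_nonneg fun a ha => ?_
  have ha' := (Finset.mem_filter.1 ha).1
  exact mul_nonneg (h.wf.gain_pos a ha').le (h.flow_nonneg a ha')

theorem sum_flow_nonneg (h : S.net.ScaledFeasible t S.f S.μ S.Δ) (p : V × V → Prop)
    [DecidablePred p] :
    0 ≤ ∑ a ∈ S.net.arcs with p a, S.f a := by
  refine Finset.sum_nonneg fun a ha => ?_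
  exact h.flow_nonneg a (Finset.mem_filter.1 ha).1

theorem nonTightInflow_mul (h : S.net.ScaledFeasible t S.f S.μ S.Δ) {i : V}
    (hi : i ∈ S.net.nodes) :
    S.net.nonTightInflow S.f S.μ i * S.μ i =
      ∑ a ∈ S.net.arcs with a.2 = i ∧ S.net.relGain S.μ a < 1, S.net.gain a * S.f a := by
  have := h.label_pos i hi
  rw [nonTightInflow, ← h.sum_gain_div, div_mul_cancel₀ _ this.ne']

theorem nonTightInflow_mul_le (h : S.net.ScaledFeasible t S.f S.μ S.Δ) {i : V}
    (hi : i ∈ S.net.nodes.erase t) :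
    ∑ a ∈ S.net.arcs with a.2 = i ∧ S.net.relGain S.μ a < 1, S.net.gain a * S.f a ≤
      S.net.excess S.f i := by
  have hi' := Finset.mem_of_mem_erase hi
  have := h.label_pos i hi'
  rw [← nonTightInflow_mul h hi', ← le_div_iff₀ this]
  exact h.nonTightInflow_le i hi

/-! Elementary Step before the update of `T₀` and `T` -/

/-- The change of `Δ`, `μ` and `f` in Elementary Step. -/
noncomputable def scaled (a : ℝ) (S : State V) : State V :=
  { S with
    Δ := S.Δ / a
    μ := fun i => if i ∈ S.T then a * S.μ i else S.μ i
    f := fun c => if c ∈ S.decreasing then S.f c / a else S.f c }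

theorem mem_decreasing {c : V × V} : c ∈ S.decreasing ↔
    c ∈ S.net.arcs ∧ c.1 ∉ S.T ∧ (c.2 ∈ S.T ∨ S.net.relGain S.μ c < 1) := by
  simp only [decreasing, nonTight, Finset.mem_filter]
  tauto

theorem r₁_eq {i : V} (hi : i ∉ S.T) : S.r₁ i =
    ∑ a ∈ S.net.arcs with a.2 = i ∧ (a.1 ∉ S.T ∧ S.net.relGain S.μ a < 1),
      S.net.gain a * S.f a := by
  refine Finset.sum_congr (Finset.filter_congr fun a ha => ?_) fun _ _ => rfl
  simp only [nonTight, Finset.mem_filter]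
  constructor
  · rintro ⟨h1, h2, h3, h4⟩; exact ⟨h1, h3, h2.2⟩
  · rintro ⟨h1, h2, h3⟩; exact ⟨h1, ⟨ha, h3⟩, h2, h1 ▸ hi⟩

theorem excess_eq (i : V) :
    S.net.excess S.f i = S.r₁ i + S.r₂ i - S.r₃ i - S.r₄ i - S.net.demand i := by
  rw [excess, netInflow, sum_filter_split S.net.arcs (fun a => a.2 = i)
      (fun a => a ∈ S.net.nonTight S.μ ∧ a.1 ∉ S.T ∧ a.2 ∉ S.T),
    sum_filter_split S.net.arcs (fun a => a.1 = i) (fun a => a ∈ S.decreasing)]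
  simp only [r₁, r₂, r₃, r₄]
  ring

/-- At a node outside T, the arcs whose flow is divided by a are exactly the entering arcs counted
in r₁ and the leaving arcs counted in r₃. -/
theorem scaled_excess_of_notMem (a : ℝ) {i : V} (hi : i ∉ S.T) :
    (S.scaled a).net.excess (S.scaled a).f i =
      S.r₁ i / a + S.r₂ i - S.r₃ i / a - S.r₄ i - S.net.demand i := by
  have h1 : ∑ c ∈ S.net.arcs with c.2 = i ∧
      (c ∈ S.net.nonTight S.μ ∧ c.1 ∉ S.T ∧ c.2 ∉ S.T),
      S.net.gain c * (S.scaled a).f c = S.r₁ i / a := by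
    rw [r₁, Finset.sum_div]
    refine Finset.sum_congr rfl fun c hc => ?_
    simp only [Finset.mem_filter] at hc
    have : c ∈ S.decreasing := by
      simp only [decreasing, Finset.mem_filter]
      exact ⟨hc.1, hc.2.2.2.1, .inr hc.2.2.1⟩
    simp only [scaled, this, if_true]
    ring
  have h2 : ∑ c ∈ S.net.arcs with c.2 = i ∧
      ¬ (c ∈ S.net.nonTight S.μ ∧ c.1 ∉ S.T ∧ c.2 ∉ S.T),
      S.net.gain c * (S.scaled a).f c = S.r₂ i := by
    refine Finset.sum_congr rfl fun c hc => ?_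
    simp only [Finset.mem_filter] at hc
    have : c ∉ S.decreasing := by
      simp only [decreasing, Finset.mem_filter]
      rintro ⟨h3, h4, h5⟩
      have h6 : c.2 ∉ S.T := hc.2.1 ▸ hi
      exact hc.2.2 ⟨h5.resolve_left h6, h4, h6⟩
    simp only [scaled, this, if_false]
  have h3 : ∑ c ∈ S.net.arcs with c.1 = i ∧ c ∈ S.decreasing, (S.scaled a).f c =
      S.r₃ i / a := by
    rw [r₃, Finset.sum_div]
    refine Finset.sum_congr rfl fun c hc => ?_
    simp only [Finset.mem_filter] at hc
    simp only [scaled, hc.2.2, if_true]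
  have h4 : ∑ c ∈ S.net.arcs with c.1 = i ∧ c ∉ S.decreasing, (S.scaled a).f c =
      S.r₄ i := by
    refine Finset.sum_congr rfl fun c hc => ?_
    simp only [Finset.mem_filter] at hc
    simp only [scaled, hc.2.2, if_false]
  change S.net.excess (S.scaled a).f i = _
  rw [excess, netInflow, sum_filter_split S.net.arcs (fun a => a.2 = i)
      (fun a => a ∈ S.net.nonTight S.μ ∧ a.1 ∉ S.T ∧ a.2 ∉ S.T),
    sum_filter_split S.net.arcs (fun a => a.1 = i) (fun a => a ∈ S.decreasing), h1, h2, h3, h4]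
  ring

/-- At a node of T, only the arcs coming from outside T are rescaled. -/
theorem scaled_excess_of_mem (a : ℝ) {i : V} (hi : i ∈ S.T) :
    (S.scaled a).net.excess (S.scaled a).f i = S.net.excess S.f i -
      (1 - 1 / a) * ∑ c ∈ S.net.arcs with c.2 = i ∧ c.1 ∉ S.T, S.net.gain c * S.f c := by
  have h1 : ∑ c ∈ S.net.arcs with c.2 = i ∧ c.1 ∉ S.T, S.net.gain c * (S.scaled a).f c =
      1 / a * ∑ c ∈ S.net.arcs with c.2 = i ∧ c.1 ∉ S.T, S.net.gain c * S.f c := by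
    rw [Finset.mul_sum]
    refine Finset.sum_congr rfl fun c hc => ?_
    simp only [Finset.mem_filter] at hc
    have : c ∈ S.decreasing := mem_decreasing.2 ⟨hc.1, hc.2.2, .inl (hc.2.1 ▸ hi)⟩
    simp only [scaled, this, if_true]
    ring
  have h2 : ∑ c ∈ S.net.arcs with c.2 = i ∧ ¬ c.1 ∉ S.T, S.net.gain c * (S.scaled a).f c =
      ∑ c ∈ S.net.arcs with c.2 = i ∧ ¬ c.1 ∉ S.T, S.net.gain c * S.f c := by
    refine Finset.sum_congr rfl fun c hc => ?_
    simp only [Finset.mem_filter] at hc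
    have : c ∉ S.decreasing := fun h => hc.2.2 (mem_decreasing.1 h).2.1
    simp only [scaled, this, if_false]
  have h3 : ∑ c ∈ S.net.arcs with c.1 = i, (S.scaled a).f c =
      ∑ c ∈ S.net.arcs with c.1 = i, S.f c := by
    refine Finset.sum_congr rfl fun c hc => ?_
    simp only [Finset.mem_filter] at hc
    have : c ∉ S.decreasing := fun h => (mem_decreasing.1 h).2.1 (hc.2 ▸ hi)
    simp only [scaled, this, if_false]
  change S.net.excess (S.scaled a).f i = _
  rw [excess, netInflow, excess, netInflow,
    sum_filter_split S.net.arcs (fun a => a.2 = i) (fun c => c.1 ∉ S.T), h1, h2, h3,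
    sum_filter_split S.net.arcs (fun a => a.2 = i) (fun c => c.1 ∉ S.T) (fun c => S.net.gain c * S.f c)]
  ring

theorem r₁_nonneg (h : S.net.ScaledFeasible t S.f S.μ S.Δ) (i : V) : 0 ≤ S.r₁ i :=
  sum_in_nonneg h _

theorem r₃_nonneg (h : S.net.ScaledFeasible t S.f S.μ S.Δ) (i : V) : 0 ≤ S.r₃ i :=
  sum_flow_nonneg h _

/-- Every arc counted in r₃ is not tight or enters T, and so carries at most Δ. -/
theorem Blocked.r₃_le (hB : Blocked t S) (h : S.net.ScaledFeasible t S.f S.μ S.Δ) (hΔ : 0 < S.Δ)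
    {i : V} (hi : i ∈ S.net.nodes) : S.r₃ i ≤ S.d i * S.Δ * S.μ i := by
  have hμ := h.label_pos i hi
  have h1 : S.r₃ i ≤ S.net.outDegree i * S.Δ * S.μ i := by
    rw [r₃, ← div_le_iff₀ hμ, sum_div_label]
    refine sum_out_le hΔ.le i _ fun a ha hai hp => ?_
    obtain ⟨-, h2, h3⟩ := mem_decreasing.1 hp
    rcases h3 with h3 | h3
    · exact hB.flow_le_of_entering h ha h2 h3
    · exact h.slack a ha h3
  have h2 := h.wf.inDegree_add_outDegree_cast i
  have h3 : (0 : ℝ) ≤ S.net.inDegree i := Nat.cast_nonneg _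
  have h4 : (S.net.outDegree i : ℝ) ≤ S.d i := by unfold d; linarith
  refine h1.trans ?_
  gcongr

/-- Flow arriving outside of `T` on arcs that are not tight. -/
theorem Blocked.r₁_add_le (hB : Blocked t S) (h : S.net.ScaledFeasible t S.f S.μ S.Δ)
    {i : V} (hi : i ∈ S.net.nodes.erase t) (hiT : i ∉ S.T) :
    S.r₁ i + ∑ a ∈ S.net.arcs with a.2 = i ∧ a.1 ∈ S.T, S.net.gain a * S.f a ≤
      S.net.excess S.f i := by
  refine le_trans (le_of_eq ?_) (nonTightInflow_mul_le h hi)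
  rw [r₁_eq hiT, sum_filter_split S.net.arcs (fun a => a.2 = i ∧ S.net.relGain S.μ a < 1)
    (fun a => a.1 ∉ S.T)]
  congr 1
  · exact Finset.sum_congr (Finset.filter_congr fun a _ => by tauto) fun _ _ => rfl
  · refine Finset.sum_congr (Finset.filter_congr fun a ha => ?_) fun _ _ => rfl
    constructor
    · rintro ⟨h1, h2⟩
      exact ⟨⟨h1, hB.relGain_lt h ha h2 (h1 ▸ hiT)⟩, not_not.2 h2⟩
    · rintro ⟨⟨h1, -⟩, h2⟩
      exact ⟨h1, not_not.1 h2⟩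

/-- The denominator equals the excess − r₁ + r₃, and r₁ is part of the inflow that the invariant
lets the excess cover. The sign allows the bound δ_i to be used with the division cleared. -/
theorem Blocked.denominator_nonneg (hB : Blocked t S) (h : S.net.ScaledFeasible t S.f S.μ S.Δ)
    {i : V} (hi : i ∈ S.net.nodes.erase t) (hiT : i ∉ S.T) :
    0 ≤ S.r₂ i - S.r₄ i - S.net.demand i := by
  have h1 := hB.r₁_add_le h hi hiT
  have h2 := sum_in_nonneg h (fun a => a.2 = i ∧ a.1 ∈ S.T)
  have h3 := r₃_nonneg h i
  rw [excess_eq] at h1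
  linarith

/-- The properties of a finite value `a` of the step length. -/
structure StepLength (t : V) (S : State V) (a : ℝ) : Prop where
  one_le : 1 ≤ a
  mul_le : ∀ i ∈ (S.net.nodes \ S.T).erase t,
    a * (S.r₂ i - S.r₄ i - S.net.demand i) ≤ 4 * (S.d i + 2) * S.Δ * S.μ i + S.r₃ i - S.r₁ i
  mul_relGain_le : ∀ c ∈ S.net.arcs, c.1 ∈ S.T → c.2 ∉ S.T → a * S.net.relGain S.μ c ≤ 1
  attained : (∃ i ∈ (S.net.nodes \ S.T).erase t, a * (S.r₂ i - S.r₄ i - S.net.demand i) =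
      4 * (S.d i + 2) * S.Δ * S.μ i + S.r₃ i - S.r₁ i) ∨
    ∃ c ∈ S.net.arcs, c.1 ∈ S.T ∧ c.2 ∉ S.T ∧ a * S.net.relGain S.μ c = 1

/-- Every candidate for the minimum is at least 1, by the present bounds on excesses and relabeled
gains. As α is finite, the minimum is attained at a finite candidate rather than over an empty set.
-/
theorem Blocked.stepLength (hB : Blocked t S) (h : S.net.ScaledFeasible t S.f S.μ S.Δ)
    {a : ℝ} (ha : α t S = (a : WithTop ℝ)) : StepLength t S a := by
  have hmem : ∀ i ∈ (S.net.nodes \ S.T).erase t, i ∈ S.net.nodes.erase t ∧ i ∉ S.T := by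
    intro i hi
    simp only [Finset.mem_erase, Finset.mem_sdiff] at hi ⊢
    tauto
  have hup : ∀ i ∈ (S.net.nodes \ S.T).erase t, S.r₂ i - S.r₄ i - S.net.demand i ≤
      4 * (S.d i + 2) * S.Δ * S.μ i + S.r₃ i - S.r₁ i := by
    intro i hi
    have h1 := h.relExcess_le i (hmem i hi).1
    have hμ := h.label_pos i (Finset.mem_of_mem_erase (hmem i hi).1)
    rw [relExcess, div_le_iff₀ hμ, excess_eq] at h1
    simp only [d]
    linarith
  have hδ : ∀ i ∈ (S.net.nodes \ S.T).erase t, S.δ i = ⊤ ∧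
        S.r₂ i - S.r₄ i - S.net.demand i = 0 ∨
      0 < S.r₂ i - S.r₄ i - S.net.demand i ∧
        S.δ i = (((4 * (S.d i + 2) * S.Δ * S.μ i + S.r₃ i - S.r₁ i) /
          (S.r₂ i - S.r₄ i - S.net.demand i) : ℝ) : WithTop ℝ) := by
    intro i hi
    by_cases h0 : S.r₂ i - S.r₄ i - S.net.demand i = 0
    · exact .inl ⟨if_pos h0, h0⟩
    · exact .inr ⟨lt_of_le_of_ne (hB.denominator_nonneg h (hmem i hi).1 (hmem i hi).2)
        (Ne.symm h0), if_neg h0⟩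
  have hmin : (a : WithTop ℝ) ≤ ((S.net.nodes \ S.T).erase t).inf S.δ ∧
      (a : WithTop ℝ) ≤ (S.net.arcs.filter fun a => a.1 ∈ S.T ∧ a.2 ∉ S.T).inf
        fun a => ((1 / S.net.relGain S.μ a : ℝ) : WithTop ℝ) := by
    rw [← ha]
    exact ⟨min_le_left _ _, min_le_right _ _⟩
  refine ⟨?_, ?_, ?_, ?_⟩
  · have : ((1 : ℝ) : WithTop ℝ) ≤ α t S := by
      refine le_min (Finset.le_inf fun i hi => ?_) (Finset.le_inf fun c hc => ?_)
      · rcases hδ i hi with ⟨h1, -⟩ | ⟨h1, h2⟩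
        · rw [h1]; exact le_top
        · rw [h2, WithTop.coe_le_coe, le_div_iff₀ h1, one_mul]
          exact hup i hi
      · have hc' := (Finset.mem_filter.1 hc).1
        rw [WithTop.coe_le_coe, le_div_iff₀ (h.relGain_pos hc'), one_mul]
        exact h.relGain_le c hc'
    rw [ha] at this
    exact WithTop.coe_le_coe.1 this
  · intro i hi
    -- With denominator zero the left side vanishes for every a, so the infinite δ_i imposes
    -- nothing.
    rcases hδ i hi with ⟨-, h1⟩ | ⟨h1, h2⟩
    · have := hup i hi
      rw [h1] at this ⊢
      simpa using this
    · have h3 := hmin.1.trans (Finset.inf_le hi)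
      rw [h2, WithTop.coe_le_coe, le_div_iff₀ h1] at h3
      exact h3
  · intro c hc h1 h2
    have h3 := hmin.2.trans (Finset.inf_le (Finset.mem_filter.2 ⟨hc, h1, h2⟩))
    rw [WithTop.coe_le_coe, le_div_iff₀ (h.relGain_pos hc)] at h3
    exact h3
  · rcases min_choice (((S.net.nodes \ S.T).erase t).inf S.δ)
      ((S.net.arcs.filter fun a => a.1 ∈ S.T ∧ a.2 ∉ S.T).inf
        fun a => ((1 / S.net.relGain S.μ a : ℝ) : WithTop ℝ)) with h1 | h1
    · left
      change α t S = _ at h1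
      rw [ha] at h1
      obtain h2 | h2 := ((S.net.nodes \ S.T).erase t).eq_empty_or_nonempty
      · rw [h2] at h1
        exact absurd h1 WithTop.coe_ne_top
      · obtain ⟨i, hi, h3⟩ := Finset.exists_mem_eq_inf _ h2 S.δ
        refine ⟨i, hi, ?_⟩
        rcases hδ i hi with ⟨h4, -⟩ | ⟨h4, h5⟩
        · rw [h3, h4] at h1
          exact absurd h1 WithTop.coe_ne_top
        · rw [h3, h5, WithTop.coe_inj, eq_div_iff h4.ne'] at h1
          exact h1
    · right
      change α t S = _ at h1
      rw [ha] at h1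
      obtain h2 | h2 :=
        (S.net.arcs.filter fun a => a.1 ∈ S.T ∧ a.2 ∉ S.T).eq_empty_or_nonempty
      · rw [h2] at h1
        exact absurd h1 WithTop.coe_ne_top
      · obtain ⟨c, hc, h3⟩ := Finset.exists_mem_eq_inf _ h2
          fun a => ((1 / S.net.relGain S.μ a : ℝ) : WithTop ℝ)
        rw [Finset.mem_filter] at hc
        refine ⟨c, hc.1, hc.2.1, hc.2.2, ?_⟩
        rw [h3, WithTop.coe_inj, eq_div_iff (h.relGain_pos hc.1).ne'] at h1
        exact h1

theorem scaled_relGain (a : ℝ) (c : V × V) : (S.scaled a).net.relGain (S.scaled a).μ c =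
    S.net.relGain S.μ c * ((if c.1 ∈ S.T then a else 1) / (if c.2 ∈ S.T then a else 1)) := by
  simp only [relGain, scaled]
  split_ifs <;> simp only [div_eq_mul_inv, mul_inv, inv_one] <;> ring

theorem StepLength.pos {a : ℝ} (ha : StepLength t S a) : 0 < a := one_pos.trans_le ha.one_le

/-- Relative excesses outside of `T` grow at most by the factor `a`, up to the degrees. -/
theorem StepLength.scaled_e_le_of_notMem {a : ℝ} (ha : StepLength t S a) (hB : Blocked t S)
    (h : S.net.ScaledFeasible t S.f S.μ S.Δ) (hΔ : 0 < S.Δ) {i : V}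
    (hi : i ∈ S.net.nodes.erase t) (hiT : i ∉ S.T) :
    (S.scaled a).e i / (S.scaled a).Δ + S.d i ≤ a * (S.e i / S.Δ + S.d i) := by
  have hi' := Finset.mem_of_mem_erase hi
  have hμ := h.label_pos i hi'
  have h0 := ha.pos
  have h1 := hB.r₃_le h hΔ hi'
  have h2 := r₁_nonneg h i
  have h3 : (S.scaled a).e i = (S.r₁ i / a + S.r₂ i - S.r₃ i / a - S.r₄ i - S.net.demand i) /
      S.μ i := by
    rw [e, relExcess, scaled_excess_of_notMem a hiT]
    simp only [scaled, hiT, if_false]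
  have h4 : S.e i = (S.r₁ i + S.r₂ i - S.r₃ i - S.r₄ i - S.net.demand i) / S.μ i := by
    rw [e, relExcess, excess_eq]
  -- The correction is a − 1 times at most d. Adding d to the relative excess turns this into growth
  -- by the pure factor a, which is why the passive charge uses x + d.
  have h5 : (S.scaled a).e i / (S.scaled a).Δ =
      a * (S.e i / S.Δ) + (a - 1) * ((S.r₃ i - S.r₁ i) / (S.Δ * S.μ i)) := by
    rw [h3, h4]
    simp only [scaled]
    field_simp
    ring
  have h6 : (S.r₃ i - S.r₁ i) / (S.Δ * S.μ i) ≤ S.d i := by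
    rw [div_le_iff₀ (by positivity)]
    linarith
  have h7 := mul_le_mul_of_nonneg_left h6 (sub_nonneg.2 ha.one_le)
  rw [h5]
  linarith

/-- For a node of T the product μ_i Δ is unchanged, while the excess only loses inflow from outside
T. -/
theorem StepLength.scaled_e_le_of_mem {a : ℝ} (ha : StepLength t S a) (hB : Blocked t S)
    (h : S.net.ScaledFeasible t S.f S.μ S.Δ) (hΔ : 0 < S.Δ) {i : V} (hiT : i ∈ S.T) :
    (S.scaled a).e i / (S.scaled a).Δ ≤ S.e i / S.Δ := by
  have hμ := h.label_pos i (hB.subset hiT)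
  have h0 := ha.pos
  have h1 : (S.scaled a).e i / (S.scaled a).Δ =
      (S.scaled a).net.excess (S.scaled a).f i / (S.μ i * S.Δ) := by
    simp only [e, relExcess, scaled, hiT, if_true]
    field_simp
  have h2 : S.e i / S.Δ = S.net.excess S.f i / (S.μ i * S.Δ) := by
    rw [e, relExcess, div_div]
  rw [h1, h2, scaled_excess_of_mem a hiT]
  have h3 := sum_in_nonneg h (fun c => c.2 = i ∧ c.1 ∉ S.T)
  have h4 : 0 ≤ 1 - 1 / a := by
    rw [sub_nonneg, div_le_one h0]; exact ha.one_le
  have := mul_nonneg h4 h3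
  gcongr
  linarith

/-- Relabeled gains grow only on arcs leaving T, where the step length keeps them at most 1. The
arcs entering T may become non-tight, but blockedness already bounds their flow by Δ and the step
rescales it. The other half of the step length bounds the excesses outside T. -/
theorem StepLength.scaledFeasible {a : ℝ} (ha : StepLength t S a) (hB : Blocked t S)
    (h : S.net.ScaledFeasible t S.f S.μ S.Δ) (hΔ : 0 < S.Δ) :
    (S.scaled a).net.ScaledFeasible t (S.scaled a).f (S.scaled a).μ (S.scaled a).Δ := by
  have h0 := ha.pos
  have h1a : 1 / a ≤ 1 := (div_le_one h0).2 ha.one_le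
  have hμ' : ∀ i ∈ S.net.nodes, 0 < (S.scaled a).μ i := by
    intro i hi
    have := h.label_pos i hi
    simp only [scaled]
    split_ifs <;> positivity
  have hl : (S.scaled a).net.Labeling t (S.scaled a).μ := by
    refine ⟨h.wf, hμ', fun c hc => ?_⟩
    rw [scaled_relGain]
    have h1 := h.relGain_le c hc
    have h2 := (h.relGain_pos hc).le
    split_ifs with h3 h4 h4
    · rw [div_self h0.ne', mul_one]; exact h1
    · rw [div_one, mul_comm]; exact ha.mul_relGain_le c hc h3 h4
    · nlinarith [one_div_pos.2 h0]
    · simpa using h1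
  have hf : ∀ c ∈ S.net.arcs, 0 ≤ (S.scaled a).f c := by
    intro c hc
    have := h.flow_nonneg c hc
    simp only [scaled]
    split_ifs <;> positivity
  have hfle : ∀ c ∈ S.net.arcs, (S.scaled a).f c ≤ S.f c := by
    intro c hc
    have := h.flow_nonneg c hc
    simp only [scaled]
    split_ifs
    · exact div_le_self this ha.one_le
    · exact le_rfl
  have hslack : ∀ c ∈ (S.scaled a).net.arcs, (S.scaled a).net.relGain (S.scaled a).μ c < 1 →
      (S.scaled a).f c / (S.scaled a).μ c.1 ≤ (S.scaled a).Δ := by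
    intro c hc hlt
    change c ∈ S.net.arcs at hc
    have hμ1 := h.fst_pos hc
    rw [scaled_relGain] at hlt
    -- If the tail is in T its label grows by a; otherwise the flow is divided by a. Either way the
    -- relabeled flow shrinks together with Δ.
    by_cases h1 : c.1 ∈ S.T
    · have h2 : S.f c / S.μ c.1 ≤ S.Δ := by
        by_cases h3 : c.2 ∈ S.T
        · rw [if_pos h1, if_pos h3, div_self h0.ne', mul_one] at hlt
          exact h.slack c hc hlt
        · exact hB.flow_le_of_leaving h hc h1 h3
      have h3 : c ∉ S.decreasing := fun h => (mem_decreasing.1 h).2.1 h1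
      simp only [scaled, h1, h3, if_true, if_false]
      rw [mul_comm, ← div_div]
      gcongr
    · have h2 : c ∈ S.decreasing ∧ S.f c / S.μ c.1 ≤ S.Δ := by
        by_cases h3 : c.2 ∈ S.T
        · exact ⟨mem_decreasing.2 ⟨hc, h1, .inl h3⟩, hB.flow_le_of_entering h hc h1 h3⟩
        · rw [if_neg h1, if_neg h3, div_self one_ne_zero, mul_one] at hlt
          exact ⟨mem_decreasing.2 ⟨hc, h1, .inr hlt⟩, h.slack c hc hlt⟩
      simp only [scaled, h1, h2.1, if_true, if_false]
      rw [div_right_comm]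
      gcongr
      exact h2.2
  have hexc : ∀ i ∈ S.net.nodes.erase t,
      ∑ c ∈ S.net.arcs with c.2 = i ∧ (S.scaled a).net.relGain (S.scaled a).μ c < 1,
        S.net.gain c * (S.scaled a).f c ≤ (S.scaled a).net.excess (S.scaled a).f i := by
    intro i hi
    have hi' := Finset.mem_of_mem_erase hi
    have hμ := h.label_pos i hi'
    by_cases hiT : i ∈ S.T
    -- Every arc from outside T may now be non-tight. The loss of inflow on these arcs is also the
    -- loss of excess, so it suffices to compare the old inflow, at most Δ per entering arc, with
    -- the old excess, at least (d+1)Δ.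
    · have h1 : ∑ c ∈ S.net.arcs with c.2 = i ∧ (S.scaled a).net.relGain (S.scaled a).μ c < 1,
          S.net.gain c * (S.scaled a).f c ≤
          (∑ c ∈ S.net.arcs with c.2 = i ∧ (c.1 ∉ S.T ∨ S.net.relGain S.μ c < 1),
            S.net.gain c * S.f c) -
          (1 - 1 / a) * ∑ c ∈ S.net.arcs with c.2 = i ∧ c.1 ∉ S.T, S.net.gain c * S.f c := by
        simp only [Finset.sum_filter, Finset.mul_sum]
        rw [← Finset.sum_sub_distrib]
        refine Finset.sum_le_sum fun c hc => ?_
        have h2 := mul_nonneg (h.wf.gain_pos c hc).le (h.flow_nonneg c hc)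
        have h2' : 0 ≤ 1 / a * (S.net.gain c * S.f c) := mul_nonneg (by positivity) h2
        by_cases hci : c.2 = i
        · by_cases hc1 : c.1 ∈ S.T
          · have h3 : c ∉ S.decreasing := fun h => (mem_decreasing.1 h).2.1 hc1
            have h4 : (S.scaled a).net.relGain (S.scaled a).μ c = S.net.relGain S.μ c := by
              rw [scaled_relGain, if_pos hc1, if_pos (hci ▸ hiT), div_self h0.ne', mul_one]
            have h5 : (S.scaled a).f c = S.f c := by simp [scaled, h3]
            simp [hci, hc1, h4, h5]
          · have h3 : c ∈ S.decreasing := mem_decreasing.2 ⟨hc, hc1, .inl (hci ▸ hiT)⟩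
            have h5 : (S.scaled a).f c = S.f c / a := by simp [scaled, h3]
            simp only [hci, hc1, h5, not_false_eq_true, true_or, and_self, if_true, true_and]
            split_ifs
            · exact le_of_eq (by ring)
            · linarith
        · simp [hci]
      have h2 := hB.sum_in_le h hΔ hiT
      have h3 := hB.high i hiT
      rw [e, relExcess, le_div_iff₀ hμ] at h3
      have h4 := h.wf.inDegree_add_outDegree_cast i
      have h5 : (0 : ℝ) ≤ S.net.outDegree i := Nat.cast_nonneg _
      have h6 : S.net.inDegree i * S.Δ * S.μ i ≤ (S.d i + 1) * S.Δ * S.μ i := by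
        have : (S.net.inDegree i : ℝ) ≤ S.d i + 1 := by unfold d; linarith
        gcongr
      rw [scaled_excess_of_mem a hiT]
      linarith
    -- Arcs from T may have become tight, but all of them were non-tight before and are covered by
    -- the old excess. The share r₁/a occurs on both sides, and dividing r₃ by a only helps.
    · have h1 : ∑ c ∈ S.net.arcs with c.2 = i ∧ (S.scaled a).net.relGain (S.scaled a).μ c < 1,
          S.net.gain c * (S.scaled a).f c ≤
          1 / a * S.r₁ i + ∑ c ∈ S.net.arcs with c.2 = i ∧ c.1 ∈ S.T, S.net.gain c * S.f c := by
        rw [r₁_eq hiT]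
        simp only [Finset.sum_filter, Finset.mul_sum]
        rw [← Finset.sum_add_distrib]
        refine Finset.sum_le_sum fun c hc => ?_
        have h2 := mul_nonneg (h.wf.gain_pos c hc).le (h.flow_nonneg c hc)
        by_cases hci : c.2 = i
        · have hc2 : c.2 ∉ S.T := hci ▸ hiT
          by_cases hc1 : c.1 ∈ S.T
          · have h3 : c ∉ S.decreasing := fun h => (mem_decreasing.1 h).2.1 hc1
            have h5 : (S.scaled a).f c = S.f c := by simp [scaled, h3]
            simp only [hci, hc1, h5, not_true_eq_false, false_and, and_false, if_false, and_self,
              if_true, true_and]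
            split_ifs <;> linarith
          · have h4 : (S.scaled a).net.relGain (S.scaled a).μ c = S.net.relGain S.μ c := by
              rw [scaled_relGain, if_neg hc1, if_neg hc2, div_self one_ne_zero, mul_one]
            by_cases hlt : S.net.relGain S.μ c < 1
            · have h3 : c ∈ S.decreasing := mem_decreasing.2 ⟨hc, hc1, .inr hlt⟩
              have h5 : (S.scaled a).f c = S.f c / a := by simp [scaled, h3]
              simp only [hci, hc1, h4, h5, hlt, not_false_eq_true, and_self, if_true, and_false,
                if_false]
              exact le_of_eq (by ring)
            · simp [hci, hc1, h4, hlt]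
        · simp [hci]
      have h2 := hB.r₁_add_le h hi hiT
      have h3 := r₃_nonneg h i
      have h4 : S.r₃ i / a ≤ S.r₃ i := div_le_self h3 ha.one_le
      rw [excess_eq] at h2
      rw [scaled_excess_of_notMem a hiT]
      have h5 : 1 / a * S.r₁ i = S.r₁ i / a := by ring
      linarith
  refine ⟨hl, hf, hslack, fun i hi => ?_, fun i hi => ?_⟩
  · have hμ := hμ' i (Finset.mem_of_mem_erase hi)
    rw [nonTightInflow, relExcess, ← hl.sum_gain_div]
    have := hexc i hi
    exact div_le_div_of_nonneg_right this hμ.le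
  · have hi' := Finset.mem_of_mem_erase hi
    change i ∈ S.net.nodes at hi'
    have hμ := h.label_pos i hi'
    have hle := h.relExcess_le i hi
    by_cases hiT : i ∈ S.T
    · have h1 := ha.scaled_e_le_of_mem hB h hΔ hiT
      have hΔ' : 0 < (S.scaled a).Δ := div_pos hΔ h0
      change (S.scaled a).e i ≤ 4 * (S.net.degree i + 2) * (S.scaled a).Δ
      rw [← div_le_iff₀ hΔ']
      refine h1.trans ?_
      rw [div_le_iff₀ hΔ]
      exact hle
    · have h1 := ha.mul_le i (Finset.mem_erase.2
        ⟨(Finset.mem_erase.1 hi).1, Finset.mem_sdiff.2 ⟨hi', hiT⟩⟩)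
      rw [relExcess, scaled_excess_of_notMem a hiT]
      simp only [scaled, hiT, if_false]
      rw [div_le_iff₀ hμ]
      have h2 : S.r₁ i / a + S.r₂ i - S.r₃ i / a - S.r₄ i - S.net.demand i =
          (S.r₁ i - S.r₃ i + a * (S.r₂ i - S.r₄ i - S.net.demand i)) / a := by
        field_simp
        ring
      have h3 : 4 * ((S.net.degree i : ℝ) + 2) * (S.Δ / a) * S.μ i =
          4 * (S.net.degree i + 2) * S.Δ * S.μ i / a := by ring
      rw [h2, h3]
      refine div_le_div_of_nonneg_right ?_ h0.le
      simp only [d] at h1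
      linarith

/-- Some node reaches the bound on its excess, or some arc that leaves `T` becomes tight. -/
theorem StepLength.progress {a : ℝ} (ha : StepLength t S a)
    (h : S.net.ScaledFeasible t S.f S.μ S.Δ) :
    (∃ i ∈ (S.net.nodes \ S.T).erase t,
      (S.scaled a).e i = 4 * ((S.scaled a).d i + 2) * (S.scaled a).Δ) ∨
    ∃ i j, (S.scaled a).Leaving i j := by
  have h0 := ha.pos
  rcases ha.attained with ⟨i, hi, heq⟩ | ⟨c, hc, h1, h2, heq⟩
  · left
    refine ⟨i, hi, ?_⟩
    have hi2 := Finset.mem_sdiff.1 (Finset.mem_of_mem_erase hi)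
    have hμ := h.label_pos i hi2.1
    rw [e, relExcess, scaled_excess_of_notMem a hi2.2]
    simp only [scaled, hi2.2, if_false]
    change _ = 4 * (S.d i + 2) * (S.Δ / a)
    rw [div_eq_iff hμ.ne']
    field_simp
    linarith
  · right
    refine ⟨c.1, c.2, h1, Finset.mem_sdiff.2 ⟨(h.wf.arc_mem c hc).2.1, h2⟩, .inl ⟨hc, ?_⟩⟩
    have := scaled_relGain (S := S) a c
    rw [if_pos h1, if_neg h2, div_one, mul_comm, heq] at this
    exact this

end State

/-! ### Filtration -/

namespace State

open Network

variable {V : Type*} {t : V} {S S₁ : State V} {n : ℕ}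

/-- The facts about the state after Filtration. -/
structure Filtered (t : V) (n : ℕ) (S S₁ : State V) : Prop where
  flow_eq : ∀ a ∈ S.net.arcs, a.1 ∈ S.T → S₁.f a = S.f a
  feasible : S.net.ScaledFeasible t S₁.f S.μ S.Δ
  e_le_of_mem : ∀ i ∈ S.T, S₁.e i ≤ S.e i
  e_le_of_notMem : ∀ i ∈ S.net.nodes.erase t, i ∉ S.T → S₁.e i ≤
    ∑ j ∈ (S.net.nodes \ S.T).erase t, |S.net.relDemand S.μ j| +
      (∑ a ∈ S.net.arcs with a.2 = i ∧ a.1 ∈ S.T, S.net.gain a * S.f a) / S.μ i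
  r₁_eq_zero : ∀ i, S₁.r₁ i = 0
  r₃_eq_zero : ∀ i, S₁.r₃ i = 0
  not_leaving : ∀ i j, ¬ S₁.Leaving i j

/-- The demands outside of `T` are small altogether if each of them is. -/
theorem sum_abs_relDemand_le {c : ℝ} (hc : 0 ≤ c) (hn : S.net.nodes.card ≤ n) {μ : V → ℝ}
    (hb : ∀ i ∈ (S.net.nodes \ S.T).erase t, |S.net.relDemand μ i| < c / (16 ^ S.k * n)) :
    ∑ j ∈ (S.net.nodes \ S.T).erase t, |S.net.relDemand μ j| ≤ c := by
  have h1 : ∑ j ∈ (S.net.nodes \ S.T).erase t, |S.net.relDemand μ j| ≤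
      ∑ j ∈ (S.net.nodes \ S.T).erase t, c / (16 ^ S.k * n) :=
    Finset.sum_le_sum fun j hj => (hb j hj).le
  have h2 : ((S.net.nodes \ S.T).erase t).card ≤ n :=
    (Finset.card_le_card ((Finset.erase_subset _ _).trans Finset.sdiff_subset)).trans hn
  have h3 : (((S.net.nodes \ S.T).erase t).card : ℝ) ≤ n := by exact_mod_cast h2
  rw [Finset.sum_const, nsmul_eq_mul] at h1
  refine h1.trans ?_
  -- For n = 0 the bound on each summand is 0, since division by zero gives 0.
  obtain rfl | hpos := Nat.eq_zero_or_pos n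
  · simpa using hc
  have hn' : (0 : ℝ) < n := by exact_mod_cast hpos
  have h4 : (1 : ℝ) ≤ 16 ^ S.k := one_le_pow₀ (by norm_num)
  calc _ ≤ (n : ℝ) * (c / (16 ^ S.k * n)) := by gcongr
    _ = c / 16 ^ S.k := by field_simp
    _ ≤ c := div_le_self hc h4

theorem Blocked.inflow_le (hB : Blocked t S) (h : S.net.ScaledFeasible t S.f S.μ S.Δ)
    (hΔ : 0 < S.Δ) {i : V} (hiT : i ∉ S.T) :
    (∑ a ∈ S.net.arcs with a.2 = i ∧ a.1 ∈ S.T, S.net.gain a * S.f a) / S.μ i ≤ S.d i * S.Δ := by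
  rw [h.sum_gain_div]
  have h1 := h.toLabeling.sum_in_le (f := S.f) hΔ.le i (fun a => a.1 ∈ S.T) fun a ha hai hp =>
    ⟨h.flow_nonneg a ha, hB.flow_le_of_leaving h ha hp (hai ▸ hiT)⟩
  refine h1.trans ?_
  have h4 := h.wf.inDegree_add_outDegree_cast i
  have h5 : (0 : ℝ) ≤ S.net.outDegree i := Nat.cast_nonneg _
  have : (S.net.inDegree i : ℝ) ≤ S.d i := by unfold d; linarith
  gcongr

/-- Outside T the new flow is a Tight-Flow output, whose excesses lie between 0 and the sum of the
absolute demands there, plus the unchanged inflow from T. The only arcs outside T that carry flow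
are tight and do not enter T, so nothing is left for Elementary Step to rescale. -/
theorem Blocked.filtered (hB : Blocked t S) (h : S.net.ScaledFeasible t S.f S.μ S.Δ)
    (hΔ : 0 < S.Δ) (hn : S.net.nodes.card ≤ n) (hc : FiltrationCond t n S)
    (hF : Filtration t S S₁) : Filtered t n S S₁ := by
  obtain ⟨f', hf', rfl⟩ := hF
  have hl := h.toLabeling
  have hf0 : ∀ a, 0 ≤ f' a := hf'.nonneg hl
  have hfz : ∀ a, ¬ (a ∈ S.net.arcs ∧ a.1 ∉ S.T ∧ a.2 ∉ S.T ∧ S.net.relGain S.μ a = 1) →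
      f' a = 0 := by
    intro a ha
    refine hf'.eq_zero fun hmem => ha ?_
    rw [mem_tightArcs, Finset.mem_sdiff, Finset.mem_sdiff] at hmem
    exact ⟨hmem.1, hmem.2.1.2, hmem.2.2.1.2, hmem.2.2.2⟩
  have hexc : ∀ i ∈ S.net.nodes.erase t, i ∉ S.T → 0 ≤ S.net.excess f' i / S.μ i ∧
      S.net.excess f' i / S.μ i ≤
        ∑ j ∈ (S.net.nodes \ S.T).erase t, |S.net.relDemand S.μ j| := by
    intro i hi hiT
    refine hf'.relExcess_mem hl ?_
    simp only [Finset.mem_erase, Finset.mem_sdiff] at hi ⊢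
    exact ⟨hi.1, hi.2, hiT⟩
  clear hf'
  set F : V × V → ℝ := fun a =>
    if a ∈ S.net.arcs ∧ a.1 ∉ S.T then (if a.2 ∈ S.T then 0 else f' a) else S.f a with hF
  have hF1 : ∀ a ∈ S.net.arcs, a.1 ∈ S.T → F a = S.f a := fun a _ h1 => by simp [hF, h1]
  have hF2 : ∀ a ∈ S.net.arcs, a.1 ∉ S.T → F a = f' a := fun a ha h1 => by
    by_cases h2 : a.2 ∈ S.T
    · simp [hF, ha, h1, h2, hfz a fun h => h.2.2.1 h2]
    · simp [hF, ha, h1, h2]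
  have hF3 : ∀ a ∈ S.net.arcs, a.1 ∉ S.T → (a.2 ∈ S.T ∨ S.net.relGain S.μ a < 1) → F a = 0 := by
    intro a ha h1 h2
    rw [hF2 a ha h1]
    refine hfz a fun h3 => ?_
    rcases h2 with h2 | h2
    · exact h3.2.2.1 h2
    · exact h2.ne h3.2.2.2
  have hout : ∀ i ∈ S.net.nodes.erase t, i ∉ S.T → S.net.excess F i = S.net.excess f' i +
      ∑ a ∈ S.net.arcs with a.2 = i ∧ a.1 ∈ S.T, S.net.gain a * S.f a := by
    intro i hi hiT
    have h1 : ∑ a ∈ S.net.arcs with a.1 = i, F a = ∑ a ∈ S.net.arcs with a.1 = i, f' a := by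
      refine Finset.sum_congr rfl fun a ha => ?_
      rw [Finset.mem_filter] at ha
      exact hF2 a ha.1 (ha.2 ▸ hiT)
    have h2 : ∑ a ∈ S.net.arcs with a.2 = i, S.net.gain a * F a =
        (∑ a ∈ S.net.arcs with a.2 = i, S.net.gain a * f' a) +
          ∑ a ∈ S.net.arcs with a.2 = i ∧ a.1 ∈ S.T, S.net.gain a * S.f a := by
      simp only [Finset.sum_filter]
      rw [← Finset.sum_add_distrib]
      refine Finset.sum_congr rfl fun a ha => ?_
      by_cases h3 : a.2 = i
      · by_cases h4 : a.1 ∈ S.T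
        · simp [h3, h4, hF1 a ha h4, hfz a fun h => h.2.1 h4]
        · simp [h3, h4, hF2 a ha h4]
      · simp [h3]
    rw [excess, netInflow, h1, h2, excess, netInflow]
    ring
  have hin : ∀ i ∈ S.T, S.net.excess F i = S.net.excess S.f i -
      ∑ a ∈ S.net.arcs with a.2 = i ∧ a.1 ∉ S.T, S.net.gain a * S.f a := by
    intro i hiT
    have h1 : ∑ a ∈ S.net.arcs with a.1 = i, F a = ∑ a ∈ S.net.arcs with a.1 = i, S.f a := by
      refine Finset.sum_congr rfl fun a ha => ?_
      rw [Finset.mem_filter] at ha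
      exact hF1 a ha.1 (ha.2 ▸ hiT)
    have h2 : ∑ a ∈ S.net.arcs with a.2 = i, S.net.gain a * F a =
        (∑ a ∈ S.net.arcs with a.2 = i, S.net.gain a * S.f a) -
          ∑ a ∈ S.net.arcs with a.2 = i ∧ a.1 ∉ S.T, S.net.gain a * S.f a := by
      simp only [Finset.sum_filter]
      rw [← Finset.sum_sub_distrib]
      refine Finset.sum_congr rfl fun a ha => ?_
      by_cases h3 : a.2 = i
      · by_cases h4 : a.1 ∈ S.T
        · simp [h3, h4, hF1 a ha h4]
        · simp [h3, h4, hF3 a ha h4 (.inl (h3 ▸ hiT))]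
      · simp [h3]
    rw [excess, netInflow, h1, h2, excess, netInflow]
    ring
  have hle_in : ∀ i ∈ S.T, S.net.excess F i / S.μ i ≤ S.net.excess S.f i / S.μ i := by
    intro i hiT
    have hμ := h.label_pos i (hB.subset hiT)
    have h3 := sum_in_nonneg h (fun c => c.2 = i ∧ c.1 ∉ S.T)
    rw [hin i hiT]
    gcongr
    linarith
  have hle_out : ∀ i ∈ S.net.nodes.erase t, i ∉ S.T → S.net.excess F i / S.μ i ≤
      ∑ j ∈ (S.net.nodes \ S.T).erase t, |S.net.relDemand S.μ j| +
      (∑ a ∈ S.net.arcs with a.2 = i ∧ a.1 ∈ S.T, S.net.gain a * S.f a) / S.μ i := by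
    intro i hi hiT
    rw [hout i hi hiT, add_div]
    have := (hexc i hi hiT).2
    linarith
  refine ⟨hF1, ⟨hl, ?_, ?_, ?_, ?_⟩, hle_in, hle_out, ?_, ?_, ?_⟩
  · intro a ha
    change 0 ≤ F a
    by_cases h1 : a.1 ∈ S.T
    · rw [hF1 a ha h1]; exact h.flow_nonneg a ha
    · rw [hF2 a ha h1]; exact hf0 a
  · intro a ha hlt
    change F a / S.μ a.1 ≤ S.Δ
    by_cases h1 : a.1 ∈ S.T
    · rw [hF1 a ha h1]; exact h.slack a ha hlt
    · rw [hF3 a ha h1 (.inr hlt), zero_div]; exact hΔ.le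
  · intro i hi
    have hi' := Finset.mem_of_mem_erase hi
    have hμ := h.label_pos i hi'
    change S.net.nonTightInflow F S.μ i ≤ S.net.excess F i / S.μ i
    rw [nonTightInflow, ← hl.sum_gain_div]
    refine div_le_div_of_nonneg_right ?_ hμ.le
    by_cases hiT : i ∈ S.T
    -- The accounting is the one for Elementary Step, with the whole inflow from outside T deleted
    -- instead of a fraction of it.
    · have h1 : ∑ a ∈ S.net.arcs with a.2 = i ∧ S.net.relGain S.μ a < 1, S.net.gain a * F a ≤
          (∑ a ∈ S.net.arcs with a.2 = i ∧ (a.1 ∉ S.T ∨ S.net.relGain S.μ a < 1),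
            S.net.gain a * S.f a) -
          ∑ a ∈ S.net.arcs with a.2 = i ∧ a.1 ∉ S.T, S.net.gain a * S.f a := by
        simp only [Finset.sum_filter]
        rw [← Finset.sum_sub_distrib]
        refine Finset.sum_le_sum fun a ha => ?_
        by_cases h3 : a.2 = i
        · by_cases h4 : a.1 ∈ S.T
          · simp [h3, h4, hF1 a ha h4]
          · simp [h3, h4, hF3 a ha h4 (.inl (h3 ▸ hiT))]
        · simp [h3]
      have h2 := hB.sum_in_le h hΔ hiT
      have h3 := hB.high i hiT
      rw [e, relExcess, le_div_iff₀ hμ] at h3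
      have h4 := h.wf.inDegree_add_outDegree_cast i
      have h5 : (0 : ℝ) ≤ S.net.outDegree i := Nat.cast_nonneg _
      have h6 : S.net.inDegree i * S.Δ * S.μ i ≤ (S.d i + 1) * S.Δ * S.μ i := by
        have : (S.net.inDegree i : ℝ) ≤ S.d i + 1 := by unfold d; linarith
        gcongr
      rw [hin i hiT]
      linarith
    · have h1 : ∑ a ∈ S.net.arcs with a.2 = i ∧ S.net.relGain S.μ a < 1, S.net.gain a * F a ≤
          ∑ a ∈ S.net.arcs with a.2 = i ∧ a.1 ∈ S.T, S.net.gain a * S.f a := by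
        simp only [Finset.sum_filter]
        refine Finset.sum_le_sum fun a ha => ?_
        have h2 := mul_nonneg (h.wf.gain_pos a ha).le (h.flow_nonneg a ha)
        by_cases h3 : a.2 = i
        · by_cases h4 : a.1 ∈ S.T
          · simp only [h3, h4, hF1 a ha h4, true_and, and_self, if_true]
            split_ifs
            · exact le_rfl
            · exact h2
          · by_cases h5 : S.net.relGain S.μ a < 1
            · simp [h3, h4, hF3 a ha h4 (.inr h5)]
            · simp [h3, h4, h5]
        · simp [h3]
      have h2 := (hexc i hi hiT).1
      rw [le_div_iff₀ hμ, zero_mul] at h2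
      rw [hout i hi hiT]
      linarith
  · intro i hi
    by_cases hiT : i ∈ S.T
    · exact (hle_in i hiT).trans (h.relExcess_le i hi)
    -- The demands contribute at most Δ and the arcs from T at most Δ each: (d+1)Δ in total.
    · have h1 := hle_out i hi hiT
      have h2 := sum_abs_relDemand_le (t := t) hΔ.le hn hc
      have h3 := hB.inflow_le h hΔ hiT
      change S.net.excess F i / S.μ i ≤ 4 * (S.d i + 2) * S.Δ
      have h4 : 0 ≤ S.d i := Nat.cast_nonneg _
      nlinarith [mul_nonneg h4 hΔ.le]
  · intro i
    refine Finset.sum_eq_zero fun a ha => ?_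
    simp only [Finset.mem_filter, nonTight] at ha
    change S.net.gain a * F a = 0
    rw [hF3 a ha.1 ha.2.2.2.1 (.inr ha.2.2.1.2), mul_zero]
  · intro i
    refine Finset.sum_eq_zero fun a ha => ?_
    obtain ⟨h1, h2, h3⟩ := mem_decreasing.1 (Finset.mem_filter.1 ha).2.2
    exact hF3 a h1 h2 h3
  · rintro i j ⟨hi, hj, harc⟩
    have hj' := (Finset.mem_sdiff.1 hj).2
    -- Forward tight arcs do not depend on the flow, and arcs entering T now carry none, so no
    -- backward arc can appear.
    rcases harc with harc | harc
    · exact hB.not_leaving i j ⟨hi, hj, .inl harc⟩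
    · have h1 := harc.2.1
      change S.Δ < F (j, i) / S.μ j at h1
      rw [hF3 (j, i) harc.1 hj' (.inl hi), zero_div] at h1
      exact lt_asymm h1 hΔ

end State

/-! ### Contraction of a tight arc -/

namespace Network

variable {V : Type*} {G : Network V} {t : V} {f : V × V → ℝ} {μ : V → ℝ} {Δ : ℝ} {r s : V} {c : ℝ}

/-- The flow without the arcs that are not tight. -/
noncomputable def tightPart (G : Network V) (μ : V → ℝ) (f : V × V → ℝ) : V × V → ℝ :=
  fun a => if a ∈ G.nonTight μ then 0 else f a

theorem mem_absorb_arcs {e : V × V} : e ∈ (G.absorb r s c).arcs ↔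
    (∃ a ∈ G.arcs, merge r s a = e) ∧ e.1 ≠ e.2 := by
  simp [absorb]

theorem label_merge (hμ : μ s = c * μ r) (v : V) :
    μ (if v = r then s else v) = (if v = r then c else 1) * μ v := by
  split_ifs with hv
  · rw [hv, hμ]
  · rw [one_mul]

/-- As μ_s = c μ_r, one relabeled unit at r is one relabeled unit at s. Merging with factor c is
therefore invisible after relabeling. -/
theorem Labeling.relGain_merge (h : G.Labeling t μ) (hc : 0 < c) (hμ : μ s = c * μ r) {a : V × V}
    (ha : a ∈ G.arcs) :
    G.gain a * (if a.2 = r then c else 1) / (if a.1 = r then c else 1) *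
      μ (merge r s a).1 / μ (merge r s a).2 = G.relGain μ a := by
  have h1 := h.fst_pos ha
  have h2 := h.snd_pos ha
  simp only [merge, label_merge hμ, relGain]
  have h3 : (0 : ℝ) < if a.1 = r then c else 1 := by split_ifs <;> linarith
  have h4 : (0 : ℝ) < if a.2 = r then c else 1 := by split_ifs <;> linarith
  field_simp

/-- Among the gains of parallel arcs the largest one is kept. -/
theorem absorb_gain {e : V × V} (he : e ∈ (G.absorb r s c).arcs) :
    (∃ a ∈ G.arcs, merge r s a = e ∧ (G.absorb r s c).gain e =
      G.gain a * (if a.2 = r then c else 1) / (if a.1 = r then c else 1)) ∧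
    ∀ a ∈ G.arcs, merge r s a = e →
      G.gain a * (if a.2 = r then c else 1) / (if a.1 = r then c else 1) ≤
        (G.absorb r s c).gain e := by
  obtain ⟨⟨a₀, ha₀, hae⟩, -⟩ := mem_absorb_arcs.1 he
  set I : Finset ℝ := (G.arcs.filter fun a => merge r s a = e).image fun a =>
    G.gain a * (if a.2 = r then c else 1) / (if a.1 = r then c else 1) with hI
  have hne : I.Nonempty := ⟨_, Finset.mem_image_of_mem _ (Finset.mem_filter.2 ⟨ha₀, hae⟩)⟩
  have hg : (G.absorb r s c).gain e = I.max' hne := by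
    change I.max.unbotD 0 = _
    rw [← Finset.coe_max' hne, WithBot.unbotD_coe]
  rw [hg]
  refine ⟨?_, fun a ha hm => Finset.le_max' I _
    (Finset.mem_image.2 ⟨a, Finset.mem_filter.2 ⟨ha, hm⟩, rfl⟩)⟩
  obtain ⟨a, ha, heq⟩ := Finset.mem_image.1 (I.max'_mem hne)
  rw [Finset.mem_filter] at ha
  exact ⟨a, ha.1, ha.2, heq.symm⟩

theorem WellFormed.absorb (h : G.WellFormed t) (hs : s ∈ G.nodes) (hrs : r ≠ s) (hrt : r ≠ t)
    (hc : 0 < c) : (G.absorb r s c).WellFormed t := by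
  refine ⟨Finset.mem_erase.2 ⟨hrt.symm, h.sink_mem⟩, fun e he => ?_, fun e he => ?_⟩
  · obtain ⟨⟨a, ha, rfl⟩, hne⟩ := mem_absorb_arcs.1 he
    obtain ⟨h1, h2, -⟩ := h.arc_mem a ha
    have key : ∀ v ∈ G.nodes, (if v = r then s else v) ∈ G.nodes.erase r := by
      intro v hv
      split_ifs with hvr
      · exact Finset.mem_erase.2 ⟨hrs.symm, hs⟩
      · exact Finset.mem_erase.2 ⟨hvr, hv⟩
    exact ⟨key _ h1, key _ h2, hne⟩
  · obtain ⟨⟨a, ha, -, heq⟩, -⟩ := absorb_gain he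
    rw [heq]
    have := h.gain_pos a ha
    have h3 : (0 : ℝ) < if a.1 = r then c else 1 := by split_ifs <;> linarith
    have h4 : (0 : ℝ) < if a.2 = r then c else 1 := by split_ifs <;> linarith
    positivity

theorem Labeling.absorb_relGain (h : G.Labeling t μ) (hc : 0 < c) (hμ : μ s = c * μ r)
    (hpos : ∀ v ∈ G.nodes, 0 < μ (if v = r then s else v)) {e : V × V}
    (he : e ∈ (G.absorb r s c).arcs) :
    (∃ a ∈ G.arcs, merge r s a = e ∧ (G.absorb r s c).relGain μ e = G.relGain μ a) ∧
    ∀ a ∈ G.arcs, merge r s a = e → G.relGain μ a ≤ (G.absorb r s c).relGain μ e := by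
  obtain ⟨⟨a, ha, hae, heq⟩, hmax⟩ := absorb_gain he
  refine ⟨⟨a, ha, hae, ?_⟩, fun b hb hbe => ?_⟩
  · rw [← h.relGain_merge hc hμ ha, hae, relGain, heq]
  · rw [← h.relGain_merge hc hμ hb, relGain, hbe]
    have h1 := hmax b hb hbe
    have h2 : 0 < μ e.1 := hbe ▸ hpos _ (h.wf.arc_mem b hb).1
    have h3 : 0 < μ e.2 := hbe ▸ hpos _ (h.wf.arc_mem b hb).2.1
    gcongr

theorem Labeling.absorb (h : G.Labeling t μ) (hs : s ∈ G.nodes) (hrs : r ≠ s) (hrt : r ≠ t)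
    (hc : 0 < c) (hμ : μ s = c * μ r) : (G.absorb r s c).Labeling t μ := by
  refine ⟨h.wf.absorb hs hrs hrt hc, fun i hi => h.label_pos i (Finset.mem_of_mem_erase hi),
    fun e he => ?_⟩
  have hpos : ∀ v ∈ G.nodes, 0 < μ (if v = r then s else v) := by
    intro v hv
    split_ifs
    · exact h.label_pos s hs
    · exact h.label_pos v hv
  obtain ⟨⟨a, ha, -, heq⟩, -⟩ := h.absorb_relGain hc hμ hpos he
  rw [heq]
  exact h.relGain_le a ha

theorem Labeling.absorbFlow_div (h : G.Labeling t μ) (hc : 0 < c) (hμ : μ s = c * μ r)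
    (g : V × V → ℝ) {e : V × V} (he : e ∈ (G.absorb r s c).arcs) :
    G.absorbFlow r s c g e / μ e.1 = ∑ a ∈ G.arcs with merge r s a = e, g a / μ a.1 := by
  rw [absorbFlow, if_pos he, Finset.sum_div]
  refine Finset.sum_congr rfl fun a ha => ?_
  rw [Finset.mem_filter] at ha
  have h1 := h.fst_pos ha.1
  have h3 : (0 : ℝ) < if a.1 = r then c else 1 := by split_ifs <;> linarith
  rw [← ha.2]
  simp only [merge, label_merge hμ]
  field_simp

/-- A flow on tight arcs is an ordinary flow after relabeling, so its excess is a signed sum over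
arcs. In this form merging only changes the indicators of the end nodes. -/
theorem Labeling.relExcess_of_tight (h : G.Labeling t μ) {g : V × V → ℝ}
    (hg : ∀ a ∈ G.arcs, G.relGain μ a < 1 → g a = 0) (i : V) :
    G.relExcess g μ i = (∑ a ∈ G.arcs,
      g a / μ a.1 * ((if a.2 = i then 1 else 0) - (if a.1 = i then 1 else 0))) -
        G.relDemand μ i := by
  rw [h.relExcess_eq]
  congr 1
  simp only [Finset.sum_filter]
  rw [← Finset.sum_sub_distrib]
  refine Finset.sum_congr rfl fun a ha => ?_
  have h1 : G.relGain μ a * (g a / μ a.1) = g a / μ a.1 := by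
    obtain hlt | heq := (h.relGain_le a ha).lt_or_eq
    · rw [hg a ha hlt]; simp
    · rw [heq, one_mul]
  rw [h1]
  split_ifs <;> ring

theorem tightPart_eq_zero {a : V × V} (ha : a ∈ G.arcs) (hlt : G.relGain μ a < 1) :
    G.tightPart μ f a = 0 := by
  simp [tightPart, nonTight, ha, hlt]

/-- The kept gain is the largest among the parallel arcs: if even it is not tight, none of the
preimages is, and the tight part vanishes on all of them. -/
theorem absorbFlow_tightPart_eq_zero (h : G.Labeling t μ) (hs : s ∈ G.nodes) (hc : 0 < c)
    (hμ : μ s = c * μ r) {e : V × V} (he : e ∈ (G.absorb r s c).arcs)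
    (hlt : (G.absorb r s c).relGain μ e < 1) :
    G.absorbFlow r s c (G.tightPart μ f) e = 0 := by
  have hpos : ∀ v ∈ G.nodes, 0 < μ (if v = r then s else v) := by
    intro v hv
    split_ifs
    · exact h.label_pos s hs
    · exact h.label_pos v hv
  obtain ⟨-, hmax⟩ := h.absorb_relGain hc hμ hpos he
  rw [absorbFlow, if_pos he]
  refine Finset.sum_eq_zero fun a ha => ?_
  rw [Finset.mem_filter] at ha
  rw [tightPart_eq_zero ha.1 ((hmax a ha.1 ha.2).trans_lt hlt), zero_mul]

theorem Labeling.relExcess_absorb (h : G.Labeling t μ) (hs : s ∈ G.nodes)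
    (hrs : r ≠ s) (hrt : r ≠ t) (hc : 0 < c) (hμ : μ s = c * μ r) (i : V) :
    (G.absorb r s c).relExcess (G.absorbFlow r s c (G.tightPart μ f)) μ i =
      (∑ a ∈ G.arcs, G.tightPart μ f a / μ a.1 *
        ((if (merge r s a).2 = i then 1 else 0) - (if (merge r s a).1 = i then 1 else 0))) -
        (G.absorb r s c).relDemand μ i := by
  rw [(h.absorb hs hrs hrt hc hμ).relExcess_of_tight
    fun e he hlt => absorbFlow_tightPart_eq_zero h hs hc hμ he hlt]
  congr 1
  have h1 : ∀ e ∈ (G.absorb r s c).arcs,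
      G.absorbFlow r s c (G.tightPart μ f) e / μ e.1 *
        ((if e.2 = i then 1 else 0) - (if e.1 = i then 1 else 0)) =
      ∑ a ∈ G.arcs with merge r s a = e, G.tightPart μ f a / μ a.1 *
        ((if (merge r s a).2 = i then 1 else 0) - (if (merge r s a).1 = i then 1 else 0)) := by
    intro e he
    rw [h.absorbFlow_div hc hμ _ he, Finset.sum_mul]
    refine Finset.sum_congr rfl fun a ha => ?_
    rw [Finset.mem_filter] at ha
    rw [ha.2]
  rw [Finset.sum_congr rfl h1]
  simp only [Finset.sum_filter]
  rw [Finset.sum_comm]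
  refine Finset.sum_congr rfl fun a ha => ?_
  rw [Finset.sum_ite_eq]
  split_ifs with hmem
  · rfl
  · rfl
  · rfl
  · rfl
  -- An arc that becomes a loop is lost, but its two indicators cancel.
  all_goals
    have : (merge r s a).1 = (merge r s a).2 := by
      by_contra hne
      exact hmem (mem_absorb_arcs.2 ⟨⟨a, ha, rfl⟩, hne⟩)
    simp_all

theorem relDemand_absorb_of_ne {i : V} (his : i ≠ s) :
    (G.absorb r s c).relDemand μ i = G.relDemand μ i := by
  simp [relDemand, absorb, his]

theorem relExcess_absorb_of_ne (h : G.Labeling t μ) (hs : s ∈ G.nodes)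
    (hrs : r ≠ s) (hrt : r ≠ t) (hc : 0 < c) (hμ : μ s = c * μ r) {i : V}
    (his : i ≠ s) (hir : i ≠ r) :
    (G.absorb r s c).relExcess (G.absorbFlow r s c (G.tightPart μ f)) μ i =
      G.relExcess (G.tightPart μ f) μ i := by
  have key : ∀ v : V, (if v = r then s else v) = i ↔ v = i := by
    intro v
    split_ifs with hv
    · subst hv; exact ⟨fun h => absurd h.symm his, fun h => absurd h.symm hir⟩
    · rfl
  rw [h.relExcess_absorb hs hrs hrt hc hμ, relDemand_absorb_of_ne his,
    h.relExcess_of_tight fun a ha hlt => tightPart_eq_zero ha hlt]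
  simp only [merge, key]

/-- The indicator of s at the image of a node is the sum of the indicators of r and s, and relabeled
demands add as well. -/
theorem relExcess_absorb_self (h : G.Labeling t μ) (hs : s ∈ G.nodes) (hr : r ∈ G.nodes)
    (hrs : r ≠ s) (hrt : r ≠ t) (hc : 0 < c) (hμ : μ s = c * μ r) :
    (G.absorb r s c).relExcess (G.absorbFlow r s c (G.tightPart μ f)) μ s =
      G.relExcess (G.tightPart μ f) μ s + G.relExcess (G.tightPart μ f) μ r := by
  have key₁ : ∀ a : V × V, (if (merge r s a).1 = s then (1 : ℝ) else 0) =
      (if a.1 = s then 1 else 0) + (if a.1 = r then 1 else 0) := by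
    intro a
    by_cases hv : a.1 = r
    · simp [merge, hv, hrs]
    · simp [merge, hv]
  have key₂ : ∀ a : V × V, (if (merge r s a).2 = s then (1 : ℝ) else 0) =
      (if a.2 = s then 1 else 0) + (if a.2 = r then 1 else 0) := by
    intro a
    by_cases hv : a.2 = r
    · simp [merge, hv, hrs]
    · simp [merge, hv]
  have hb : (G.absorb r s c).relDemand μ s = G.relDemand μ s + G.relDemand μ r := by
    have h1 := h.label_pos r hr
    simp only [relDemand, absorb, if_true, hμ]
    field_simp
  rw [h.relExcess_absorb hs hrs hrt hc hμ, hb,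
    h.relExcess_of_tight fun a ha hlt => tightPart_eq_zero ha hlt,
    h.relExcess_of_tight fun a ha hlt => tightPart_eq_zero ha hlt]
  simp only [key₁, key₂]
  have : ∀ a : V × V, G.tightPart μ f a / μ a.1 *
      ((if a.2 = s then 1 else 0) + (if a.2 = r then 1 else 0) -
        ((if a.1 = s then 1 else 0) + (if a.1 = r then 1 else 0))) =
      G.tightPart μ f a / μ a.1 * ((if a.2 = s then 1 else 0) - (if a.1 = s then 1 else 0)) +
      G.tightPart μ f a / μ a.1 * ((if a.2 = r then 1 else 0) - (if a.1 = r then 1 else 0)) := by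
    intro a; ring
  simp only [this, Finset.sum_add_distrib]
  ring

/-- Deleting the non-tight flow removes inflow that the excess covers and gives back at most dΔ of
outflow, on top of the old bound 4(d+2)Δ. -/
theorem ScaledFeasible.relExcess_tightPart (h : G.ScaledFeasible t f μ Δ) (hΔ : 0 < Δ) {i : V}
    (hi : i ∈ G.nodes.erase t) :
    0 ≤ G.relExcess (G.tightPart μ f) μ i ∧
      G.relExcess (G.tightPart μ f) μ i ≤ (5 * G.degree i + 8) * Δ := by
  have hl := h.toLabeling
  have h1 : G.relExcess (G.tightPart μ f) μ i = G.relExcess f μ i - G.nonTightInflow f μ i +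
      ∑ a ∈ G.arcs with a.1 = i ∧ G.relGain μ a < 1, f a / μ a.1 := by
    rw [hl.relExcess_eq, hl.relExcess_eq, nonTightInflow]
    simp only [Finset.sum_filter]
    have h2 : ∀ a ∈ G.arcs, (if a.2 = i then G.relGain μ a * (G.tightPart μ f a / μ a.1) else 0) =
        (if a.2 = i then G.relGain μ a * (f a / μ a.1) else 0) -
        (if a.2 = i ∧ G.relGain μ a < 1 then G.relGain μ a * (f a / μ a.1) else 0) := by
      intro a ha
      by_cases h3 : G.relGain μ a < 1
      · simp [tightPart_eq_zero ha h3, h3]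
      · simp [tightPart, nonTight, h3]
    have h3 : ∀ a ∈ G.arcs, (if a.1 = i then G.tightPart μ f a / μ a.1 else 0) =
        (if a.1 = i then f a / μ a.1 else 0) -
        (if a.1 = i ∧ G.relGain μ a < 1 then f a / μ a.1 else 0) := by
      intro a ha
      by_cases h3 : G.relGain μ a < 1
      · simp [tightPart_eq_zero ha h3, h3]
      · simp [tightPart, nonTight, h3]
    rw [Finset.sum_congr rfl h2, Finset.sum_congr rfl h3, Finset.sum_sub_distrib,
      Finset.sum_sub_distrib]
    ring
  have h2 : 0 ≤ ∑ a ∈ G.arcs with a.1 = i ∧ G.relGain μ a < 1, f a / μ a.1 := by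
    refine Finset.sum_nonneg fun a ha => ?_
    have ha' := (Finset.mem_filter.1 ha).1
    exact div_nonneg (h.flow_nonneg a ha') (h.fst_pos ha').le
  have h3 := sum_out_le (G := G) (f := f) (μ := μ) hΔ.le i (fun a => G.relGain μ a < 1)
    fun a ha _ hlt => h.slack a ha hlt
  have h4 := h.nonTightInflow_le i hi
  have h5 := h.nonTightInflow_nonneg i
  have h6 := h.relExcess_le i hi
  have h7 := h.wf.inDegree_add_outDegree_cast i
  have h8 : (0 : ℝ) ≤ G.inDegree i := Nat.cast_nonneg _
  rw [h1]
  constructor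
  · linarith
  · nlinarith [mul_nonneg h8 hΔ.le]

/-! Degrees after merging two nodes -/

theorem card_absorb_arcs_le : (G.absorb r s c).arcs.card ≤ G.arcs.card :=
  (Finset.card_filter_le _ _).trans Finset.card_image_le

/-- An arc of the merged network has at most two preimages, told apart by whether they touch r. -/
theorem WellFormed.card_incident_le (h : G.WellFormed t) (i : V) :
    (G.arcs.filter fun a => (merge r s a).1 ≠ (merge r s a).2 ∧
      ((merge r s a).1 = i ∨ (merge r s a).2 = i)).card ≤ 2 * (G.absorb r s c).degree i := by
  have h1 : ((((G.absorb r s c).arcs.filter fun a => a.1 = i ∨ a.2 = i) ×ˢ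
      (Finset.univ : Finset Bool))).card = 2 * (G.absorb r s c).degree i := by
    rw [Finset.card_product, Finset.card_univ, Fintype.card_bool, degree, mul_comm]
  rw [← h1]
  refine Finset.card_le_card_of_injOn
    (fun a => (merge r s a, decide (a.1 = r ∨ a.2 = r))) ?_ ?_
  · intro a ha
    simp only [Finset.coe_filter, Set.mem_ofPred_eq] at ha
    simp only [Finset.coe_product, Set.mem_prod, Finset.mem_coe, Finset.mem_filter,
      Finset.mem_univ, and_true]
    exact ⟨mem_absorb_arcs.2 ⟨⟨a, ha.1, rfl⟩, ha.2.1⟩, ha.2.2⟩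
  · rintro ⟨a1, a2⟩ ha ⟨b1, b2⟩ hb hab
    simp only [Finset.coe_filter, Set.mem_ofPred_eq] at ha hb
    have ha3 := (h.arc_mem _ ha.1).2.2
    have hb3 := (h.arc_mem _ hb.1).2.2
    have ha4 := ha.2.1
    have hb4 := hb.2.1
    simp only [merge, Prod.mk.injEq, decide_eq_decide] at hab ha3 hb3 ha4 hb4 ⊢
    clear ha hb
    obtain ⟨⟨h2, h3⟩, h4⟩ := hab
    by_cases e1 : a1 = r <;> by_cases e2 : a2 = r <;> by_cases e3 : b1 = r <;>
      by_cases e4 : b2 = r <;> simp only [e1, e2, e3, e4, if_true, if_false] at * <;> grind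

theorem WellFormed.degree_le_absorb_of_ne (h : G.WellFormed t) {i : V}
    (his : i ≠ s) (hir : i ≠ r) : G.degree i ≤ 2 * (G.absorb r s c).degree i := by
  refine le_trans (Finset.card_le_card fun a ha => ?_) (h.card_incident_le i)
  rw [Finset.mem_filter] at ha ⊢
  have h1 := (h.arc_mem a ha.1).2.2
  refine ⟨ha.1, ?_⟩
  simp only [merge]
  rcases ha.2 with h2 | h2
  · have h3 : a.1 ≠ r := h2 ▸ hir
    rw [if_neg h3]
    refine ⟨?_, .inl h2⟩
    split_ifs
    · exact h2 ▸ his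
    · exact h1
  · have h3 : a.2 ≠ r := h2 ▸ hir
    rw [if_neg h3]
    refine ⟨?_, .inr h2⟩
    split_ifs
    · exact h2 ▸ his.symm
    · exact h1

/-- The arcs rs and sr are the only ones that can become loops, and the only ones counted in both
degrees; this double count gives the 4. -/
theorem WellFormed.degree_add_le_absorb (h : G.WellFormed t) (hrs : r ≠ s) :
    G.degree r + G.degree s ≤ 2 * (G.absorb r s c).degree s + 4 := by
  have h2 : ({(r, s), (s, r)} : Finset (V × V)).card ≤ 2 := Finset.card_le_two
  rw [degree, degree, ← Finset.card_union_add_card_inter]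
  have h3 : ((G.arcs.filter fun a => a.1 = r ∨ a.2 = r) ∩
      (G.arcs.filter fun a => a.1 = s ∨ a.2 = s)).card ≤ 2 := by
    refine le_trans (Finset.card_le_card fun a ha => ?_) h2
    rw [Finset.mem_inter, Finset.mem_filter, Finset.mem_filter] at ha
    obtain ⟨⟨ha1, ha2⟩, -, ha3⟩ := ha
    obtain ⟨a1, a2⟩ := a
    simp only [Finset.mem_insert, Finset.mem_singleton, Prod.mk.injEq] at ha2 ha3 ⊢
    grind
  have h4 : ((G.arcs.filter fun a => a.1 = r ∨ a.2 = r) ∪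
      (G.arcs.filter fun a => a.1 = s ∨ a.2 = s)).card ≤ 2 * (G.absorb r s c).degree s + 2 := by
    refine le_trans (Finset.card_le_card (t := (G.arcs.filter fun a =>
      (merge r s a).1 ≠ (merge r s a).2 ∧ ((merge r s a).1 = s ∨ (merge r s a).2 = s)) ∪
      {(r, s), (s, r)}) fun a ha => ?_) ((Finset.card_union_le _ _).trans
        (add_le_add (h.card_incident_le s) h2))
    have ha1 : a ∈ G.arcs := by
      rw [Finset.mem_union, Finset.mem_filter, Finset.mem_filter] at ha
      rcases ha with ha | ha <;> exact ha.1
    have ha2 := (h.arc_mem a ha1).2.2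
    obtain ⟨a1, a2⟩ := a
    simp only [Finset.mem_union, Finset.mem_filter, ha1, true_and, merge, Finset.mem_insert,
      Finset.mem_singleton, Prod.mk.injEq] at ha ha2 ⊢
    grind
  omega

/-- Merging the ends of a tight arc keeps the flow feasible, for a larger scaling factor. -/
theorem ScaledFeasible.absorb (h : G.ScaledFeasible t f μ Δ) (hΔ : 0 < Δ) (hs : s ∈ G.nodes)
    (hr : r ∈ G.nodes) (hrs : r ≠ s) (hrt : r ≠ t) (hc : 0 < c) (hμ : μ s = c * μ r) :
    (G.absorb r s c).ScaledFeasible t (G.absorbFlow r s c (G.tightPart μ f)) μ (16 * Δ) := by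
  have hl := h.toLabeling
  have hl' := hl.absorb hs hrs hrt hc hμ
  have hmem : ∀ i ∈ (G.absorb r s c).nodes.erase t, i ∈ G.nodes.erase t ∧ i ≠ r := by
    intro i hi
    simp only [Network.absorb, Finset.mem_erase] at hi ⊢
    tauto
  have hrt' : r ∈ G.nodes.erase t := Finset.mem_erase.2 ⟨hrt, hr⟩
  refine ⟨hl', fun e he => ?_, fun e he hlt => ?_, fun i hi => ?_, fun i hi => ?_⟩
  · rw [absorbFlow, if_pos he]
    refine Finset.sum_nonneg fun a ha => ?_
    have ha' := (Finset.mem_filter.1 ha).1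
    have h1 := h.flow_nonneg a ha'
    have h2 : 0 ≤ G.tightPart μ f a := by
      simp only [tightPart]; split_ifs <;> simp [h1]
    have h3 : (0 : ℝ) ≤ if a.1 = r then c else 1 := by split_ifs <;> linarith
    exact mul_nonneg h2 h3
  · rw [absorbFlow_tightPart_eq_zero hl hs hc hμ he hlt, zero_div]
    positivity
  · have h0 : (G.absorb r s c).nonTightInflow (G.absorbFlow r s c (G.tightPart μ f)) μ i = 0 := by
      refine Finset.sum_eq_zero fun e he => ?_
      rw [Finset.mem_filter] at he
      rw [absorbFlow_tightPart_eq_zero hl hs hc hμ he.1 he.2.2]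
      simp
    rw [h0]
    obtain ⟨hi1, hir⟩ := hmem i hi
    by_cases his : i = s
    · subst his
      rw [relExcess_absorb_self hl hs hr hrs hrt hc hμ]
      exact add_nonneg (h.relExcess_tightPart hΔ hi1).1 (h.relExcess_tightPart hΔ hrt').1
    · rw [relExcess_absorb_of_ne hl hs hrs hrt hc hμ his hir]
      exact (h.relExcess_tightPart hΔ hi1).1
  · obtain ⟨hi1, hir⟩ := hmem i hi
    have h0 : (0 : ℝ) ≤ (G.absorb r s c).degree i := Nat.cast_nonneg _
    by_cases his : i = s
    · subst his
      rw [relExcess_absorb_self hl hs hr hrs hrt hc hμ]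
      have h1 := (h.relExcess_tightPart hΔ hi1).2
      have h2 := (h.relExcess_tightPart hΔ hrt').2
      have h3 : (G.degree r : ℝ) + G.degree i ≤ 2 * (G.absorb r i c).degree i + 4 := by
        exact_mod_cast h.wf.degree_add_le_absorb (c := c) hrs
      -- With d' the new degree, 5(2d'+4) + 16 = 10d' + 36 is below 64(d'+2), the bound for the new
      -- scaling factor 16Δ.
      nlinarith [mul_nonneg h0 hΔ.le]
    · rw [relExcess_absorb_of_ne hl hs hrs hrt hc hμ his hir]
      have h1 := (h.relExcess_tightPart hΔ hi1).2
      have h3 : (G.degree i : ℝ) ≤ 2 * (G.absorb r s c).degree i := by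
        exact_mod_cast h.wf.degree_le_absorb_of_ne (c := c) his hir
      nlinarith [mul_nonneg h0 hΔ.le]

end Network

/-! The potential of a node -/

/-- The potential of a node in `T₀` with degree `d` and relative excess `x`. -/
noncomputable def activeCost (d x : ℝ) : ℝ := x - d - 1

/-- The potential of a node outside of `T₀` with degree `d` and relative excess `x`. -/
noncomputable def passiveCost (d x : ℝ) : ℝ :=
  (3 * d + 7) * min 1 (Real.logb 2 ((max x (d + 2) + d) / (2 * d + 2)))

/-- The progress made by a node whose relative demand is `r`. -/
noncomputable def demandLevel (n k : ℕ) (r : ℝ) : ℝ :=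
  if 1 ≤ r then 1 + min (Real.logb 2 r) (5 + 2 * n + 4 * k) else 0

section costs

variable {d x y a : ℝ}

theorem one_le_passive_arg (hd : 0 ≤ d) : 1 ≤ (max x (d + 2) + d) / (2 * d + 2) := by
  rw [le_div_iff₀ (by linarith)]
  linarith [le_max_right x (d + 2)]

theorem passiveCost_nonneg (hd : 0 ≤ d) : 0 ≤ passiveCost d x :=
  mul_nonneg (by linarith)
    (le_min zero_le_one (Real.logb_nonneg one_lt_two (one_le_passive_arg hd)))

theorem passiveCost_le (hd : 0 ≤ d) : passiveCost d x ≤ 3 * d + 7 :=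
  mul_le_of_le_one_right (by linarith) (min_le_left _ _)

/-- A node dropped from T₀ has x < d+2, so its whole active charge disappears. -/
theorem passiveCost_eq_zero (hd : 0 ≤ d) (hx : x ≤ d + 2) : passiveCost d x = 0 := by
  have : (max x (d + 2) + d) / (2 * d + 2) = 1 := by
    rw [max_eq_right hx, div_eq_one_iff_eq (by linarith)]
    ring
  rw [passiveCost, this, Real.logb_one, min_eq_right zero_le_one, mul_zero]

/-- The maximum with d+2 is harmless because a ≥ 1, so the argument of the logarithm grows by at
most a; the cap is preserved since log₂ a ≥ 0. -/
theorem passiveCost_grow (hd : 0 ≤ d) (ha : 1 ≤ a) (h : y + d ≤ a * (x + d)) :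
    passiveCost d y ≤ passiveCost d x + (3 * d + 7) * Real.logb 2 a := by
  have ha0 : 0 < a := one_pos.trans_le ha
  have hl : 0 ≤ Real.logb 2 a := Real.logb_nonneg one_lt_two ha
  have h1 : max y (d + 2) + d ≤ a * (max x (d + 2) + d) := by
    rw [← max_add_add_right]
    refine max_le (h.trans ?_) ?_
    · gcongr; exact le_max_left _ _
    · have := le_max_right x (d + 2)
      nlinarith
  have hpx := one_le_passive_arg (x := x) hd
  have hpy := one_le_passive_arg (x := y) hd
  have h2 : (max y (d + 2) + d) / (2 * d + 2) ≤ a * ((max x (d + 2) + d) / (2 * d + 2)) := by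
    rw [← mul_div_assoc]
    exact div_le_div_of_nonneg_right h1 (by linarith)
  have h3 : Real.logb 2 ((max y (d + 2) + d) / (2 * d + 2)) ≤
      Real.logb 2 ((max x (d + 2) + d) / (2 * d + 2)) + Real.logb 2 a := by
    rw [add_comm (Real.logb 2 _) (Real.logb 2 a), ← Real.logb_mul ha0.ne' (by linarith)]
    exact Real.logb_le_logb_of_le one_lt_two (by linarith) h2
  rw [passiveCost, passiveCost, ← mul_add]
  refine mul_le_mul_of_nonneg_left ?_ (by linarith)
  rw [← min_add_add_right]
  exact le_min ((min_le_left _ _).trans (by linarith)) ((min_le_right _ _).trans h3)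

theorem passiveCost_mono (hd : 0 ≤ d) (h : y ≤ x) : passiveCost d y ≤ passiveCost d x := by
  have := passiveCost_grow hd le_rfl (show y + d ≤ 1 * (x + d) by linarith)
  simpa using this

/-- At the threshold for entering T₀ the logarithm is at least 1. The value 3d+7 is also the active
charge there, which makes entering free. -/
theorem passiveCost_top (hd : 0 ≤ d) : passiveCost d (4 * (d + 2)) = 3 * d + 7 := by
  have h1 : (2 : ℝ) ≤ (max (4 * (d + 2)) (d + 2) + d) / (2 * d + 2) := by
    rw [le_div_iff₀ (by linarith)]
    linarith [le_max_left (4 * (d + 2)) (d + 2)]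
  have h2 := Real.logb_le_logb_of_le one_lt_two two_pos h1
  rw [Real.logb_self_eq_one one_lt_two] at h2
  rw [passiveCost, min_eq_left h2, mul_one]

variable {n k : ℕ}

theorem demandLevel_nonneg (r : ℝ) : 0 ≤ demandLevel n k r := by
  unfold demandLevel
  split_ifs with h
  · have := Real.logb_nonneg one_lt_two h
    positivity
  · exact le_rfl

theorem demandLevel_le (r : ℝ) : demandLevel n k r ≤ 6 + 2 * n + 4 * k := by
  unfold demandLevel
  split_ifs with h
  · linarith [min_le_right (Real.logb 2 r) (5 + 2 * n + 4 * k : ℝ)]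
  · positivity

theorem demandLevel_mono {k' : ℕ} {r r' : ℝ} (hk : k ≤ k') (hr : r ≤ r') :
    demandLevel n k r ≤ demandLevel n k' r' := by
  by_cases h : 1 ≤ r
  · have h1 := Real.logb_le_logb_of_le one_lt_two (by linarith) hr
    have h2 : (k : ℝ) ≤ k' := by exact_mod_cast hk
    rw [demandLevel, demandLevel, if_pos h, if_pos (h.trans hr)]
    gcongr
  · rw [demandLevel, if_neg h]
    exact demandLevel_nonneg _

theorem one_le_demandLevel {r : ℝ} (h : 1 ≤ r) : 1 ≤ demandLevel n k r := by
  rw [demandLevel, if_pos h]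
  have := Real.logb_nonneg one_lt_two h
  have : 0 ≤ min (Real.logb 2 r) (5 + 2 * n + 4 * k : ℝ) := by positivity
  linarith

theorem demandLevel_eq_zero {r : ℝ} (h : r < 1) : demandLevel n k r = 0 :=
  if_neg (not_le.2 h)

/-- The level grows with the logarithm of the relative demand as long as this is not too large. -/
theorem demandLevel_mul {r : ℝ} (hr : 1 ≤ r) (ha : 1 ≤ a)
    (hle : a * r ≤ 2 ^ (5 + 2 * n + 4 * k)) :
    demandLevel n k r + Real.logb 2 a ≤ demandLevel n k (a * r) := by
  have h1 : 1 ≤ a * r := by nlinarith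
  have h2 : Real.logb 2 (a * r) ≤ 5 + 2 * n + 4 * k := by
    have := Real.logb_le_logb_of_le one_lt_two (by linarith) hle
    rw [← Real.rpow_natCast, Real.logb_rpow two_pos one_lt_two.ne'] at this
    exact_mod_cast this
  rw [demandLevel, demandLevel, if_pos hr, if_pos h1, min_eq_left h2,
    Real.logb_mul (by linarith) (by linarith)]
  linarith [min_le_left (Real.logb 2 r) (5 + 2 * n + 4 * k : ℝ)]

end costs

/-! ### Invariants, the potential of a state, and its change under contractions -/

namespace State

open Network

variable {V : Type*} {t : V} {S S' : State V} {n m : ℕ}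

/-- The invariants of the algorithm. -/
structure Valid (t : V) (n m : ℕ) (S : State V) : Prop where
  feasible : S.net.ScaledFeasible t S.f S.μ S.Δ
  scale_pos : 0 < S.Δ
  card_arcs_le : S.net.arcs.card ≤ m
  card_nodes : S.net.nodes.card + S.k = n
  T₀_subset : S.T₀ ⊆ S.T
  T_subset : S.T ⊆ S.net.nodes
  sink_notMem : t ∉ S.T₀
  high : ∀ i ∈ S.T₀, (S.d i + 2) * S.Δ ≤ S.e i

/-- The potential of a node. -/
noncomputable def nodeCost (S : State V) (i : V) : ℝ :=
  if i ∈ S.T₀ then activeCost (S.d i) (S.e i / S.Δ) else passiveCost (S.d i) (S.e i / S.Δ)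

/-- The potential of all excesses. -/
noncomputable def cost (t : V) (S : State V) : ℝ := ∑ i ∈ S.net.nodes.erase t, S.nodeCost i

/-- The absolute value of the demand in relation to the scaling factor. -/
noncomputable def demandRatio (n : ℕ) (S : State V) (i : V) : ℝ :=
  |S.net.relDemand S.μ i| * (16 ^ S.k * n) / S.Δ

/-- The distance of the level of a node from its upper bound. -/
noncomputable def gap (n : ℕ) (S : State V) (i : V) : ℝ :=
  6 + 2 * n + 4 * S.k - demandLevel n S.k (S.demandRatio n i)

/-- The potential of all demands. -/
noncomputable def deficit (t : V) (n : ℕ) (S : State V) : ℝ :=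
  ∑ i ∈ S.net.nodes.erase t, S.gap n i + 6 * n * (S.net.nodes.card - 1)

/-- The potential of a state. -/
noncomputable def potential (t : V) (n m : ℕ) (S : State V) : ℝ :=
  cost t S + 13 * m * deficit t n S

theorem d_nonneg (S : State V) (i : V) : 0 ≤ S.d i := Nat.cast_nonneg _

theorem gap_nonneg (i : V) : 0 ≤ S.gap n i := sub_nonneg.2 (demandLevel_le _)

theorem gap_le (i : V) : S.gap n i ≤ 6 + 2 * n + 4 * S.k :=
  sub_le_self _ (demandLevel_nonneg _)

theorem Valid.one_le_activeCost (h : Valid t n m S) {i : V} (hi : i ∈ S.T₀) :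
    1 ≤ activeCost (S.d i) (S.e i / S.Δ) := by
  have h1 := h.high i hi
  rw [← le_div_iff₀ h.scale_pos] at h1
  unfold activeCost
  linarith

theorem Valid.nodeCost_nonneg (h : Valid t n m S) (i : V) : 0 ≤ S.nodeCost i := by
  unfold nodeCost
  split_ifs with hi
  · linarith [h.one_le_activeCost hi]
  · exact passiveCost_nonneg (S.d_nonneg i)

theorem Valid.e_div_le (h : Valid t n m S) {i : V} (hi : i ∈ S.net.nodes.erase t) :
    S.e i / S.Δ ≤ 4 * (S.d i + 2) := by
  rw [div_le_iff₀ h.scale_pos]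
  exact h.feasible.relExcess_le i hi

theorem Valid.nodeCost_le (h : Valid t n m S) {i : V} (hi : i ∈ S.net.nodes.erase t) :
    S.nodeCost i ≤ 3 * S.d i + 7 := by
  unfold nodeCost
  split_ifs with hT
  · have := h.e_div_le hi
    unfold activeCost
    linarith
  · exact passiveCost_le (S.d_nonneg i)

/-- The origin of the constant 13: the degrees add up to at most 2m, and 7n ≤ 7m. -/
theorem Valid.sum_weight_le (h : Valid t n m S) (hnm : n ≤ m) {s : Finset V}
    (hs : s ⊆ S.net.nodes) : ∑ i ∈ s, (3 * S.d i + 7) ≤ 13 * m := by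
  have h1 := h.feasible.wf.sum_degree_le s
  have h2 : (S.net.arcs.card : ℝ) ≤ m := by exact_mod_cast h.card_arcs_le
  have h3 : (s.card : ℝ) ≤ m := by
    have := Finset.card_le_card hs
    have := h.card_nodes
    exact_mod_cast (show s.card ≤ m by omega)
  rw [Finset.sum_add_distrib, ← Finset.mul_sum, Finset.sum_const, nsmul_eq_mul]
  simp only [d]
  linarith

theorem Valid.cost_nonneg (h : Valid t n m S) : 0 ≤ cost t S :=
  Finset.sum_nonneg fun i _ => h.nodeCost_nonneg i

theorem Valid.cost_le (h : Valid t n m S) (hnm : n ≤ m) : cost t S ≤ 13 * m :=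
  (Finset.sum_le_sum fun _ hi => h.nodeCost_le hi).trans
    (h.sum_weight_le hnm (Finset.erase_subset _ _))

theorem Valid.one_le_cost (h : Valid t n m S) {i : V} (hi : i ∈ S.T₀) : 1 ≤ cost t S := by
  have h1 : i ∈ S.net.nodes.erase t := Finset.mem_erase.2
    ⟨fun hit => h.sink_notMem (hit ▸ hi), h.T_subset (h.T₀_subset hi)⟩
  refine le_trans ?_ (Finset.single_le_sum (fun j _ => h.nodeCost_nonneg j) h1)
  rw [nodeCost, if_pos hi]
  exact h.one_le_activeCost hi

theorem Valid.one_le_card_nodes (h : Valid t n m S) : 1 ≤ S.net.nodes.card :=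
  Finset.card_pos.2 ⟨t, h.feasible.wf.sink_mem⟩

theorem Valid.deficit_nonneg (h : Valid t n m S) : 0 ≤ deficit t n S := by
  have h1 : (1 : ℝ) ≤ S.net.nodes.card := by exact_mod_cast h.one_le_card_nodes
  have h2 : 0 ≤ ∑ i ∈ S.net.nodes.erase t, S.gap n i :=
    Finset.sum_nonneg fun i _ => gap_nonneg i
  have h3 : 0 ≤ 6 * (n : ℝ) * (S.net.nodes.card - 1) :=
    mul_nonneg (by positivity) (by linarith)
  unfold deficit
  linarith

theorem Valid.potential_nonneg (h : Valid t n m S) : 0 ≤ potential t n m S :=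
  add_nonneg h.cost_nonneg (mul_nonneg (by positivity) h.deficit_nonneg)

/-! Contraction -/

/-- The factor 16^k in the demand ratio compensates for 16Δ, so an untouched node keeps its ratio
and its gap rises by at most 4 with the cap. The merged node is given the largest possible gap. As
|V| + k = n, the change 4(|V| − 2) + (6 + 2n + 4k) − 6n equals −2. -/
theorem absorb_valid (h : Valid t n m S) {r s : V} {c : ℝ} (hs : s ∈ S.net.nodes)
    (hr : r ∈ S.net.nodes) (hrs : r ≠ s) (hrt : r ≠ t) (hc : 0 < c) (hμ : S.μ s = c * S.μ r)
    (hS' : S' = { S with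
      net := S.net.absorb r s c
      f := S.net.absorbFlow r s c (S.net.tightPart S.μ S.f)
      Δ := 16 * S.Δ
      T₀ := ∅
      T := ∅
      k := S.k + 1 }) :
    Valid t n m S' ∧ deficit t n S' ≤ deficit t n S - 2 := by
  have hcard : (S.net.nodes.erase r).card + 1 = S.net.nodes.card :=
    Finset.card_erase_add_one hr
  have hk := h.card_nodes
  have hΔ := h.scale_pos
  subst hS'
  refine ⟨⟨h.feasible.absorb h.scale_pos hs hr hrs hrt hc hμ, by simpa using h.scale_pos,
    card_absorb_arcs_le.trans h.card_arcs_le, ?_, by simp, by simp, by simp, by simp⟩, ?_⟩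
  · change (S.net.nodes.erase r).card + (S.k + 1) = n
    omega
  · set S' : State V := { S with
      net := S.net.absorb r s c
      f := S.net.absorbFlow r s c (S.net.tightPart S.μ S.f)
      Δ := 16 * S.Δ
      T₀ := ∅
      T := ∅
      k := S.k + 1 } with hS'
    have h1 : ∀ i, S'.gap n i ≤ S.gap n i + 4 + if s = i then (6 + 2 * n + 4 * S.k : ℝ) else 0 := by
      intro i
      split_ifs with hi
      · have h2 := gap_le (n := n) (S := S') i
        have h3 := gap_nonneg (n := n) (S := S) i
        have h4 : ((S'.k : ℕ) : ℝ) = S.k + 1 := by simp [hS']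
        rw [h4] at h2
        linarith
      · have h2 : S'.demandRatio n i = S.demandRatio n i := by
          unfold demandRatio
          have : S'.net.relDemand S'.μ i = S.net.relDemand S.μ i :=
            relDemand_absorb_of_ne (Ne.symm hi)
          rw [this]
          simp only [hS', pow_succ]
          field_simp
        have h3 := demandLevel_mono (n := n) (Nat.le_succ S.k) (le_refl (S.demandRatio n i))
        have h4 : S'.gap n i =
            6 + 2 * n + 4 * (S.k + 1) - demandLevel n S.k.succ (S.demandRatio n i) := by
          rw [gap, h2]
          simp [hS']
        rw [h4]
        unfold gap
        linarith
    have hmem : r ∈ S.net.nodes.erase t := Finset.mem_erase.2 ⟨hrt, hr⟩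
    have h2 : ∑ i ∈ (S.net.nodes.erase r).erase t, S'.gap n i ≤
        ∑ i ∈ S.net.nodes.erase t, S.gap n i + 4 * (S.net.nodes.card - 2) +
          (6 + 2 * n + 4 * S.k) := by
      have hcard2 : ((S.net.nodes.erase r).erase t).card + 2 = S.net.nodes.card := by
        rw [← hcard, ← Finset.card_erase_add_one
          (Finset.mem_erase.2 ⟨hrt.symm, h.feasible.wf.sink_mem⟩)]
      have hcard3 : (((S.net.nodes.erase r).erase t).card : ℝ) = S.net.nodes.card - 2 := by
        rw [← hcard2]; push_cast; ring
      refine (Finset.sum_le_sum fun i _ => h1 i).trans ?_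
      rw [Finset.sum_add_distrib, Finset.sum_add_distrib, Finset.sum_const, nsmul_eq_mul, hcard3,
        Finset.sum_ite_eq]
      have h3 : ∑ i ∈ (S.net.nodes.erase r).erase t, S.gap n i ≤
          ∑ i ∈ S.net.nodes.erase t, S.gap n i := by
        refine Finset.sum_le_sum_of_subset_of_nonneg ?_ fun i _ _ => gap_nonneg i
        exact Finset.erase_subset_erase _ (Finset.erase_subset _ _)
      have h4 : (if s ∈ (S.net.nodes.erase r).erase t then (6 + 2 * n + 4 * S.k : ℝ) else 0) ≤
          6 + 2 * n + 4 * S.k := by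
        split_ifs
        · exact le_rfl
        · positivity
      linarith
    have h3 : (S'.net.nodes.card : ℝ) = S.net.nodes.card - 1 := by
      change ((S.net.nodes.erase r).card : ℝ) = _
      rw [← hcard]; push_cast; ring
    have h4 : (S.net.nodes.card : ℝ) + S.k = n := by exact_mod_cast hk
    change ∑ i ∈ (S.net.nodes.erase r).erase t, S'.gap n i + 6 * n * (S'.net.nodes.card - 1) ≤ _
    rw [h3, deficit]
    linarith

/-- An abundant arc carries at least 17mΔ > Δ and so must be tight. Hence the factor used for
merging is the quotient of the labels, in either direction. -/
theorem ContractOne.valid (h : Valid t n m S) (hS : ContractOne t m S S') :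
    Valid t n m S' ∧ deficit t n S' ≤ deficit t n S - 2 := by
  obtain ⟨p, q, ⟨ha, hab⟩, rfl⟩ := hS
  obtain ⟨hp, hq, hpq⟩ := h.feasible.wf.arc_mem _ ha
  have hg := h.feasible.wf.gain_pos _ ha
  have hμp : 0 < S.μ p := h.feasible.label_pos p hp
  have hμq : 0 < S.μ q := h.feasible.label_pos q hq
  have htight : S.net.gain (p, q) * S.μ p = S.μ q := by
    have h1 : S.net.relGain S.μ (p, q) = 1 := by
      refine le_antisymm (h.feasible.relGain_le _ ha) ?_
      by_contra! hlt
      have h2 := hab.trans (h.feasible.slack _ ha hlt)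
      have h3 : 1 ≤ m := (Finset.card_pos.2 ⟨_, ha⟩).trans_le h.card_arcs_le
      have h4 : (1 : ℝ) ≤ m := by exact_mod_cast h3
      nlinarith [h.scale_pos]
    simp only [relGain] at h1
    rwa [div_eq_one_iff_eq hμq.ne'] at h1
  by_cases hpt : p = t
  · refine absorb_valid (r := q) (s := p) (c := 1 / S.net.gain (p, q)) h hp hq (Ne.symm hpq)
      (hpt ▸ Ne.symm hpq) (one_div_pos.2 hg) ?_ ?_
    · rw [← htight]; field_simp
    · simp only [contract, contractFlow, hpt, ne_eq, not_true_eq_false, if_false]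
      rfl
  · refine absorb_valid (r := p) (s := q) (c := S.net.gain (p, q)) h hq hp hpq hpt hg
      htight.symm ?_
    simp only [contract, contractFlow, hpt, ne_eq, not_false_eq_true, if_true]
    rfl

theorem contractions_valid (h : Valid t n m S)
    (hS : Relation.ReflTransGen (ContractOne t m) S S') :
    Valid t n m S' ∧ (S' = S ∨ deficit t n S' ≤ deficit t n S - 2) := by
  induction hS with
  | refl => exact ⟨h, .inl rfl⟩
  | tail _ hstep ih =>
    obtain ⟨h1, h2⟩ := hstep.valid ih.1
    refine ⟨h1, .inr ?_⟩
    rcases ih.2 with rfl | h3 <;> linarith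

/-- Without abundant arcs, demands are not too large. -/
theorem Valid.demandRatio_le (h : Valid t n m S) (hn : 2 ≤ n) (hm : m ≤ n ^ 2)
    (hno : ∀ a, ¬ S.Abundant m a) {i : V} (hi : i ∈ S.net.nodes.erase t) :
    S.demandRatio n i ≤ 2 ^ (5 + 2 * n + 4 * S.k) := by
  have hΔ := h.scale_pos
  have h1 := h.feasible.abs_relDemand_le (c := 17 * m * S.Δ) (by positivity)
    (fun a ha => by
      by_contra! hlt
      exact hno a ⟨ha, hlt.le⟩) hi
  have h2 : (S.net.nodes.card : ℝ) ≤ n := by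
    have := h.card_nodes
    exact_mod_cast (show S.net.nodes.card ≤ n by omega)
  have h3 : (S.net.degree i : ℝ) ≤ 2 * n := by
    have h4 := h.feasible.wf.inDegree_add_outDegree_cast i
    have h5 : (S.net.inDegree i : ℝ) ≤ S.net.nodes.card := by
      exact_mod_cast h.feasible.wf.inDegree_le i
    have h6 : (S.net.outDegree i : ℝ) ≤ S.net.nodes.card := by
      exact_mod_cast h.feasible.wf.outDegree_le i
    linarith
  have h4 : |S.net.relDemand S.μ i| ≤ (n * (17 * n ^ 2) + 4 * (2 * n + 2)) * S.Δ := by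
    have hm' : (m : ℝ) ≤ n ^ 2 := by exact_mod_cast hm
    calc _ ≤ S.net.nodes.card * (17 * m * S.Δ) + 4 * (S.net.degree i + 2) * S.Δ := h1
      _ ≤ n * (17 * n ^ 2 * S.Δ) + 4 * (2 * n + 2) * S.Δ := by gcongr
      _ = _ := by ring
  -- Equality holds at n = 3, where the induction starts; the squared inequality bounds n⁴ by a
  -- multiple of 4ⁿ, which absorbs the factors polynomial in n.
  have h5 : 8 * n ^ 2 ≤ 9 * 2 ^ n := by
    obtain rfl | h3n := hn.eq_or_lt
    · norm_num
    · have h3n' : 3 ≤ n := h3n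
      clear h1 h2 h3 h4 hm hn h3n hno h hi
      induction n, h3n' using Nat.le_induction with
      | base => norm_num
      | succ n hn ih => rw [pow_succ 2 n]; nlinarith
  have h6 : (8 * (n : ℝ) ^ 2) ≤ 9 * 2 ^ n := by exact_mod_cast h5
  have hn' : (2 : ℝ) ≤ n := by exact_mod_cast hn
  have h7 : ((n : ℝ) * (17 * n ^ 2) + 4 * (2 * n + 2)) * n ≤ 2 ^ (5 + 2 * n) := by
    have h8 : (8 * (n : ℝ) ^ 2) ^ 2 ≤ (9 * 2 ^ n) ^ 2 := by gcongr
    have h9 : (2 : ℝ) ^ (5 + 2 * n) = 32 * (2 ^ n) ^ 2 := by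
      rw [pow_add, pow_mul', ← pow_mul]; norm_num [pow_mul']
    rw [h9]
    have h10 : (4 : ℝ) ≤ n ^ 2 := by nlinarith
    nlinarith [mul_le_mul_of_nonneg_right h10 (sq_nonneg (n : ℝ))]
  calc S.demandRatio n i = |S.net.relDemand S.μ i| * (16 ^ S.k * n) / S.Δ := rfl
    _ ≤ (n * (17 * n ^ 2) + 4 * (2 * n + 2)) * S.Δ * (16 ^ S.k * n) / S.Δ := by gcongr
    _ = ((n : ℝ) * (17 * n ^ 2) + 4 * (2 * n + 2)) * n * 16 ^ S.k := by field_simp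
    _ ≤ 2 ^ (5 + 2 * n) * 16 ^ S.k := by gcongr
    _ = _ := by rw [pow_add _ (5 + 2 * n), pow_mul 2 4]; norm_num

end State

/-! ### Rank, removal from T₀, augmentation, extension of T, and demands in Elementary Step -/

namespace State

open Network

variable {V : Type*} {t : V} {S S' R : State V} {n m : ℕ}

/-- The number of nodes in `T`, refined by whether `T` can be extended or a path can be found. -/
noncomputable def rank (t : V) (S : State V) : ℕ :=
  2 * S.T.card + if (low t S ∩ S.T).Nonempty ∨ ∃ i j, S.Leaving i j then 1 else 0

/-- Either the potential decreases, or `T` grows in the sense of the rank. -/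
def Progress (t : V) (n m : ℕ) (S S' : State V) : Prop :=
  potential t n m S' ≤ potential t n m S - 1 ∨
    potential t n m S' ≤ potential t n m S ∧ S.T ⊆ S'.T ∧ rank t S < rank t S'

/-! Removal of nodes with small excesses -/

section dropLow

theorem dropLow_net : (dropLow R).net = R.net := by unfold dropLow; split_ifs <;> rfl

theorem dropLow_f : (dropLow R).f = R.f := by unfold dropLow; split_ifs <;> rfl

theorem dropLow_μ : (dropLow R).μ = R.μ := by unfold dropLow; split_ifs <;> rfl

theorem dropLow_Δ : (dropLow R).Δ = R.Δ := by unfold dropLow; split_ifs <;> rfl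

theorem dropLow_k : (dropLow R).k = R.k := by unfold dropLow; split_ifs <;> rfl

theorem dropLow_e (i : V) : (dropLow R).e i = R.e i := by
  rw [e, dropLow_net, dropLow_f, dropLow_μ, e]

theorem dropLow_d (i : V) : (dropLow R).d i = R.d i := by rw [d, dropLow_net, d]

theorem mem_dropLow_T₀ {i : V} :
    i ∈ (dropLow R).T₀ ↔ i ∈ R.T₀ ∧ ¬ R.e i < (R.d i + 2) * R.Δ := by
  unfold dropLow
  split_ifs with h
  · simp
  · push Not at h
    exact ⟨fun hi => ⟨hi, not_lt.2 (h i hi)⟩, fun hi => hi.1⟩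

theorem dropLow_T_subset (h : R.T₀ ⊆ R.T) : (dropLow R).T ⊆ R.T := by
  unfold dropLow
  split_ifs
  · exact (Finset.filter_subset _ _).trans h
  · exact subset_rfl

theorem dropLow_T₀_subset (h : R.T₀ ⊆ R.T) : (dropLow R).T₀ ⊆ (dropLow R).T := by
  unfold dropLow
  split_ifs
  · exact subset_rfl
  · exact h

theorem dropLow_deficit : deficit t n (dropLow R) = deficit t n R := by
  simp only [deficit, gap, demandRatio, dropLow_net, dropLow_μ, dropLow_Δ, dropLow_k]

theorem dropLow_valid (hf : R.net.ScaledFeasible t R.f R.μ R.Δ) (hΔ : 0 < R.Δ)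
    (hm : R.net.arcs.card ≤ m) (hn : R.net.nodes.card + R.k = n) (h₀ : R.T₀ ⊆ R.T)
    (hT : R.T ⊆ R.net.nodes) (ht : t ∉ R.T₀) : Valid t n m (dropLow R) where
  feasible := by rw [dropLow_net, dropLow_f, dropLow_μ, dropLow_Δ]; exact hf
  scale_pos := by rw [dropLow_Δ]; exact hΔ
  card_arcs_le := by rw [dropLow_net]; exact hm
  card_nodes := by rw [dropLow_net, dropLow_k]; exact hn
  T₀_subset := dropLow_T₀_subset h₀
  T_subset := by rw [dropLow_net]; exact (dropLow_T_subset h₀).trans hT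
  sink_notMem := fun h => ht (mem_dropLow_T₀.1 h).1
  high := fun i hi => by
    rw [dropLow_e, dropLow_d, dropLow_Δ]
    exact not_lt.1 (mem_dropLow_T₀.1 hi).2

/-- The potential of the excesses before nodes with small excesses are removed, and afterwards. -/
theorem dropLow_cost (h : Valid t n m S) (hnet : R.net = S.net) {w : V → ℝ} (hw : ∀ i, 0 ≤ w i)
    (h₀ : S.T₀ ⊆ R.T₀) (hactive : ∀ i ∈ S.T₀, R.e i / R.Δ ≤ S.e i / S.Δ) (hΔ : 0 < R.Δ)
    (hnew : ∀ i ∈ R.T₀, i ∉ S.T₀ → R.e i = 4 * (R.d i + 2) * R.Δ)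
    (hpassive : ∀ i ∈ S.net.nodes.erase t, i ∉ S.T₀ →
      passiveCost (S.d i) (R.e i / R.Δ) ≤ passiveCost (S.d i) (S.e i / S.Δ) + w i) :
    cost t (dropLow R) ≤ cost t S + ∑ i ∈ S.net.nodes.erase t, w i ∧
    ((∃ i ∈ R.T₀, R.e i < (R.d i + 2) * R.Δ) →
      (∃ i, i ∈ S.T₀) ∧ cost t (dropLow R) ≤ cost t S + ∑ i ∈ S.net.nodes.erase t, w i - 1) := by
  have hd : ∀ i, R.d i = S.d i := fun i => by rw [d, hnet, d]
  have hcost : cost t (dropLow R) = ∑ i ∈ S.net.nodes.erase t, (dropLow R).nodeCost i := by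
    rw [cost, dropLow_net, hnet]
  -- A node that has just entered sits at 4(d+2)Δ and is not dropped, so a dropped node was active
  -- before; its charge of at least 1 becomes 0.
  have hdrop : ∀ i ∈ R.T₀, R.e i < (R.d i + 2) * R.Δ →
      i ∈ S.T₀ ∧ (dropLow R).nodeCost i ≤ S.nodeCost i + w i - 1 := by
    intro i hi hlt
    have hiS : i ∈ S.T₀ := by
      by_contra hiS
      rw [hnew i hi hiS] at hlt
      have := R.d_nonneg i
      nlinarith [mul_nonneg this hΔ.le]
    refine ⟨hiS, ?_⟩
    have h1 : i ∉ (dropLow R).T₀ := fun h => (mem_dropLow_T₀.1 h).2 hlt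
    rw [nodeCost, if_neg h1, dropLow_d, dropLow_e, dropLow_Δ, passiveCost_eq_zero (R.d_nonneg i)
      ((div_le_iff₀ hΔ).2 hlt.le), nodeCost, if_pos hiS]
    linarith [h.one_le_activeCost hiS, hw i]
  have hle : ∀ i ∈ S.net.nodes.erase t, (dropLow R).nodeCost i ≤ S.nodeCost i + w i := by
    intro i hi
    by_cases hiR : i ∈ R.T₀
    · by_cases hlt : R.e i < (R.d i + 2) * R.Δ
      · linarith [(hdrop i hiR hlt).2]
      · rw [nodeCost, if_pos (mem_dropLow_T₀.2 ⟨hiR, hlt⟩), dropLow_d, dropLow_e, dropLow_Δ, hd]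
        by_cases hiS : i ∈ S.T₀
        · rw [nodeCost, if_pos hiS]
          have := hactive i hiS
          unfold activeCost
          linarith [hw i]
        -- A new active node: its passive charge was allowed to rise to 3d+7, which is exactly its
        -- new active charge.
        · have h1 : R.e i / R.Δ = 4 * (S.d i + 2) := by
            rw [hnew i hiR hiS, hd, mul_div_cancel_right₀ _ hΔ.ne']
          have h2 := hpassive i hi hiS
          rw [nodeCost, if_neg hiS]
          rw [h1, passiveCost_top (S.d_nonneg i)] at h2
          rw [h1]
          unfold activeCost
          linarith
    · have h1 : i ∉ (dropLow R).T₀ := fun h => hiR (mem_dropLow_T₀.1 h).1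
      have h2 : i ∉ S.T₀ := fun h => hiR (h₀ h)
      rw [nodeCost, if_neg h1, dropLow_d, dropLow_e, dropLow_Δ, hd, nodeCost, if_neg h2]
      exact hpassive i hi h2
  refine ⟨?_, ?_⟩
  · rw [hcost, cost, ← Finset.sum_add_distrib]
    exact Finset.sum_le_sum hle
  · rintro ⟨i, hi, hlt⟩
    obtain ⟨hiS, h1⟩ := hdrop i hi hlt
    refine ⟨⟨i, hiS⟩, ?_⟩
    have hmem : i ∈ S.net.nodes.erase t := Finset.mem_erase.2
      ⟨fun hit => h.sink_notMem (hit ▸ hiS), h.T_subset (h.T₀_subset hiS)⟩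
    rw [hcost, cost, ← Finset.sum_add_distrib, ← Finset.add_sum_erase _ _ hmem,
      ← Finset.add_sum_erase (S.net.nodes.erase t) (fun i => S.nodeCost i + w i) hmem]
    have := Finset.sum_le_sum fun j (hj : j ∈ (S.net.nodes.erase t).erase i) =>
      hle j (Finset.mem_of_mem_erase hj)
    linarith

end dropLow

/-! Path augmentation and extension of `T` -/

theorem mem_low {i : V} : i ∈ low t S ↔
    i = t ∨ i ∈ S.net.nodes.erase t ∧ S.e i < (S.d i + 1) * S.Δ := by
  simp [low]

/-- The active charge of p falls by one, or vanishes from at least 1 if p is dropped. The end q is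
the sink or a passive node with excess below (d+1)Δ, and one more unit leaves its passive charge at
0. -/
theorem Augment.valid (h : Valid t n m S) (hS : Augment t S S') :
    Valid t n m S' ∧ deficit t n S' = deficit t n S ∧ cost t S' ≤ cost t S - 1 := by
  obtain ⟨p, hp, q, hq, L, φ, hw, hnd, hS'⟩ := hS
  rw [Finset.mem_inter, mem_low] at hq
  have hΔ := h.scale_pos
  have hpn : p ∈ S.net.nodes := h.T_subset (h.T₀_subset hp)
  have hpt : p ∈ S.net.nodes.erase t :=
    Finset.mem_erase.2 ⟨fun hpt => h.sink_notMem (hpt ▸ hp), hpn⟩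
  have hqT₀ : q ∉ S.T₀ := by
    intro hq0
    rcases hq.1 with rfl | hlt
    · exact h.sink_notMem hq0
    · have := h.high q hq0
      linarith [hlt.2]
  have hpq : p ≠ q := fun hpq => hqT₀ (hpq ▸ hp)
  have hfeas : S.net.ScaledFeasible t (S.f + φ) S.μ S.Δ := by
    refine h.feasible.augment hΔ hw hnd (h.high p hp) ?_
    rcases hq.1 with hqt | hlt
    · exact .inl hqt
    · exact .inr hlt.2
  set S₁ : State V := { S with f := S.f + φ } with hS₁
  have he : ∀ i ∈ S.net.nodes, S₁.e i / S.Δ =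
      S.e i / S.Δ + ((if i = q then 1 else 0) - (if i = p then 1 else 0)) := by
    intro i hi
    have h1 : S₁.e i = S.e i + S.Δ * ((if i = q then 1 else 0) - (if i = p then 1 else 0)) :=
      hw.relExcess_eq h.feasible.toLabeling hi
    rw [h1]
    field_simp
  have hep : S₁.e p / S.Δ = S.e p / S.Δ - 1 := by rw [he p hpn]; simp [hpq]; ring
  have hother : ∀ i ∈ S.net.nodes, i ≠ p → i ≠ q → S₁.e i = S.e i := by
    intro i hi hip hiq
    have := he i hi
    simp only [hip, hiq, if_false, sub_zero, add_zero] at this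
    exact (div_left_inj' hΔ.ne').1 this
  set U : Finset V := if S₁.e p < (S₁.d p + 2) * S₁.Δ then S.T₀.erase p else S.T₀ with hU
  have hUsub : U ⊆ S.T₀ := by
    rw [hU]; split_ifs
    · exact Finset.erase_subset _ _
    · exact subset_rfl
  have hUmem : ∀ i, i ≠ p → (i ∈ U ↔ i ∈ S.T₀) := by
    intro i hip
    rw [hU]; split_ifs <;> simp [hip]
  have hUp : p ∈ U ↔ ¬ S₁.e p < (S₁.d p + 2) * S₁.Δ := by
    rw [hU]; split_ifs with h1 <;> simp [h1, hp]
  have hS'' : S' = { S₁ with T₀ := U, T := U } := hS'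
  clear hS'
  subst hS''
  refine ⟨⟨hfeas, hΔ, h.card_arcs_le, h.card_nodes, subset_rfl,
    hUsub.trans (h.T₀_subset.trans h.T_subset), fun h1 => h.sink_notMem (hUsub h1), ?_⟩, rfl, ?_⟩
  · intro i hi
    change i ∈ U at hi
    change (S.d i + 2) * S.Δ ≤ S₁.e i
    by_cases hip : i = p
    · subst hip
      exact not_lt.1 (hUp.1 hi)
    · have hi0 := hUsub hi
      rw [hother i (h.T_subset (h.T₀_subset hi0)) hip fun hiq => hqT₀ (hiq ▸ hi0)]
      exact h.high i hi0
  · have hle : ∀ i ∈ S.net.nodes.erase t,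
        State.nodeCost { S₁ with T₀ := U, T := U } i ≤ S.nodeCost i - if p = i then 1 else 0 := by
      intro i hi
      have hin := Finset.mem_of_mem_erase hi
      change (if i ∈ U then activeCost (S.d i) (S₁.e i / S.Δ) else
        passiveCost (S.d i) (S₁.e i / S.Δ)) ≤ _
      by_cases hip : p = i
      · subst hip
        have h1 := h.one_le_activeCost hp
        rw [nodeCost, if_pos hp, if_pos rfl]
        split_ifs with h2
        · rw [hep]; unfold activeCost; linarith
        · have h3 := not_not.1 (fun h3 => h2 (hUp.2 h3))
          rw [passiveCost_eq_zero (S.d_nonneg p) ((div_le_iff₀ hΔ).2 h3.le)]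
          linarith
      · rw [if_neg hip, sub_zero, nodeCost]
        simp only [hUmem i (Ne.symm hip)]
        by_cases hiq : i = q
        · subst hiq
          rw [if_neg hqT₀, if_neg hqT₀]
          rcases hq.1 with hit | hlt
          · exact absurd hit (Finset.mem_erase.1 hi).1
          · have h1 : S₁.e i / S.Δ ≤ S.d i + 2 := by
              rw [he i hin, if_pos rfl, if_neg (Ne.symm hip)]
              have := (div_le_iff₀ hΔ).2 hlt.2.le
              linarith
            rw [passiveCost_eq_zero (S.d_nonneg i) h1]
            exact passiveCost_nonneg (S.d_nonneg i)
        · rw [hother i hin (Ne.symm hip) hiq]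
    refine (Finset.sum_le_sum hle).trans (le_of_eq ?_)
    rw [Finset.sum_sub_distrib, Finset.sum_ite_eq, if_pos hpt, cost]

/-- The potential does not see T. The rank was 2|T| + 1, because an arc was leaving, and becomes at
least 2|T| + 2. -/
theorem extend_valid (h : Valid t n m S) {i j : V} (hij : S.Leaving i j)
    (hS' : S' = { S with T := insert j S.T }) :
    Valid t n m S' ∧ deficit t n S' = deficit t n S ∧ cost t S' = cost t S ∧
      S.T ⊆ S'.T ∧ rank t S < rank t S' := by
  have hj := Finset.mem_sdiff.1 hij.2.1
  subst hS'
  refine ⟨⟨h.feasible, h.scale_pos, h.card_arcs_le, h.card_nodes,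
    h.T₀_subset.trans (Finset.subset_insert _ _), Finset.insert_subset hj.1 h.T_subset,
    h.sink_notMem, h.high⟩, rfl, rfl, Finset.subset_insert _ _, ?_⟩
  unfold rank
  rw [if_pos (.inr ⟨i, j, hij⟩), Finset.card_insert_of_notMem hj.2]
  omega

/-! Demands in Elementary Step -/

theorem demandRatio_scaled_of_mem {a : ℝ} (ha : 0 < a) {i : V} (hi : i ∈ S.T) :
    (S.scaled a).demandRatio n i = S.demandRatio n i := by
  simp only [demandRatio, relDemand, scaled, hi, if_true, abs_div, abs_mul, abs_of_pos ha]
  field_simp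

/-- Outside T the label stays while Δ is divided by a; inside T the two changes compensate each
other. Thus only demands outside T can pay. -/
theorem demandRatio_scaled_of_notMem (a : ℝ) {i : V} (hi : i ∉ S.T) :
    (S.scaled a).demandRatio n i = a * S.demandRatio n i := by
  simp only [demandRatio, relDemand, scaled, hi, if_false]
  rw [div_div_eq_mul_div]
  ring

theorem demandRatio_nonneg (hΔ : 0 < S.Δ) (i : V) : 0 ≤ S.demandRatio n i := by
  unfold demandRatio; positivity

theorem gap_scaled_le (hΔ : 0 < S.Δ) {a : ℝ} (ha : 1 ≤ a) (i : V) :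
    (S.scaled a).gap n i ≤ S.gap n i := by
  have h1 : S.demandRatio n i ≤ (S.scaled a).demandRatio n i := by
    by_cases hi : i ∈ S.T
    · rw [demandRatio_scaled_of_mem (by linarith) hi]
    · rw [demandRatio_scaled_of_notMem a hi]
      exact le_mul_of_one_le_left (demandRatio_nonneg hΔ i) ha
  have h2 := demandLevel_mono (n := n) (le_refl S.k) h1
  change 6 + 2 * (n : ℝ) + 4 * S.k - demandLevel n S.k ((S.scaled a).demandRatio n i) ≤ _
  unfold gap
  linarith

/-- The deficit decreases at least as much as one of the gaps. -/
theorem deficit_scaled_le (hΔ : 0 < S.Δ) {a : ℝ} (ha : 1 ≤ a) {c : ℝ} {j : V}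
    (hj : j ∈ S.net.nodes.erase t) (hc : (S.scaled a).gap n j ≤ S.gap n j - c) :
    deficit t n (S.scaled a) ≤ deficit t n S - c := by
  have h1 : ∑ i ∈ (S.net.nodes.erase t).erase j, (S.scaled a).gap n i ≤
      ∑ i ∈ (S.net.nodes.erase t).erase j, S.gap n i :=
    Finset.sum_le_sum fun i _ => gap_scaled_le hΔ ha i
  change ∑ i ∈ S.net.nodes.erase t, (S.scaled a).gap n i + 6 * n * (S.net.nodes.card - 1) ≤ _
  rw [deficit, ← Finset.add_sum_erase _ _ hj, ← Finset.add_sum_erase (S.net.nodes.erase t)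
    (fun i => S.gap n i) hj]
  linarith

theorem deficit_scaled_le_self (hΔ : 0 < S.Δ) {a : ℝ} (ha : 1 ≤ a) :
    deficit t n (S.scaled a) ≤ deficit t n S := by
  have h1 : ∑ i ∈ S.net.nodes.erase t, (S.scaled a).gap n i ≤
      ∑ i ∈ S.net.nodes.erase t, S.gap n i :=
    Finset.sum_le_sum fun i _ => gap_scaled_le hΔ ha i
  change ∑ i ∈ S.net.nodes.erase t, (S.scaled a).gap n i + 6 * n * (S.net.nodes.card - 1) ≤ _
  unfold deficit
  linarith

/-- The condition for Filtration in terms of the relative demands. -/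
theorem demandRatio_lt_one_iff (hΔ : 0 < S.Δ) (hn : 0 < n) (i : V) :
    S.demandRatio n i < 1 ↔ |S.net.relDemand S.μ i| < S.Δ / (16 ^ S.k * n) := by
  have : (0 : ℝ) < n := by exact_mod_cast hn
  rw [demandRatio, div_lt_one hΔ, lt_div_iff₀ (by positivity)]

/-- After Filtration, the flow that arrives outside of `T` remains small. -/
theorem StepLength.inflow_le {a : ℝ} (ha : StepLength t S a) (hB : Blocked t S)
    (h : S.net.ScaledFeasible t S.f S.μ S.Δ) (hΔ : 0 < S.Δ) {i : V} (hiT : i ∉ S.T) :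
    (∑ c ∈ S.net.arcs with c.2 = i ∧ c.1 ∈ S.T, S.net.gain c * S.f c) / S.μ i ≤
      S.d i * (S.scaled a).Δ := by
  have h0 := ha.pos
  have h' := ha.scaledFeasible hB h hΔ
  have h1 : (∑ c ∈ S.net.arcs with c.2 = i ∧ c.1 ∈ S.T, S.net.gain c * S.f c) / S.μ i =
      (∑ c ∈ (S.scaled a).net.arcs with c.2 = i ∧ c.1 ∈ S.T,
        (S.scaled a).net.gain c * S.f c) / (S.scaled a).μ i := by
    simp only [scaled, hiT, if_false]
  have hΔ' : 0 < (S.scaled a).Δ := div_pos hΔ h0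
  rw [h1, h'.sum_gain_div]
  refine (h'.toLabeling.sum_in_le hΔ'.le i _ fun c hc hci hp => ⟨h.flow_nonneg c hc, ?_⟩).trans ?_
  · have h2 := hB.flow_le_of_leaving h hc hp (hci ▸ hiT)
    simp only [scaled, hp, if_true]
    rw [mul_comm, ← div_div]
    gcongr
  · have h2 := h.wf.inDegree_add_outDegree_cast i
    have h3 : (0 : ℝ) ≤ S.net.outDegree i := Nat.cast_nonneg _
    have h4 : (S.net.inDegree i : ℝ) ≤ S.d i := by unfold d; linarith
    exact mul_le_mul_of_nonneg_right h4 hΔ'.le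

end State

/-! ### The potential over a whole iteration -/

namespace State

open Network

variable {V : Type*} {t : V} {S S' : State V} {F : V × V → ℝ} {n m : ℕ}

/-- The flow `F` can be used in place of the flow of `S` in the last part of an iteration. -/
structure Prepared (t : V) (S : State V) (F : V × V → ℝ) : Prop where
  feasible : S.net.ScaledFeasible t F S.μ S.Δ
  e_le : ∀ i ∈ S.T, ({ S with f := F } : State V).e i ≤ S.e i
  passiveCost_le : ∀ i ∈ S.net.nodes.erase t, i ∉ S.T →
    passiveCost (S.d i) (({ S with f := F } : State V).e i / S.Δ) ≤
      passiveCost (S.d i) (S.e i / S.Δ)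
  not_leaving : ∀ i j, ¬ ({ S with f := F } : State V).Leaving i j

theorem Blocked.prepared (hB : Blocked t S) (h : S.net.ScaledFeasible t S.f S.μ S.Δ) :
    Prepared t S S.f :=
  ⟨h, fun _ _ => le_rfl, fun _ _ _ => le_rfl, hB.not_leaving⟩

/-- After Filtration the relative excesses outside T are at most d+1, so their passive charges
vanish. -/
theorem Filtered.prepared (hF : Filtered t n S { S with f := F }) (hB : Blocked t S)
    (h : Valid t n m S) (hc : FiltrationCond t n S) : Prepared t S F := by
  refine ⟨hF.feasible, hF.e_le_of_mem, fun i hi hiT => ?_, hF.not_leaving⟩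
  have hΔ := h.scale_pos
  have h1 := hF.e_le_of_notMem i hi hiT
  have h2 := sum_abs_relDemand_le (S := S) (t := t) (n := n) hΔ.le
    (by have := h.card_nodes; omega) hc
  have h3 := hB.inflow_le h.feasible hΔ hiT
  rw [passiveCost_eq_zero (S.d_nonneg i)]
  · exact passiveCost_nonneg (S.d_nonneg i)
  · rw [div_le_iff₀ hΔ]
    linarith

theorem rank_eq (h₁ : ¬ (low t S ∩ S.T).Nonempty) (h₂ : ¬ ∃ i j, S.Leaving i j) :
    rank t S = 2 * S.T.card := by
  rw [rank, if_neg (not_or.2 ⟨h₁, h₂⟩), add_zero]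

/-- The end of an iteration without Elementary Step. -/
theorem Prepared.drop (hP : Prepared t S F) (h : Valid t n m S) (htT : t ∉ S.T)
    (hrank : rank t S = 2 * S.T.card)
    (hne : ¬ ((∀ i ∈ S.T₀, (S.d i + 2) * S.Δ ≤ ({ S with f := F } : State V).e i) ∧
      ∀ i ∈ S.T, (S.d i + 1) * S.Δ ≤ ({ S with f := F } : State V).e i)) :
    Valid t n m (dropLow { S with f := F }) ∧
    deficit t n (dropLow { S with f := F }) = deficit t n S ∧
    Progress t n m S (dropLow { S with f := F }) := by
  have hΔ := h.scale_pos
  set R : State V := { S with f := F } with hR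
  have hdef : deficit t n (dropLow R) = deficit t n S := dropLow_deficit
  refine ⟨dropLow_valid hP.feasible hΔ h.card_arcs_le h.card_nodes h.T₀_subset h.T_subset
    h.sink_notMem, hdef, ?_⟩
  obtain ⟨h1, h2⟩ := dropLow_cost (R := R) h rfl (w := 0) (fun _ => le_rfl) subset_rfl
    (fun i hi => div_le_div_of_nonneg_right (hP.e_le i (h.T₀_subset hi)) hΔ.le) hΔ
    (fun i hi hi' => absurd hi hi') (fun i hi hi' => by
      rw [Pi.zero_apply, add_zero]
      by_cases hiT : i ∈ S.T
      · exact passiveCost_mono (S.d_nonneg i) (div_le_div_of_nonneg_right (hP.e_le i hiT) hΔ.le)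
      · exact hP.passiveCost_le i hi hiT)
  simp only [Pi.zero_apply, Finset.sum_const_zero, add_zero] at h1 h2
  by_cases hdrop : ∃ i ∈ R.T₀, R.e i < (R.d i + 2) * R.Δ
  · left
    have := (h2 hdrop).2
    unfold potential
    rw [hdef]
    linarith
  · right
    have hRR : dropLow R = R := if_neg hdrop
    refine ⟨by unfold potential; rw [hdef]; linarith, by rw [hRR], ?_⟩
    rw [hRR, hrank]
    push Not at hdrop
    -- Nothing was dropped, so Elementary Step was prevented by a node of T with low excess. It
    -- makes an augmentation possible next, which turns on the extra unit of the rank.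
    have hex : ∃ i ∈ S.T, R.e i < (S.d i + 1) * S.Δ := by
      by_contra! hcon
      exact hne ⟨hdrop, hcon⟩
    obtain ⟨i, hi, hlt⟩ := hex
    have hlow : (low t R ∩ R.T).Nonempty := by
      refine ⟨i, Finset.mem_inter.2 ⟨mem_low.2 (.inr ⟨Finset.mem_erase.2 ⟨?_, h.T_subset hi⟩, hlt⟩),
        hi⟩⟩
      rintro rfl
      exact htT hi
    rw [rank, if_pos (.inl hlow)]
    exact Nat.lt_succ_self _

/-- If Elementary Step is preceded by Filtration, then the relative excesses outside of `T` remain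
small, unless there are large demands outside of `T`. -/
theorem Filtered.scaled_e_le (hF : Filtered t n S { S with f := F }) (h : Valid t n m S)
    (hB : Blocked t { S with f := F }) {a : ℝ} (ha : StepLength t { S with f := F } a)
    (hb : ∀ i ∈ (S.net.nodes \ S.T).erase t, |S.net.relDemand S.μ i| <
      (S.Δ / a) / (16 ^ S.k * n)) {i : V} (hi : i ∈ S.net.nodes.erase t) (hiT : i ∉ S.T) :
    (scaled a { S with f := F }).e i ≤ (S.d i + 1) * (S.Δ / a) := by
  have hΔ := h.scale_pos
  have h0 := ha.pos
  set R : State V := { S with f := F } with hR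
  have h1 := ha.inflow_le hB hF.feasible hΔ hiT
  have h2 : (∑ c ∈ R.net.arcs with c.2 = i ∧ c.1 ∈ R.T, R.net.gain c * R.f c) =
      ∑ c ∈ S.net.arcs with c.2 = i ∧ c.1 ∈ S.T, S.net.gain c * S.f c := by
    refine Finset.sum_congr rfl fun c hc => ?_
    rw [Finset.mem_filter] at hc
    rw [hF.flow_eq c hc.1 hc.2.2]
  -- No flow at i is rescaled after Filtration, and the label of i stays, so the relabeled excess
  -- does not change at all; only Δ does.
  have h3 : (scaled a R).e i = R.e i := by
    rw [e, relExcess, scaled_excess_of_notMem (S := R) a hiT, e, relExcess, excess_eq, hF.r₁_eq_zero,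
      hF.r₃_eq_zero]
    have : (scaled a R).μ i = R.μ i := if_neg hiT
    rw [this]
    ring
  have h4 := hF.e_le_of_notMem i hi hiT
  have h5 := sum_abs_relDemand_le (S := S) (t := t) (n := n) (c := S.Δ / a) (by positivity)
    (by have := h.card_nodes; omega) hb
  rw [h2] at h1
  rw [h3]
  have h6 : (∑ c ∈ S.net.arcs with c.2 = i ∧ c.1 ∈ S.T, S.net.gain c * S.f c) / S.μ i ≤
    S.d i * (S.Δ / a) := h1
  linarith

/-- Elementary Step with finite step length. -/
theorem Prepared.scaleBy (hP : Prepared t S F) (h : Valid t n m S) (hn : 2 ≤ n) (hnm : n ≤ m)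
    (hm : m ≤ n ^ 2) (hrank : rank t S = 2 * S.T.card)
    (hcase : (F = S.f ∧ ¬ FiltrationCond t n S) ∨
      (FiltrationCond t n S ∧ Filtered t n S { S with f := F }))
    (hB : Blocked t { S with f := F }) {a : ℝ} (ha : StepLength t { S with f := F } a)
    (hS' : S' = scaleBy t a { S with f := F }) :
    Valid t n m S' ∧ deficit t n S' ≤ deficit t n S ∧
      ((∀ c, ¬ S'.Abundant m c) → Progress t n m S S') := by
  have hΔ := h.scale_pos
  have h0 := ha.pos
  have hl : 0 ≤ Real.logb 2 a := Real.logb_nonneg one_lt_two ha.one_le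
  have hΔ' : 0 < S.Δ / a := div_pos hΔ h0
  set S₁ : State V := { S with f := F } with hS₁
  have hfeas := ha.scaledFeasible hB hP.feasible hΔ
  set A : Finset V := ((S.net.nodes \ S.T).erase t).filter fun i =>
    (scaled a S₁).e i = 4 * (S.d i + 2) * (S.Δ / a) with hA
  set R : State V := { scaled a S₁ with T₀ := S.T₀ ∪ A, T := S.T ∪ (S.T₀ ∪ A) } with hR
  have hS'' : S' = dropLow R := hS'
  clear hS'
  subst hS''
  have hAmem : ∀ i ∈ A, i ∈ S.net.nodes ∧ i ∉ S.T ∧ i ≠ t := by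
    intro i hi
    have := (Finset.mem_filter.1 hi).1
    simp only [Finset.mem_erase, Finset.mem_sdiff] at this
    tauto
  have hRT : S.T ⊆ R.T := Finset.subset_union_left
  have hRsub : R.T ⊆ S.net.nodes := by
    refine Finset.union_subset h.T_subset (Finset.union_subset (h.T₀_subset.trans h.T_subset) ?_)
    exact fun i hi => (hAmem i hi).1
  have hdef : deficit t n (dropLow R) = deficit t n (scaled a S₁) := dropLow_deficit
  have hdefle : deficit t n (scaled a S₁) ≤ deficit t n S :=
    deficit_scaled_le_self (S := S₁) hΔ ha.one_le
  have hvalid : Valid t n m (dropLow R) := by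
    refine dropLow_valid hfeas hΔ' h.card_arcs_le h.card_nodes Finset.subset_union_right hRsub ?_
    intro ht
    rcases Finset.mem_union.1 ht with ht | ht
    · exact h.sink_notMem ht
    · exact (hAmem t ht).2.2 rfl
  refine ⟨hvalid, hdef.trans_le hdefle, fun hno => ?_⟩
  have he_mem : ∀ i ∈ S.T, R.e i / R.Δ ≤ S.e i / S.Δ := fun i hi =>
    (ha.scaled_e_le_of_mem hB hP.feasible hΔ hi).trans
      (div_le_div_of_nonneg_right (hP.e_le i hi) hΔ.le)
  have hnew : ∀ i ∈ R.T₀, i ∉ S.T₀ → R.e i = 4 * (R.d i + 2) * R.Δ := by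
    intro i hi hi'
    exact (Finset.mem_filter.1 ((Finset.mem_union.1 hi).resolve_left hi')).2
  have hmain : (potential t n m (dropLow R) ≤ potential t n m S) ∧
      ((∃ i ∈ R.T₀, R.e i < (R.d i + 2) * R.Δ) →
        potential t n m (dropLow R) ≤ potential t n m S - 1) := by
    have hcost : ∀ w : V → ℝ, (∀ i, 0 ≤ w i) → (∀ i ∈ S.net.nodes.erase t, i ∉ S.T →
        passiveCost (S.d i) (R.e i / R.Δ) ≤ passiveCost (S.d i) (S.e i / S.Δ) + w i) →
        cost t (dropLow R) ≤ cost t S + ∑ i ∈ S.net.nodes.erase t, w i ∧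
        ((∃ i ∈ R.T₀, R.e i < (R.d i + 2) * R.Δ) →
          (∃ i, i ∈ S.T₀) ∧
            cost t (dropLow R) ≤ cost t S + ∑ i ∈ S.net.nodes.erase t, w i - 1) := by
      intro w hw hpass
      refine dropLow_cost (R := R) h rfl hw Finset.subset_union_left
        (fun i hi => he_mem i (h.T₀_subset hi)) hΔ' hnew fun i hi hi' => ?_
      by_cases hiT : i ∈ S.T
      · have := passiveCost_mono (S.d_nonneg i) (he_mem i hiT)
        linarith [hw i]
      · exact hpass i hi hiT
    -- The general allowance for growth, with total at most 13m log₂ a; it is used where `deficit`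
    -- can pay.
    have hgrow := hcost (fun i => (3 * S.d i + 7) * Real.logb 2 a)
      (fun i => mul_nonneg (by linarith [S.d_nonneg i]) hl) fun i hi hiT => by
        have h1 := ha.scaled_e_le_of_notMem hB hP.feasible hΔ hi hiT
        have h2 := passiveCost_grow (S.d_nonneg i) ha.one_le h1
        have h3 := hP.passiveCost_le i hi hiT
        exact h2.trans (by linarith)
    have hmem : ∀ j ∈ (S.net.nodes \ S.T).erase t, j ∈ S.net.nodes.erase t ∧ j ∉ S.T := by
      intro j hj
      simp only [Finset.mem_erase, Finset.mem_sdiff] at hj ⊢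
      tauto
    rcases hcase with ⟨-, hc⟩ | ⟨hc, hF⟩
    · unfold FiltrationCond at hc
      push Not at hc
      obtain ⟨j, hj, hlarge⟩ := hc
      have hj' := hmem j hj
      rw [← not_lt, ← demandRatio_lt_one_iff hΔ (by omega), not_lt] at hlarge
      have hratio : (scaled a S₁).demandRatio n j = a * S.demandRatio n j :=
        demandRatio_scaled_of_notMem (S := S₁) a hj'.2
      -- The ratio of j is multiplied by a, and without abundant arcs after the step it is still
      -- below the cap, so the level gains the full log₂ a.
      have hgap : (scaled a S₁).gap n j ≤ S₁.gap n j - Real.logb 2 a := by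
        have h1 : (dropLow R).demandRatio n j ≤ 2 ^ (5 + 2 * n + 4 * (dropLow R).k) :=
          hvalid.demandRatio_le hn hm hno (by rw [dropLow_net]; exact hj'.1)
        have h2 : (dropLow R).demandRatio n j = (scaled a S₁).demandRatio n j := by
          simp only [demandRatio, dropLow_net, dropLow_μ, dropLow_Δ, dropLow_k, hR]
        rw [h2, hratio, dropLow_k] at h1
        have h3 := demandLevel_mul hlarge ha.one_le h1
        have h4 : (scaled a S₁).gap n j = 6 + 2 * n + 4 * S.k -
            demandLevel n S.k (a * S.demandRatio n j) := by rw [← hratio]; rfl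
        have h5 : S₁.gap n j = 6 + 2 * n + 4 * S.k - demandLevel n S.k (S.demandRatio n j) := rfl
        have h6 : demandLevel n S.k (S.demandRatio n j) + Real.logb 2 a ≤
          demandLevel n S.k (a * S.demandRatio n j) := h3
        rw [h4, h5]
        linarith
      have hd : deficit t n (scaled a S₁) ≤ deficit t n S - Real.logb 2 a :=
        deficit_scaled_le (S := S₁) hΔ ha.one_le hj'.1 hgap
      have hsum : ∑ i ∈ S.net.nodes.erase t, (3 * S.d i + 7) * Real.logb 2 a ≤
          13 * m * Real.logb 2 a := by
        rw [← Finset.sum_mul]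
        exact mul_le_mul_of_nonneg_right (h.sum_weight_le hnm (Finset.erase_subset _ _)) hl
      have hd' : 13 * (m : ℝ) * deficit t n (scaled a S₁) ≤
          13 * m * (deficit t n S - Real.logb 2 a) :=
        mul_le_mul_of_nonneg_left hd (by positivity)
      unfold potential
      rw [hdef]
      refine ⟨?_, fun hdrop => ?_⟩
      · linarith [hgrow.1]
      · linarith [(hgrow.2 hdrop).2]
    · by_cases hlarge : ∃ j ∈ (S.net.nodes \ S.T).erase t, 1 ≤ (scaled a S₁).demandRatio n j
      · obtain ⟨j, hj, hlarge⟩ := hlarge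
        have hj' := hmem j hj
        have hsmall : S.demandRatio n j < 1 :=
          (demandRatio_lt_one_iff hΔ (by omega) j).2 (hc j hj)
        -- The level jumps from 0 to at least 1 when the ratio passes 1; times 13m, this pays for
        -- any new value of `cost`.
        have hgap : (scaled a S₁).gap n j ≤ S₁.gap n j - 1 := by
          have h1 := one_le_demandLevel (n := n) (k := S.k) hlarge
          have h2 := demandLevel_eq_zero (n := n) (k := S.k) hsmall
          have h3 : (scaled a S₁).gap n j = 6 + 2 * n + 4 * S.k -
            demandLevel n S.k ((scaled a S₁).demandRatio n j) := rfl
          have h4 : S₁.gap n j = 6 + 2 * n + 4 * S.k - demandLevel n S.k (S.demandRatio n j) := rfl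
          rw [h3, h4]
          linarith
        have hd : deficit t n (scaled a S₁) ≤ deficit t n S - 1 :=
          deficit_scaled_le (S := S₁) hΔ ha.one_le hj'.1 hgap
        have hd' : 13 * (m : ℝ) * deficit t n (scaled a S₁) ≤ 13 * m * (deficit t n S - 1) :=
          mul_le_mul_of_nonneg_left hd (by positivity)
        have hc1 := hvalid.cost_le hnm
        have hc2 := h.cost_nonneg
        unfold potential
        rw [hdef]
        refine ⟨?_, fun hdrop => ?_⟩
        · linarith
        -- The additional unit comes from the old `cost`: the dropped node was active, so `cost` was
        -- at least 1.
        · obtain ⟨i, hi⟩ := (hgrow.2 hdrop).1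
          linarith [h.one_le_cost hi]
      · push Not at hlarge
        have hb : ∀ i ∈ (S.net.nodes \ S.T).erase t, |S.net.relDemand S.μ i| <
            (S.Δ / a) / (16 ^ S.k * n) := by
          intro i hi
          have h1 := (demandRatio_lt_one_iff (S := scaled a S₁) (n := n) hΔ' (by omega) i).1
            (hlarge i hi)
          have h2 : (scaled a S₁).net.relDemand (scaled a S₁).μ i = S.net.relDemand S.μ i := by
            have : (scaled a S₁).μ i = S.μ i := if_neg (hmem i hi).2
            rw [relDemand, this]
            rfl
          rw [h2] at h1
          exact h1
        -- All demands outside T remain small for the new Δ, so the excesses there remain free of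
        -- charge and no allowance is needed.
        have hzero := hcost 0 (fun _ => le_rfl) fun i hi hiT => by
          have h1 := hF.scaled_e_le h hB ha hb hi hiT
          have h2 : R.e i / R.Δ ≤ S.d i + 2 :=
            (div_le_iff₀ hΔ').2 (h1.trans (mul_le_mul_of_nonneg_right (by linarith) hΔ'.le))
          rw [passiveCost_eq_zero (S.d_nonneg i) h2, Pi.zero_apply, add_zero]
          exact passiveCost_nonneg (S.d_nonneg i)
        simp only [Pi.zero_apply, Finset.sum_const_zero, add_zero] at hzero
        have hd' : 13 * (m : ℝ) * deficit t n (scaled a S₁) ≤ 13 * m * deficit t n S :=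
          mul_le_mul_of_nonneg_left hdefle (by positivity)
        unfold potential
        rw [hdef]
        refine ⟨?_, fun hdrop => ?_⟩
        · linarith [hzero.1]
        · linarith [(hzero.2 hdrop).2]
  by_cases hdrop : ∃ i ∈ R.T₀, R.e i < (R.d i + 2) * R.Δ
  · exact .inl (hmain.2 hdrop)
  · have hRR : dropLow R = R := if_neg hdrop
    refine .inr ⟨hmain.1, by rw [hRR]; exact hRT, ?_⟩
    rw [hRR, hrank]
    -- Without a drop T does not shrink. If no node reaches its threshold, an arc leaving T has
    -- become tight and turns on the extra unit of the rank; otherwise T itself grows.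
    obtain hAe | ⟨i, hi⟩ := A.eq_empty_or_nonempty
    · have hRTeq : R.T = S.T := by
        change S.T ∪ (S.T₀ ∪ A) = S.T
        rw [hAe, Finset.union_empty]
        exact Finset.union_eq_left.2 h.T₀_subset
      have hleave : ∃ i j, R.Leaving i j := by
        rcases ha.progress hP.feasible with ⟨i, hi, heq⟩ | ⟨i, j, hij⟩
        · have : i ∈ A := Finset.mem_filter.2 ⟨hi, heq⟩
          rw [hAe] at this
          exact absurd this (Finset.notMem_empty i)
        · refine ⟨i, j, ?_⟩
          unfold Leaving at hij ⊢
          rw [hRTeq]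
          exact hij
      rw [rank, if_pos (.inr hleave), hRTeq]
      exact Nat.lt_succ_self _
    · have hlt : S.T.card < R.T.card := by
        refine Finset.card_lt_card ⟨hRT, fun hsub => (hAmem i hi).2.1 (hsub ?_)⟩
        exact Finset.mem_union_right _ (Finset.mem_union_right _ hi)
      unfold rank
      omega

/-- The part of an iteration that precedes the contractions. -/
theorem Body.progress (h : Valid t n m S) (hn : 2 ≤ n) (hnm : n ≤ m) (hm : m ≤ n ^ 2)
    (hbody : Body t n S S') (hhalt : S'.halted = false) :
    Valid t n m S' ∧ deficit t n S' ≤ deficit t n S ∧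
      ((∀ c, ¬ S'.Abundant m c) → Progress t n m S S') := by
  unfold Body at hbody
  by_cases h₁ : (low t S ∩ S.T).Nonempty
  · rw [if_pos h₁] at hbody
    obtain ⟨h3, h4, h5⟩ := hbody.valid h
    refine ⟨h3, h4.le, fun _ => .inl ?_⟩
    unfold potential
    rw [h4]
    linarith
  rw [if_neg h₁] at hbody
  by_cases h₂ : ∃ i j, S.Leaving i j
  · rw [if_pos h₂] at hbody
    obtain ⟨i, j, hij, hS'⟩ := hbody
    obtain ⟨h3, h4, h5, h6⟩ := extend_valid h hij hS'
    refine ⟨h3, h4.le, fun _ => .inr ⟨?_, h6⟩⟩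
    unfold potential
    rw [h4, h5]
  · rw [if_neg h₂] at hbody
    have hrank := rank_eq h₁ h₂
    have hnotlow : ∀ i ∈ S.T, i ∉ low t S := fun i hi hlow =>
      h₁ ⟨i, Finset.mem_inter.2 ⟨hlow, hi⟩⟩
    have htT : t ∉ S.T := fun ht => hnotlow t ht (mem_low.2 (.inl rfl))
    have hB : Blocked t S := by
      refine ⟨h.T_subset, htT, fun i j hij => h₂ ⟨i, j, hij⟩, fun i hi => ?_⟩
      by_contra! hlt
      refine hnotlow i hi (mem_low.2 (.inr ⟨Finset.mem_erase.2 ⟨?_, h.T_subset hi⟩, hlt⟩))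
      rintro rfl
      exact htT hi
    obtain ⟨S₁, hpre, hS'⟩ := hbody
    obtain ⟨F, rfl, hP, hcase⟩ : ∃ F, S₁ = { S with f := F } ∧ Prepared t S F ∧
        ((F = S.f ∧ ¬ FiltrationCond t n S) ∨
          (FiltrationCond t n S ∧ Filtered t n S { S with f := F })) := by
      split_ifs at hpre with hc
      · have hF := hB.filtered h.feasible h.scale_pos (by have := h.card_nodes; omega) hc hpre
        obtain ⟨f', -, rfl⟩ := hpre
        exact ⟨_, rfl, hF.prepared hB h hc, .inr ⟨hc, hF⟩⟩
      · subst hpre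
        exact ⟨S₁.f, rfl, hB.prepared h.feasible, .inl ⟨rfl, hc⟩⟩
    split_ifs at hS' with hel
    · have hB₁ : Blocked t { S with f := F } := ⟨h.T_subset, htT, hP.not_leaving, hel.2⟩
      unfold elementaryStep at hS'
      split at hS'
      · subst hS'
        exact absurd hhalt (by simp)
      · next a hα =>
        exact hP.scaleBy h hn hnm hm hrank hcase hB₁ (hB₁.stepLength hP.feasible hα) hS'
    · obtain ⟨h3, h4, h5⟩ := hP.drop h htT hrank hel
      subst hS'
      exact ⟨h3, h4.le, fun _ => h5⟩

/-- One iteration that does not return. -/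
theorem Iteration.progress (h : Valid t n m S) (hn : 2 ≤ n) (hnm : n ≤ m) (hm : m ≤ n ^ 2)
    (hit : Iteration t n m S S') (hhalt : S'.halted = false) :
    Valid t n m S' ∧ Progress t n m S S' := by
  obtain ⟨-, -, S₁, hbody, hrest⟩ := hit
  split_ifs at hrest with hh
  · subst hrest
    rw [hh] at hhalt
    cases hhalt
  · obtain ⟨hcon, hno⟩ := hrest
    obtain ⟨h1, h2, h3⟩ := hbody.progress h hn hnm hm (by simpa using hh)
    obtain ⟨h4, h5⟩ := contractions_valid h1 hcon
    refine ⟨h4, ?_⟩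
    rcases h5 with rfl | h5
    · exact h3 hno
    · left
      -- Contractions lowered `deficit` by at least 2, hence 26m in the potential; `cost` can have
      -- risen by at most 13m, so a drop of 13m ≥ 1 remains.
      have hm1 : (1 : ℝ) ≤ m := by exact_mod_cast (show 1 ≤ m by omega)
      have h6 := h4.cost_le hnm
      have h7 := h.cost_nonneg
      have h8 : 13 * (m : ℝ) * deficit t n S' ≤ 13 * m * (deficit t n S - 2) :=
        mul_le_mul_of_nonneg_left (by linarith) (by positivity)
      unfold potential
      linarith

end State

/-! ### The initial state and the count of iterations -/

namespace State

open Network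

variable {V : Type*} {t : V} {G : Network V} {S S' : State V} {n m : ℕ}

/-- The facts about the initial state that are used. -/
theorem Initial.feasible (hG : G.WellFormed t) (h : Initial t G S) :
    S.net = G ∧ G.Labeling t S.μ ∧ G.IsTightFlow t S.μ G.nodes S.f ∧
      (∀ i ∈ G.nodes.erase t, 0 ≤ G.relExcess S.f S.μ i ∧ G.relExcess S.f S.μ i ≤ S.Δ) ∧
      (∃ i ∈ G.nodes.erase t, S.Δ = G.relExcess S.f S.μ i) ∧
      S.T₀ = ∅ ∧ S.T = ∅ ∧ S.k = 0 := by
  obtain ⟨⟨g, -, hg, ht, hμ⟩, hf, hΔ, hnet, hT₀, hT, hk, -⟩ := h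
  have hl := hG.labeling hg ht hμ
  exact ⟨hnet, hl, hf, fun i hi => ⟨(hf.relExcess_mem hl hi).1, hΔ.2 ⟨i, hi, rfl⟩⟩, hΔ.1,
    hT₀, hT, hk⟩

theorem Initial.valid (hG : G.WellFormed t) (h : Initial t G S) (hΔ : 0 < S.Δ) :
    Valid t G.nodes.card G.arcs.card S := by
  obtain ⟨hnet, hl, hf, he, -, hT₀, hT, hk⟩ := h.feasible hG
  subst hnet
  refine ⟨⟨hl, fun a _ => hf.nonneg hl a, fun a _ hlt => ?_, fun i hi => ?_, fun i hi => ?_⟩,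
    hΔ, le_rfl, by rw [hk]; rfl, by rw [hT₀]; exact Finset.empty_subset _,
    by rw [hT]; exact Finset.empty_subset _, by rw [hT₀]; exact Finset.notMem_empty _,
    fun i hi => ?_⟩
  · rw [hf.eq_zero_of_lt hlt, zero_div]
    exact hΔ.le
  · refine le_trans (le_of_eq ?_) (he i hi).1
    refine Finset.sum_eq_zero fun a ha => ?_
    rw [Finset.mem_filter] at ha
    rw [hf.eq_zero_of_lt ha.2.2]
    simp
  · have h1 : (0 : ℝ) ≤ S.net.degree i := Nat.cast_nonneg _
    have h2 := (he i hi).2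
    nlinarith [mul_nonneg h1 hΔ.le]
  · rw [hT₀] at hi
    exact absurd hi (Finset.notMem_empty i)

/-- If all excesses vanish initially, the algorithm returns at once. -/
theorem Initial.halted (hG : G.WellFormed t) (h : Initial t G S) (hΔ : S.Δ ≤ 0)
    (hit : Iteration t n m S S') : S'.halted = true := by
  obtain ⟨hnet, hl, hf, he, ⟨j, hj, hΔj⟩, hT₀, hT, hk⟩ := h.feasible hG
  subst hnet
  have he0 : ∀ i ∈ S.net.nodes.erase t, S.net.excess S.f i = 0 := by
    intro i hi
    have h1 : S.net.relExcess S.f S.μ i = 0 :=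
      le_antisymm ((he i hi).2.trans hΔ) (he i hi).1
    have h2 := hl.label_pos i (Finset.mem_of_mem_erase hi)
    rw [relExcess, div_eq_zero_iff] at h1
    exact h1.resolve_right h2.ne'
  have hα : α t S = ⊤ := by
    refine top_le_iff.1 (le_min (Finset.le_inf fun i hi => ?_) (Finset.le_inf fun c hc => ?_))
    · rw [hT, Finset.sdiff_empty] at hi
      have h1 : S.r₁ i = 0 := by
        refine Finset.sum_eq_zero fun a ha => ?_
        simp only [Finset.mem_filter, nonTight] at ha
        rw [hf.eq_zero_of_lt ha.2.2.1.2, mul_zero]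
      have h3 : S.r₃ i = 0 := by
        refine Finset.sum_eq_zero fun a ha => ?_
        obtain ⟨-, -, h4⟩ := mem_decreasing.1 (Finset.mem_filter.1 ha).2.2
        rw [hT] at h4
        exact hf.eq_zero_of_lt (h4.resolve_left (Finset.notMem_empty _))
      have h5 := he0 i hi
      rw [excess_eq, h1, h3] at h5
      -- With T empty and no flow on non-tight arcs, the denominator of δ_i is the excess itself,
      -- which is 0 here.
      have h6 : S.r₂ i - S.r₄ i - S.net.demand i = 0 := by linarith
      rw [δ, if_pos h6]
    · rw [hT] at hc
      exact absurd (Finset.mem_filter.1 hc).2.1 (Finset.notMem_empty _)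
  obtain ⟨-, -, S₁, hbody, hrest⟩ := hit
  have hS₁ : S₁.halted = true := by
    unfold Body at hbody
    rw [if_neg (by simp [hT]), if_neg] at hbody
    · obtain ⟨S₂, h2, h3⟩ := hbody
      -- An absolute value cannot lie below Δ ≤ 0, and there is a node j to test. Elementary Step
      -- then runs on the unchanged flow, its conditions being vacuous for empty T₀ and T.
      have hc : ¬ FiltrationCond t n S := by
        intro hc
        have h4 := hc j (by rw [hT, Finset.sdiff_empty]; exact hj)
        have h5 : S.Δ / (16 ^ S.k * n) ≤ 0 := div_nonpos_of_nonpos_of_nonneg hΔ (by positivity)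
        linarith [abs_nonneg (S.net.relDemand S.μ j)]
      rw [if_neg hc] at h2
      subst h2
      rw [if_pos ⟨by simp [hT₀], by simp [hT]⟩] at h3
      rw [h3, elementaryStep, hα]
    · rintro ⟨i, j, hi, -⟩
      rw [hT] at hi
      exact absurd hi (Finset.notMem_empty _)
  rw [if_pos hS₁] at hrest
  rw [hrest, hS₁]

/-- As k = 0, each of the n − 1 gaps is at most 6 + 2n, so `deficit` ≤ (n−1)(8n+6) = 8n² − 2n − 6;
one more 13m covers `cost`. -/
theorem Initial.potential_le (hG : G.WellFormed t) (h : Initial t G S) (hΔ : 0 < S.Δ)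
    (hnm : G.nodes.card ≤ G.arcs.card) :
    potential t G.nodes.card G.arcs.card S ≤
      13 * G.arcs.card * (8 * G.nodes.card ^ 2 - 2 * G.nodes.card - 5) := by
  have hv := h.valid hG hΔ
  obtain ⟨hnet, -, -, -, -, -, -, hk⟩ := h.feasible hG
  have h1 := hv.cost_le hnm
  have h2 : ∑ i ∈ S.net.nodes.erase t, S.gap G.nodes.card i ≤
      (G.nodes.card - 1) * (6 + 2 * G.nodes.card) := by
    refine (Finset.sum_le_card_nsmul _ _ (6 + 2 * (G.nodes.card : ℝ)) fun i _ => ?_).trans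
      (le_of_eq ?_)
    · have := gap_le (S := S) (n := G.nodes.card) i
      rw [hk] at this
      simpa using this
    · rw [nsmul_eq_mul, hnet, ← Finset.card_erase_add_one hG.sink_mem]
      push_cast
      ring
  have h3 : deficit t G.nodes.card S ≤ (G.nodes.card - 1) * (6 + 2 * G.nodes.card) +
      6 * G.nodes.card * (G.nodes.card - 1) := by
    unfold deficit
    rw [hnet] at h2 ⊢
    linarith
  have h4 : 13 * (G.arcs.card : ℝ) * deficit t G.nodes.card S ≤
      13 * G.arcs.card * ((G.nodes.card - 1) * (6 + 2 * G.nodes.card) +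
        6 * G.nodes.card * (G.nodes.card - 1)) :=
    mul_le_mul_of_nonneg_left h3 (by positivity)
  unfold potential
  linarith

theorem Valid.rank_le (h : Valid t n m S) : rank t S ≤ 2 * n + 1 := by
  have h1 := Finset.card_le_card h.T_subset
  have h2 := h.card_nodes
  unfold rank
  split_ifs <;> omega

/-- The potential bounds the number of iterations and of shrinking iterations. -/
theorem iterations_le {S : ℕ → State V} (h₀ : Valid t n m (S 0)) {ℓ : ℕ}
    (hstep : ∀ j < ℓ, Valid t n m (S j) →
      Valid t n m (S (j + 1)) ∧ Progress t n m (S j) (S (j + 1))) :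
    Valid t n m (S ℓ) ∧
    (ℓ : ℝ) ≤ (2 * n + 2) * (potential t n m (S 0) - potential t n m (S ℓ)) + rank t (S ℓ) ∧
    (((Finset.range ℓ).filter fun j => Shrinking (S j) (S (j + 1))).card : ℝ) ≤
      potential t n m (S 0) - potential t n m (S ℓ) := by
  induction ℓ with
  | zero => exact ⟨h₀, by simp, by simp⟩
  | succ ℓ ih =>
    obtain ⟨hv, h1, h2⟩ := ih fun j hj => hstep j (by omega)
    obtain ⟨hv', hp⟩ := hstep ℓ (Nat.lt_succ_self ℓ) hv
    refine ⟨hv', ?_⟩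
    rw [Finset.range_add_one, Finset.filter_insert]
    -- A drop of the potential by 1 is worth 2n+2: at most 2n+1 for the lost rank, and one for the
    -- iteration. In the other case the rank counts the iteration, and T only grows, so it is not
    -- shrinking.
    rcases hp with hp | ⟨hp, hT, hrank⟩
    · constructor
      · have h3 : ((rank t (S ℓ) : ℕ) : ℝ) ≤ 2 * n + 1 := by exact_mod_cast hv.rank_le
        have h4 : (0 : ℝ) ≤ (rank t (S (ℓ + 1)) : ℕ) := Nat.cast_nonneg _
        have h5 : (2 * (n : ℝ) + 2) * potential t n m (S (ℓ + 1)) ≤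
            (2 * n + 2) * (potential t n m (S ℓ) - 1) :=
          mul_le_mul_of_nonneg_left hp (by positivity)
        push_cast
        linarith
      · have h3 : ((if Shrinking (S ℓ) (S (ℓ + 1)) then
            insert ℓ ((Finset.range ℓ).filter fun j => Shrinking (S j) (S (j + 1)))
            else (Finset.range ℓ).filter fun j => Shrinking (S j) (S (j + 1))).card : ℝ) ≤
            ((Finset.range ℓ).filter fun j => Shrinking (S j) (S (j + 1))).card + 1 := by
          split_ifs
          · exact_mod_cast Finset.card_insert_le _ _
          · linarith
        linarith
    · constructor
      · have h3 : ((rank t (S ℓ) : ℕ) : ℝ) + 1 ≤ (rank t (S (ℓ + 1)) : ℕ) := by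
          exact_mod_cast hrank
        have h5 : (2 * (n : ℝ) + 2) * potential t n m (S (ℓ + 1)) ≤
            (2 * n + 2) * potential t n m (S ℓ) :=
          mul_le_mul_of_nonneg_left hp (by positivity)
        push_cast
        linarith
      · have h3 : ¬ Shrinking (S ℓ) (S (ℓ + 1)) := by
          unfold Shrinking
          rw [Finset.sdiff_eq_empty_iff_subset.2 hT]
          exact Finset.not_nonempty_empty
        rw [if_neg h3]
        linarith

end State

end GenFlow

/-! ### The numerical bounds -/

theorem mainTheorem4 {V : Type*} (G : GenFlow.Network V) (t : V) (n m : ℕ)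
    (hG : G.WellFormed t)
    (hn : n = G.nodes.card) (hm : m = G.arcs.card) (hnm : n ≤ m)
    (hroot : ∀ i ∈ G.nodes, i ≠ t → (i, t) ∈ G.arcs)
    (hfeas : ∃ f, G.Feasible t f)
    (hbdd : BddAbove {x : ℝ | ∃ f, G.Feasible t f ∧ x = G.netInflow f t})
    (τ : ℕ) (S : ℕ → GenFlow.State V)
    (hinit : GenFlow.State.Initial t G (S 0))
    (hrun : ∀ j < τ, GenFlow.State.Iteration t n m (S j) (S (j + 1))) :
    τ ≤ 390 * n ^ 3 * m ∧
    ((Finset.range τ).filter fun j => GenFlow.Shrinking (S j) (S (j + 1))).card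
      ≤ 195 * n ^ 2 * m := by
  obtain rfl | hτ := Nat.eq_zero_or_pos τ
  · simp
  have hn2 : 2 ≤ n := by
    have h1 := (hrun 0 hτ).2.1
    have h2 : (S 0).net = G := hinit.2.2.2.1
    rw [h2] at h1
    omega
  have hm1 : 1 ≤ m := by omega
  -- The potential needs Δ > 0; otherwise the first iteration returns and is the only one.
  obtain hΔ | hΔ := le_or_gt (S 0).Δ 0
  · have h1 : τ ≤ 1 := by
      by_contra! hlt
      have h2 := hinit.halted hG hΔ (hrun 0 hτ)
      have h3 := (hrun 1 hlt).1
      rw [h2] at h3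
      cases h3
    have h2 : 1 ≤ n ^ 2 * m := Nat.mul_pos (by positivity) hm1
    have h3 : 1 ≤ n ^ 3 * m := Nat.mul_pos (by positivity) hm1
    have h4 := Finset.card_filter_le (Finset.range τ)
      fun j => GenFlow.Shrinking (S j) (S (j + 1))
    rw [Finset.card_range] at h4
    constructor
    · linarith
    · linarith
  -- The last iteration may return and is counted separately; all earlier ones are known not to
  -- return, since another iteration follows.
  obtain ⟨ℓ, rfl⟩ : ∃ ℓ, τ = ℓ + 1 := ⟨τ - 1, by omega⟩
  have hmn : m ≤ n ^ 2 := by rw [hn, hm]; exact hG.card_arcs_le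
  have hv := hinit.valid hG hΔ
  have hpot := hinit.potential_le hG hΔ (by rw [← hn, ← hm]; exact hnm)
  rw [← hn, ← hm] at hv hpot
  obtain ⟨hv', h1, h2⟩ := GenFlow.State.iterations_le hv (ℓ := ℓ) fun j hj hvj =>
    (hrun j (by omega)).progress hvj hn2 hnm hmn (hrun (j + 1) (by omega)).1
  have h3 := hv'.potential_nonneg
  have h4 : ((GenFlow.State.rank t (S ℓ) : ℕ) : ℝ) ≤ 2 * n + 1 := by exact_mod_cast hv'.rank_le
  have hn' : (2 : ℝ) ≤ n := by exact_mod_cast hn2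
  have hm' : (1 : ℝ) ≤ m := by exact_mod_cast hm1
  have hpot' : GenFlow.State.potential t n m (S 0) + 1 ≤ 104 * (n ^ 2 * m) := by
    nlinarith [mul_nonneg (by linarith : (0 : ℝ) ≤ m) (by linarith : (0 : ℝ) ≤ n)]
  have hnm2 : (0 : ℝ) ≤ n ^ 2 * m := by positivity
  constructor
  · have h5 : ((ℓ + 1 : ℕ) : ℝ) ≤ 390 * n ^ 3 * m := by
      push_cast
      calc (ℓ : ℝ) + 1 ≤ (2 * n + 2) * (GenFlow.State.potential t n m (S 0) -
            GenFlow.State.potential t n m (S ℓ)) + (2 * n + 1) + 1 := by linarith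
        _ ≤ (2 * n + 2) * (GenFlow.State.potential t n m (S 0) + 1) := by nlinarith
        _ ≤ (2 * n + 2) * (104 * (n ^ 2 * m)) := by gcongr
        -- Here n ≥ 2 gives 2n + 2 ≤ 3n; the result 312 n³m is within the bound.
        _ ≤ 3 * n * (104 * (n ^ 2 * m)) := by gcongr; linarith
        _ ≤ 390 * n ^ 3 * m := by nlinarith [mul_nonneg (by linarith : (0 : ℝ) ≤ n) hnm2]
    exact_mod_cast h5
  · have h5 : (((Finset.range (ℓ + 1)).filter fun j =>
        GenFlow.Shrinking (S j) (S (j + 1))).card : ℝ) ≤ 195 * n ^ 2 * m := by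
      have h6 : (((Finset.range (ℓ + 1)).filter fun j =>
          GenFlow.Shrinking (S j) (S (j + 1))).card : ℝ) ≤
          ((Finset.range ℓ).filter fun j => GenFlow.Shrinking (S j) (S (j + 1))).card + 1 := by
        rw [Finset.range_add_one, Finset.filter_insert]
        split_ifs
        · exact_mod_cast Finset.card_insert_le _ _
        · linarith
      linarith
    exact_mod_cast h5
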